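/- **Construction of the main space $W$.** Write points of frequency space $\mathbb{R}\times\mathbb{R}$ as $(\tau,\xi)$, and put $\langle x\rangle=(1+x^2)^{1/2}$. Functions are complex-valued, measurable, and identified when equal almost everywhere; a function is *reasonable* if it lies in $L^\infty(\mathbb{R}\times\mathbb{R})$ and has compact support. For integers $j,d\ge 0$ let $$A_j=\{2^j\le\langle\xi\rangle<2^{j+1}\},\qquad B_d=\{2^d\le\langle\tau-\xi^2\rangle<2^{d+1}\},$$ and define the ($[0,\infty]$-valued) norms $$\|f\|_{\hat X^{s,b}}=\|\langle\xi\rangle^s\langle\tau-\xi^2\rangle^b f\|_{L^2_\tau L^2_\xi},\qquad \|f\|_{\hat X^{-1,1/2,1}}=\Big(\sum_{j\ge0}2^{-2j}\Big(\sum_{d\ge0}2^{d/2}\|f\|_{L^2_\xi L^2_\tau(A_j\cap B_d)}\Big)^2\Big)^{1/2},$$ $$\|f\|_Y=\|\langle\xi\rangle^{-1}f\|_{L^2_\xi L^1_\tau}+\|f\|_{L^2_\xi L^2_\tau},\qquad \|f\|_Z=\inf_{f=f_1+f_2}\big(\|f_1\|_{\hat X^{-1,1/2,1}}+\|f_2\|_Y\big).$$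 Let $w(\tau,\xi)=\max(1,-\tau)^{10}$. Then there is a constant $c>0$ such that $$W=\{f:\ \|wf\|_Z<\infty\},\qquad \|f\|_W=c\,\|wf\|_Z,$$ is a Banach space which contains the reasonable functions as a dense subspace, and which has the following properties, where $C$ denotes absolute constants and $\|f\|_W=\infty$ if $f\notin W$. 1. (Monotonicity) If $f,g$ are measurable and $|f|\le|g|$ almost everywhere, then $\|f\|_W\le\|g\|_W$. In particular $\|f\|_W=\||f|\|_W$. 2. ($H^{-1}$ energy estimate) $\|\langle\xi\rangle^{-1}f\|_{L^2_\xi L^1_\tau}\le C\|f\|_W$ for all reasonable $f$. 3. (Homogeneous $H^{-1}$ solution estimate) $\|f\|_W\le C\|f\|_{\hat X^{-1,100}}$ for all reasonable $f$. 4. (Bilinear estimate) $\|\langle\tau-\xi^2\rangle^{-1}(f*g)\|_W\le\|f\|_W\|g\|_W$ for all reasonable $f,g$, where $f*g$ is the convolution on $\mathbb{R}\times\mathbb{R}$. -/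

import Mathlib

open MeasureTheory Set
open scoped ENNReal NNReal

namespace FrequencySpace

noncomputable section

/-- Frequency space; a point is a pair `(τ, ξ)` of a time and a space frequency. -/
abbrev Freq : Type := ℝ × ℝ

/-- The Japanese bracket `⟨x⟩ = (1 + x²)^{1/2}`. -/
def jap (x : ℝ) : ℝ := Real.sqrt (1 + x ^ 2)

/-- The modulation weight `⟨τ - ξ²⟩`. -/
def modulation (p : Freq) : ℝ := jap (p.1 - p.2 ^ 2)

/-- Reasonable functions: essentially bounded (and measurable) with compact support. -/
def IsReasonable (f : Freq → ℂ) : Prop := MemLp f ∞ volume ∧ HasCompactSupport f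

/-- The norm of `X̂^{s,b}`: the `L²` norm of `⟨ξ⟩^s ⟨τ - ξ²⟩^b f`. -/
def normXhat (s b : ℝ) (f : Freq → ℂ) : ℝ≥0∞ :=
  eLpNorm (fun p : Freq => (jap p.2 ^ s * modulation p ^ b) • f p) 2 volume

/-- The mixed norm `L²_ξ L¹_τ`. -/
def normL2L1 (f : Freq → ℂ) : ℝ≥0∞ :=
  (∫⁻ ξ : ℝ, (∫⁻ τ : ℝ, ‖f (τ, ξ)‖ₑ) ^ 2) ^ (1 / 2 : ℝ)

/-- The norm `‖⟨ξ⟩⁻¹ f‖` in `L²_ξ L¹_τ`. -/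
def normEnergy (f : Freq → ℂ) : ℝ≥0∞ :=
  normL2L1 (fun p => (jap p.2)⁻¹ • f p)

/-- The spatial annulus `A_j = {2^j ≤ ⟨ξ⟩ < 2^{j+1}}`. -/
def annulus (j : ℕ) : Set Freq := {p | 2 ^ j ≤ jap p.2 ∧ jap p.2 < 2 ^ (j + 1)}

/-- The parabolic neighbourhood `B_d = {2^d ≤ ⟨τ - ξ²⟩ < 2^{d+1}}`. -/
def parabolic (d : ℕ) : Set Freq := {p | 2 ^ d ≤ modulation p ∧ modulation p < 2 ^ (d + 1)}

/-- The Besov-type norm of `X̂^{s,b,1}`: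
`(∑_j (2^{sj} ∑_d 2^{bd} ‖f‖_{L²(A_j ∩ B_d)})²)^{1/2}`. -/
def normBesov (s b : ℝ) (f : Freq → ℂ) : ℝ≥0∞ :=
  (∑' j : ℕ, ((2 : ℝ≥0∞) ^ (s * (j : ℝ)) *
    ∑' d : ℕ, (2 : ℝ≥0∞) ^ (b * (d : ℝ)) *
      eLpNorm f 2 (volume.restrict (annulus j ∩ parabolic d))) ^ 2) ^ (1 / 2 : ℝ)

/-- The norm of `Y`: `‖⟨ξ⟩⁻¹ f‖_{L²_ξ L¹_τ} + ‖f‖_{L²_ξ L²_τ}`. -/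
def normY (f : Freq → ℂ) : ℝ≥0∞ := normEnergy f + eLpNorm f 2 volume

/-- The norm of the sum space `Z = X̂^{-1,1/2,1} + Y`. -/
def normZ (f : Freq → ℂ) : ℝ≥0∞ :=
  ⨅ (f₁ : Freq → ℂ) (f₂ : Freq → ℂ) (_ : AEStronglyMeasurable f₁ volume)
    (_ : AEStronglyMeasurable f₂ volume) (_ : f =ᵐ[volume] f₁ + f₂),
    normBesov (-1) (1 / 2) f₁ + normY f₂

/-- The weight `w(τ, ξ) = max(1, -τ)^{10}`. -/
def weight (p : Freq) : ℝ := max 1 (-p.1) ^ 10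

/-- For a normed space `E` of (classes of) functions on frequency space, realised by `ι`: the norm
in `E` of a function `f`, equal to `∞` if `f` does not belong to `E`. For injective `ι` at most one
`x` contributes to the infimum. -/
def extNorm {E : Type} [NormedAddCommGroup E] [NormedSpace ℂ E]
    (ι : E →ₗ[ℂ] (Freq →ₘ[volume] ℂ)) (f : Freq → ℂ) : ℝ≥0∞ :=
  ⨅ (x : E) (_ : (ι x : Freq → ℂ) =ᵐ[volume] f), ‖x‖ₑ

/-- Spacetime convolution `f * g (p) = ∫ f(p₁) g(p - p₁) dp₁`. -/
def conv (f g : Freq → ℂ) : Freq → ℂ :=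
  convolution f g (ContinuousLinearMap.mul ℂ ℂ) volume

end

end FrequencySpace

/-!
All norms in question depend on the modulus of a function only, and are studied as functionals on
`[0, ∞]`-valued functions. Such a functional which is monotone, homogeneous, countably subadditive
and satisfies dominated convergence (`IsFunctionNorm`) defines, if it is definite, a Banach space of
functions (`IsFunctionNorm.exists_banachSpace`), in which truncations are dense
(`dense_reasonable`). These properties pass to weighted norms, compositions and sums of spaces,
hence hold for the norm of `W`, which also gives monotonicity. The energy estimate is the embedding
of `Z` into the energy space (`energyNorm_le_zNorm`), and the solution estimate holds since
`X̂^{-1,9/16}` embeds into `X̂^{-1,1/2,1}` (`exists_besovNorm_le_l2norm_xWeight`) and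
`w ≤ ⟨τ - ξ²⟩^{10}`.

The constant `c` serves to absorb the constant in the bilinear estimate, which is the main point.
For this only two facts about the inputs are used: they lie in the energy space, and in `L²` with
the weight `ρ = min(1, ⟨ξ⟩⁻¹ ⟨τ - ξ²⟩^{1/2})` (`l2norm_rho_le_zNorm`). The convolution, with the
weights `w` and the factor `⟨τ - ξ²⟩⁻¹`, is an integral operator with kernel `mainKernel`, and
`kernel_bound` is a pointwise dichotomy: the kernel is dominated either by `xKernel`, whose output
is estimated in `X̂^{-1,9/16}`, or by both `energyKernel` and `squareKernel`, whose outputs are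
estimated in the energy space and in `L²`, so that the output lies in `Y`. The dichotomy
distinguishes whether the inputs are near the parabola `τ = ξ²` (modulation below `⟨ξ⟩² / 64`, where
`ρ` is `⟨ξ⟩⁻¹ ⟨τ - ξ²⟩^{1/2}` and `τ` is positive) or far from it (where `ρ ≥ 1 / 8`).

If both inputs are near, the resonance identity
`(τ₁ - ξ₁²) + (τ₂ - ξ₂²) - (τ₁ + τ₂ - (ξ₁ + ξ₂)²) = 2 ξ₁ ξ₂` shows that the output modulation is
large, or that one spatial frequency dominates. If both are far and the output lies in `Y`, its
energy is governed by the kernel `⟨τ₁ + τ₂⟩⁻¹` in the time frequencies, which barely fails to be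
bounded on `L²`. The weight `w` penalizes the cancellation of a positive and a negative time
frequency and improves the kernel to `1 / max(⟨τ₁⟩, ⟨τ₂⟩)` (`weight_add_mul_max_jap_le`), for which
Hilbert's inequality holds (`exists_hilbert_inequality`).

The `L²` estimates needed for the three kernels reduce to three elementary ones, each obtained from
the Cauchy–Schwarz inequality on pairs of frequencies with a common sum or a common factor:
`l2Bounded_xiPow_modPow_sum`, `l2Bounded_modPow_mul_modPow` and `l2Bounded_modPow_sum_mul_modPow`.
-/

open Filter Topology

namespace FrequencySpace

/-! ### Function norms and their Banach spaces -/

/-- A functional on `[0, ∞]`-valued functions with the properties of an absolutely continuous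
Banach function norm, except for definiteness: it is monotone, homogeneous, countably subadditive,
and satisfies dominated convergence. -/
structure IsFunctionNorm {α : Type*} [MeasurableSpace α] (μ : Measure α)
    (N : (α → ℝ≥0∞) → ℝ≥0∞) : Prop where
  mono : ∀ u v : α → ℝ≥0∞, u ≤ᵐ[μ] v → N u ≤ N v
  const_mul : ∀ (c : ℝ≥0) (u : α → ℝ≥0∞), AEMeasurable u μ → N (fun x => c * u x) = c * N u
  tsum_le : ∀ u : ℕ → α → ℝ≥0∞, (∀ n, AEMeasurable (u n) μ) →
    N (fun x => ∑' n, u n x) ≤ ∑' n, N (u n)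
  tendsto_zero : ∀ (u : ℕ → α → ℝ≥0∞) (v : α → ℝ≥0∞), (∀ n, AEMeasurable (u n) μ) →
    AEMeasurable v μ → (∀ n, u n ≤ᵐ[μ] v) → N v ≠ ∞ →
    (∀ᵐ x ∂μ, Tendsto (fun n => u n x) atTop (𝓝 0)) → Tendsto (fun n => N (u n)) atTop (𝓝 0)

namespace IsFunctionNorm

variable {α : Type*} [MeasurableSpace α] {μ : Measure α} {N : (α → ℝ≥0∞) → ℝ≥0∞}

theorem congr_ae (hN : IsFunctionNorm μ N) {u v : α → ℝ≥0∞} (h : u =ᵐ[μ] v) : N u = N v :=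
  le_antisymm (hN.mono _ _ h.le) (hN.mono _ _ h.symm.le)

theorem zero (hN : IsFunctionNorm μ N) : N (fun _ => 0) = 0 := by
  have := hN.const_mul 0 (fun _ => 0) aemeasurable_const
  simpa using this

theorem add_le (hN : IsFunctionNorm μ N) {u v : α → ℝ≥0∞} (hu : AEMeasurable u μ)
    (hv : AEMeasurable v μ) : N (fun x => u x + v x) ≤ N u + N v := by
  have h := hN.tsum_le (fun n => if n = 0 then u else if n = 1 then v else fun _ => 0) (by
    intro n
    split_ifs
    exacts [hu, hv, aemeasurable_const])
  have h2 : ∀ g : ℕ → ℝ≥0∞, (∀ n, 2 ≤ n → g n = 0) → ∑' n, g n = g 0 + g 1 := by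
    intro g hg
    rw [tsum_eq_sum (s := Finset.range 2)]
    · simp [Finset.sum_range_succ]
    · intro n hn
      exact hg n (by simpa [Nat.lt_iff_add_one_le] using hn)
  rw [h2] at h
  · refine le_trans (hN.mono _ _ (ae_of_all _ fun x => ?_)) (h.trans ?_)
    · refine le_of_eq ?_
      dsimp only
      rw [h2]
      · simp
      · intro n hn
        have h0 : n ≠ 0 := by omega
        have h1 : n ≠ 1 := by omega
        simp [h0, h1]
    · simp
  · intro n hn
    have h0 : n ≠ 0 := by omega
    have h1 : n ≠ 1 := by omega
    simp [h0, h1, hN.zero]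

theorem comp_mul (hN : IsFunctionNorm μ N) {w : α → ℝ≥0∞} (hw : AEMeasurable w μ)
    (hw_top : ∀ x, w x ≠ ∞) : IsFunctionNorm μ (fun u => N (fun x => w x * u x)) where
  mono u v h := hN.mono _ _ (h.mono fun x hx => mul_le_mul_right hx _)
  const_mul c u hu := by
    rw [← hN.const_mul c (fun x => w x * u x) (hw.mul hu)]
    congr 1
    ext x
    exact mul_left_comm _ _ _
  tsum_le u hu := by
    simp_rw [← ENNReal.tsum_mul_left]
    exact hN.tsum_le _ fun n => hw.mul (hu n)
  tendsto_zero u v hu hv huv hNv hlim := by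
    refine hN.tendsto_zero _ _ (fun n => hw.mul (hu n)) (hw.mul hv)
      (fun n => (huv n).mono fun x hx => mul_le_mul_right hx _) hNv (hlim.mono fun x hx => ?_)
    simpa using ENNReal.Tendsto.const_mul hx (Or.inr (hw_top x))

theorem smul (hN : IsFunctionNorm μ N) (c : ℝ≥0) : IsFunctionNorm μ (fun u => c * N u) where
  mono u v h := mul_le_mul_right (hN.mono _ _ h) _
  const_mul a u hu := by rw [hN.const_mul a u hu]; ring
  tsum_le u hu := by
    rw [ENNReal.tsum_mul_left]
    exact mul_le_mul_right (hN.tsum_le u hu) _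
  tendsto_zero u v hu hv huv hNv hlim := by
    rcases eq_or_ne c 0 with rfl | hc
    · simp
    · have : N v ≠ ∞ := by
        intro h
        simp [h, hc] at hNv
      simpa using ENNReal.Tendsto.const_mul (hN.tendsto_zero u v hu hv huv this hlim)
        (Or.inr ENNReal.coe_ne_top)

theorem add {N' : (α → ℝ≥0∞) → ℝ≥0∞} (hN : IsFunctionNorm μ N) (hN' : IsFunctionNorm μ N') :
    IsFunctionNorm μ (fun u => N u + N' u) where
  mono u v h := add_le_add (hN.mono _ _ h) (hN'.mono _ _ h)
  const_mul a u hu := by rw [hN.const_mul a u hu, hN'.const_mul a u hu, mul_add]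
  tsum_le u hu := by
    rw [ENNReal.tsum_add]
    exact add_le_add (hN.tsum_le u hu) (hN'.tsum_le u hu)
  tendsto_zero u v hu hv huv hNv hlim := by
    rw [ENNReal.add_ne_top] at hNv
    simpa using (hN.tendsto_zero u v hu hv huv hNv.1 hlim).add
      (hN'.tendsto_zero u v hu hv huv hNv.2 hlim)

/-- For a definite function norm, finiteness of the norm forces finiteness almost everywhere:
the function `∞ · 1_{u = ∞}` is at most `u / n` for every `n`. -/
theorem ae_lt_top (hN : IsFunctionNorm μ N)
    (hz : ∀ u : α → ℝ≥0∞, AEMeasurable u μ → N u = 0 → u =ᵐ[μ] 0)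
    {u : α → ℝ≥0∞} (hu : AEMeasurable u μ) (h : N u ≠ ∞) : ∀ᵐ x ∂μ, u x < ∞ := by
  let φ : ℝ≥0∞ → ℝ≥0∞ := fun t => if t = ∞ then ∞ else 0
  have hφ : Measurable φ := Measurable.ite (measurableSet_singleton _) measurable_const
    measurable_const
  have hv : AEMeasurable (fun x => φ (u x)) μ := hφ.comp_aemeasurable hu
  have hle : ∀ n : ℕ, (n : ℝ≥0∞) * N (fun x => φ (u x)) ≤ N u := by
    intro n
    have := hN.const_mul n _ hv
    rw [ENNReal.coe_natCast] at this
    rw [← this]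
    refine hN.mono _ _ (ae_of_all _ fun x => ?_)
    dsimp only [φ]
    split_ifs with hx
    · simp [hx]
    · simp
  have hzero : N (fun x => φ (u x)) = 0 := by
    by_contra hne
    obtain ⟨n, hn⟩ := ENNReal.exists_nat_mul_gt hne h
    exact absurd (hle n) (not_le.2 hn)
  filter_upwards [hz _ hv hzero] with x hx
  rw [lt_top_iff_ne_top]
  intro hx'
  simp [φ, hx'] at hx

/-- The functions of finite norm, as a subspace of the space of classes of functions. -/
def finiteSubmodule (hN : IsFunctionNorm μ N) : Submodule ℂ (α →ₘ[μ] ℂ) where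
  carrier := {f | N (fun x => ‖f x‖ₑ) ≠ ∞}
  add_mem' {f g} hf hg := by
    have h1 : N (fun x => ‖(f + g) x‖ₑ) ≤ N (fun x => ‖f x‖ₑ + ‖g x‖ₑ) := by
      refine hN.mono _ _ ?_
      filter_upwards [AEEqFun.coeFn_add f g] with x hx
      rw [hx]
      exact enorm_add_le _ _
    exact ne_top_of_le_ne_top (ENNReal.add_ne_top.2 ⟨hf, hg⟩)
      (h1.trans (hN.add_le f.aestronglyMeasurable.enorm g.aestronglyMeasurable.enorm))
  zero_mem' := by
    have : N (fun x => ‖(0 : α →ₘ[μ] ℂ) x‖ₑ) = 0 := by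
      rw [← hN.zero]
      refine hN.congr_ae ?_
      filter_upwards [AEEqFun.coeFn_zero (α := α) (β := ℂ) (μ := μ)] with x hx
      simp [hx]
    simp [this]
  smul_mem' c f hf := by
    have : N (fun x => ‖(c • f) x‖ₑ) = ‖c‖₊ * N (fun x => ‖f x‖ₑ) := by
      rw [← hN.const_mul _ _ f.aestronglyMeasurable.enorm]
      refine hN.congr_ae ?_
      filter_upwards [AEEqFun.coeFn_smul c f] with x hx
      rw [hx, Pi.smul_apply, enorm_smul]
      rfl
    simp only [mem_ofPred_eq, this]
    exact ENNReal.mul_ne_top ENNReal.coe_ne_top hf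

theorem normedSpaceCore (hN : IsFunctionNorm μ N)
    (hz : ∀ u : α → ℝ≥0∞, AEMeasurable u μ → N u = 0 → u =ᵐ[μ] 0) :
    letI : Norm hN.finiteSubmodule := ⟨fun f => (N (fun x => ‖(f : α →ₘ[μ] ℂ) x‖ₑ)).toReal⟩
    NormedSpace.Core ℂ hN.finiteSubmodule :=
  letI : Norm hN.finiteSubmodule := ⟨fun f => (N (fun x => ‖(f : α →ₘ[μ] ℂ) x‖ₑ)).toReal⟩
  { norm_nonneg := fun _ => ENNReal.toReal_nonneg
    norm_smul := fun c f => by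
      change (N _).toReal = ‖c‖ * (N _).toReal
      have : N (fun x => ‖((c • f : hN.finiteSubmodule) : α →ₘ[μ] ℂ) x‖ₑ)
          = ‖c‖₊ * N (fun x => ‖(f : α →ₘ[μ] ℂ) x‖ₑ) := by
        rw [← hN.const_mul _ _ (f : α →ₘ[μ] ℂ).aestronglyMeasurable.enorm]
        refine hN.congr_ae ?_
        filter_upwards [AEEqFun.coeFn_smul c (f : α →ₘ[μ] ℂ)] with x hx
        rw [Submodule.coe_smul, hx, Pi.smul_apply, enorm_smul]
        rfl
      rw [this, ENNReal.toReal_mul]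
      simp
    norm_triangle := fun f g => by
      change (N _).toReal ≤ (N _).toReal + (N _).toReal
      rw [← ENNReal.toReal_add f.2 g.2]
      refine ENNReal.toReal_mono (ENNReal.add_ne_top.2 ⟨f.2, g.2⟩) ?_
      refine le_trans (hN.mono _ _ ?_) (hN.add_le (f : α →ₘ[μ] ℂ).aestronglyMeasurable.enorm
        (g : α →ₘ[μ] ℂ).aestronglyMeasurable.enorm)
      filter_upwards [AEEqFun.coeFn_add (f : α →ₘ[μ] ℂ) g] with x hx
      rw [Submodule.coe_add, hx]
      exact enorm_add_le _ _
    norm_eq_zero_iff := fun f => by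
      change (N _).toReal = 0 ↔ _
      rw [ENNReal.toReal_eq_zero_iff, or_iff_left f.2]
      constructor
      · intro h
        have := hz _ (f : α →ₘ[μ] ℂ).aestronglyMeasurable.enorm h
        refine Subtype.ext (AEEqFun.ext ?_)
        filter_upwards [this, AEEqFun.coeFn_zero (α := α) (β := ℂ) (μ := μ)] with x hx h0
        rw [ZeroMemClass.coe_zero, h0]
        simpa using hx
      · rintro rfl
        rw [← hN.zero]
        refine hN.congr_ae ?_
        filter_upwards [AEEqFun.coeFn_zero (α := α) (β := ℂ) (μ := μ)] with x hx
        simp [hx] }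

/-- Riesz–Fischer: the functions of finite norm, for a definite function norm, form a Banach
space. -/
theorem exists_banachSpace {α : Type} [MeasurableSpace α] {μ : Measure α}
    {N : (α → ℝ≥0∞) → ℝ≥0∞} (hN : IsFunctionNorm μ N)
    (hz : ∀ u : α → ℝ≥0∞, AEMeasurable u μ → N u = 0 → u =ᵐ[μ] 0) :
    ∃ (W : Type) (_ : NormedAddCommGroup W) (_ : NormedSpace ℂ W) (_ : CompleteSpace W)
      (ι : W →ₗ[ℂ] (α →ₘ[μ] ℂ)), Function.Injective ι ∧
      (∀ f : α →ₘ[μ] ℂ, N (fun x => ‖f x‖ₑ) ≠ ∞ → ∃ x, ι x = f) ∧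
      ∀ x, ‖x‖ₑ = N (fun p => ‖ι x p‖ₑ) := by
  let : Norm hN.finiteSubmodule := ⟨fun f => (N (fun x => ‖(f : α →ₘ[μ] ℂ) x‖ₑ)).toReal⟩
  let inst1 : NormedAddCommGroup hN.finiteSubmodule :=
    NormedAddCommGroup.ofCore (hN.normedSpaceCore hz)
  let inst2 : NormedSpace ℂ hN.finiteSubmodule :=
    NormedSpace.ofCore (hN.normedSpaceCore hz)
  have henorm : ∀ x : hN.finiteSubmodule, ‖x‖ₑ = N (fun p => ‖(x : α →ₘ[μ] ℂ) p‖ₑ) := by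
    intro x
    rw [← ofReal_norm]
    exact ENNReal.ofReal_toReal x.2
  have hcoe_sum : ∀ (F : ℕ → hN.finiteSubmodule) (s : Finset ℕ),
      ((∑ i ∈ s, F i : hN.finiteSubmodule) : α →ₘ[μ] ℂ) =ᵐ[μ]
        fun p => ∑ i ∈ s, (F i : α →ₘ[μ] ℂ) p := by
    intro F s
    induction s using Finset.induction_on with
    | empty =>
      filter_upwards [AEEqFun.coeFn_zero (α := α) (β := ℂ) (μ := μ)] with x hx
      simp [hx]
    | insert a s ha ih =>
      rw [Finset.sum_insert ha, Submodule.coe_add]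
      filter_upwards [ih, AEEqFun.coeFn_add (F a : α →ₘ[μ] ℂ)
        ((∑ i ∈ s, F i : hN.finiteSubmodule) : α →ₘ[μ] ℂ)] with x hx h2
      rw [h2, Pi.add_apply, hx, Finset.sum_insert ha]
  refine ⟨hN.finiteSubmodule, inst1, inst2, ?_, hN.finiteSubmodule.subtype,
    Subtype.val_injective, fun f hf => ⟨⟨f, hf⟩, rfl⟩, henorm⟩
  refine NormedAddCommGroup.completeSpace_of_summable_imp_tendsto fun F hF => ?_
  have hsum : ∑' n, N (fun p => ‖(F n : α →ₘ[μ] ℂ) p‖ₑ) ≠ ∞ := by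
    simp_rw [← henorm, ← ofReal_norm]
    exact hF.tsum_ofReal_ne_top
  have hmeas : ∀ n, AEMeasurable (fun p => ‖(F n : α →ₘ[μ] ℂ) p‖ₑ) μ := fun n =>
    (F n : α →ₘ[μ] ℂ).aestronglyMeasurable.enorm
  have hG : N (fun p => ∑' n, ‖(F n : α →ₘ[μ] ℂ) p‖ₑ) ≠ ∞ :=
    ne_top_of_le_ne_top hsum (hN.tsum_le _ hmeas)
  have hae := hN.ae_lt_top hz (AEMeasurable.tsum hmeas) hG
  have hsummable : ∀ᵐ p ∂μ, Summable fun n => (F n : α →ₘ[μ] ℂ) p := by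
    filter_upwards [hae] with p hp
    refine Summable.of_nnnorm (ENNReal.tsum_coe_ne_top_iff_summable.1 ?_)
    exact hp.ne
  have hlim_meas : AEStronglyMeasurable (fun p => ∑' n, (F n : α →ₘ[μ] ℂ) p) μ := by
    refine aestronglyMeasurable_of_tendsto_ae atTop
      (f := fun (k : ℕ) p => ∑ n ∈ Finset.range k, (F n : α →ₘ[μ] ℂ) p) (fun k => ?_) ?_
    · exact Finset.aestronglyMeasurable_fun_sum _
        fun n _ => (F n : α →ₘ[μ] ℂ).aestronglyMeasurable
    · filter_upwards [hsummable] with p hp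
      exact hp.hasSum.tendsto_sum_nat
  let G : α →ₘ[μ] ℂ := AEEqFun.mk _ hlim_meas
  have hGae : G =ᵐ[μ] fun p => ∑' n, (F n : α →ₘ[μ] ℂ) p := AEEqFun.coeFn_mk _ _
  have hGmem : N (fun p => ‖G p‖ₑ) ≠ ∞ := by
    refine ne_top_of_le_ne_top hG (hN.mono _ _ ?_)
    filter_upwards [hGae, hsummable] with p hp hs
    rw [hp]
    exact enorm_tsum_le_tsum_enorm
  refine ⟨⟨G, hGmem⟩, ?_⟩
  rw [tendsto_iff_enorm_sub_tendsto_zero]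
  refine tendsto_of_tendsto_of_tendsto_of_le_of_le tendsto_const_nhds
    (ENNReal.tendsto_sum_nat_add _ hsum) (fun _ => zero_le) fun k => ?_
  rw [enorm_sub_rev, henorm]
  refine le_trans (hN.mono _ _ ?_) (hN.tsum_le _ fun n => hmeas (n + k))
  filter_upwards [hGae, hsummable, hcoe_sum F (Finset.range k),
    AEEqFun.coeFn_sub G ((∑ i ∈ Finset.range k, F i : hN.finiteSubmodule) : α →ₘ[μ] ℂ)]
    with p hp hs hc hd
  rw [Submodule.coe_sub, hd, Pi.sub_apply, hp, hc, ← hs.sum_add_tsum_nat_add k,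
    add_sub_cancel_left]
  exact enorm_tsum_le_tsum_enorm

end IsFunctionNorm


/-! ### Constructions of function norms -/

namespace IsFunctionNorm

variable {α : Type*} [MeasurableSpace α] {μ : Measure α}

theorem of_absolutelyContinuous {ν : Measure α} {N : (α → ℝ≥0∞) → ℝ≥0∞}
    (hN : IsFunctionNorm ν N) (h : ν ≪ μ) : IsFunctionNorm μ N where
  mono u v huv := hN.mono u v (h.ae_le huv)
  const_mul c u hu := hN.const_mul c u (hu.mono_ac h)
  tsum_le u hu := hN.tsum_le u fun n => (hu n).mono_ac h
  tendsto_zero u v hu hv huv hNv hlim := hN.tendsto_zero u v (fun n => (hu n).mono_ac h)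
    (hv.mono_ac h) (fun n => h.ae_le (huv n)) hNv (h.ae_le hlim)

/-- An outer function norm applied to a family of function norms. -/
theorem comp {β : Type*} [MeasurableSpace β] {ν : Measure β} {M : (β → ℝ≥0∞) → ℝ≥0∞}
    {K : β → (α → ℝ≥0∞) → ℝ≥0∞} (hM : IsFunctionNorm ν M) (hK : ∀ b, IsFunctionNorm μ (K b))
    (hmeas : ∀ u, AEMeasurable u μ → AEMeasurable (fun b => K b u) ν)
    (hfin : ∀ u, AEMeasurable u μ → M (fun b => K b u) ≠ ∞ → ∀ᵐ b ∂ν, K b u ≠ ∞) :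
    IsFunctionNorm μ (fun u => M (fun b => K b u)) where
  mono u v h := hM.mono _ _ (ae_of_all _ fun b => (hK b).mono u v h)
  const_mul c u hu := by
    simp_rw [fun b => (hK b).const_mul c u hu]
    exact hM.const_mul c _ (hmeas u hu)
  tsum_le u hu := (hM.mono _ _ (ae_of_all _ fun b => (hK b).tsum_le u hu)).trans
    (hM.tsum_le _ fun n => hmeas _ (hu n))
  tendsto_zero u v hu hv huv hNv hlim := by
    refine hM.tendsto_zero _ _ (fun n => hmeas _ (hu n)) (hmeas v hv)
      (fun n => ae_of_all _ fun b => (hK b).mono _ _ (huv n)) hNv ?_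
    filter_upwards [hfin v hv hNv] with b hb
    exact (hK b).tendsto_zero u v hu hv huv hb hlim

theorem lintegral (μ : Measure α) : IsFunctionNorm μ (fun u => ∫⁻ x, u x ∂μ) where
  mono u v h := lintegral_mono_ae h
  const_mul c u hu := lintegral_const_mul'' _ hu
  tsum_le u hu := (lintegral_tsum hu).le
  tendsto_zero u v hu hv huv hNv hlim := by
    simpa using tendsto_lintegral_of_dominated_convergence' v hu huv hNv hlim

end IsFunctionNorm

/-- The `L²` norm of a `[0, ∞]`-valued function. -/
noncomputable def l2norm {α : Type*} [MeasurableSpace α] (μ : Measure α) (u : α → ℝ≥0∞) : ℝ≥0∞ :=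
  (∫⁻ x, u x ^ 2 ∂μ) ^ (1 / 2 : ℝ)

section l2norm

variable {α : Type*} [MeasurableSpace α] {μ : Measure α}

theorem rpow_half_le_iff {a b : ℝ≥0∞} : a ^ (1 / 2 : ℝ) ≤ b ↔ a ≤ b ^ 2 := by
  rw [one_div, ENNReal.rpow_inv_le_iff (by norm_num)]
  norm_num

theorem sq_rpow_half (a : ℝ≥0∞) : (a ^ 2) ^ (1 / 2 : ℝ) = a := by
  rw [← ENNReal.rpow_natCast, ← ENNReal.rpow_mul]
  norm_num

theorem rpow_half_sq (a : ℝ≥0∞) : (a ^ (1 / 2 : ℝ)) ^ 2 = a := by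
  rw [← ENNReal.rpow_natCast, ← ENNReal.rpow_mul]
  norm_num

theorem l2norm_le_iff {u : α → ℝ≥0∞} {b : ℝ≥0∞} : l2norm μ u ≤ b ↔ ∫⁻ x, u x ^ 2 ∂μ ≤ b ^ 2 :=
  rpow_half_le_iff

theorem l2norm_sq (u : α → ℝ≥0∞) : l2norm μ u ^ 2 = ∫⁻ x, u x ^ 2 ∂μ := rpow_half_sq _

theorem l2norm_mono_ae {u v : α → ℝ≥0∞} (h : u ≤ᵐ[μ] v) : l2norm μ u ≤ l2norm μ v :=
  ENNReal.rpow_le_rpow (lintegral_mono_ae (h.mono fun _ hx => pow_le_pow_left' hx 2)) (by norm_num)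

theorem l2norm_mono {u v : α → ℝ≥0∞} (h : ∀ x, u x ≤ v x) : l2norm μ u ≤ l2norm μ v :=
  l2norm_mono_ae (ae_of_all _ h)

theorem l2norm_add_le {u v : α → ℝ≥0∞} (hu : AEMeasurable u μ) (hv : AEMeasurable v μ) :
    l2norm μ (fun x => u x + v x) ≤ l2norm μ u + l2norm μ v := by
  have := ENNReal.lintegral_Lp_add_le hu hv (p := 2) (by norm_num)
  simpa [l2norm] using this

theorem l2norm_const_mul (c : ℝ≥0∞) {u : α → ℝ≥0∞} (hu : AEMeasurable u μ) :
    l2norm μ (fun x => c * u x) = c * l2norm μ u := by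
  simp_rw [l2norm, mul_pow]
  rw [lintegral_const_mul'' _ (hu.pow_const 2), ENNReal.mul_rpow_of_nonneg _ _ (by norm_num),
    sq_rpow_half]

/-- The Cauchy–Schwarz inequality. -/
theorem lintegral_mul_le_l2norm {u v : α → ℝ≥0∞} (hu : AEMeasurable u μ) (hv : AEMeasurable v μ) :
    ∫⁻ x, u x * v x ∂μ ≤ l2norm μ u * l2norm μ v := by
  have := ENNReal.lintegral_mul_le_Lp_mul_Lq μ Real.HolderConjugate.two_two hu hv
  simpa [l2norm] using this

theorem l2norm_zero : l2norm μ (fun _ => 0) = 0 := by simp [l2norm]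

theorem l2norm_sum_le {u : ℕ → α → ℝ≥0∞} (hu : ∀ n, AEMeasurable (u n) μ) (k : ℕ) :
    l2norm μ (fun x => ∑ n ∈ Finset.range k, u n x) ≤ ∑ n ∈ Finset.range k, l2norm μ (u n) := by
  induction k with
  | zero => simp [l2norm_zero]
  | succ k ih =>
    simp_rw [Finset.sum_range_succ]
    exact (l2norm_add_le (Finset.aemeasurable_fun_sum _ fun n _ => hu n) (hu k)).trans
      (by gcongr)

/-- Minkowski's inequality for countable sums. -/
theorem l2norm_tsum_le {u : ℕ → α → ℝ≥0∞} (hu : ∀ n, AEMeasurable (u n) μ) :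
    l2norm μ (fun x => ∑' n, u n x) ≤ ∑' n, l2norm μ (u n) := by
  rw [l2norm_le_iff]
  have h : ∀ x, (∑' n, u n x) ^ 2 = ⨆ k, (∑ n ∈ Finset.range k, u n x) ^ 2 := by
    intro x
    rw [ENNReal.tsum_eq_iSup_nat, ENNReal.iSup_pow]
  simp_rw [h]
  rw [lintegral_iSup']
  · refine iSup_le fun k => ?_
    rw [← l2norm_le_iff]
    exact (l2norm_sum_le hu k).trans (ENNReal.sum_le_tsum _)
  · exact fun k => (Finset.aemeasurable_fun_sum _ fun n _ => hu n).pow_const 2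
  · refine ae_of_all _ fun x => ?_
    intro k l hkl
    exact pow_le_pow_left' (Finset.sum_le_sum_of_subset (Finset.range_mono hkl)) 2

theorem l2norm_eq_zero {u : α → ℝ≥0∞} (hu : AEMeasurable u μ) (h : l2norm μ u = 0) :
    u =ᵐ[μ] 0 := by
  have h2 : ∫⁻ x, u x ^ 2 ∂μ = 0 := by rw [← l2norm_sq, h]; simp
  rw [lintegral_eq_zero_iff' (hu.pow_const 2)] at h2
  filter_upwards [h2] with x hx
  simpa using hx

theorem l2norm_ae_lt_top {u : α → ℝ≥0∞} (hu : AEMeasurable u μ) (h : l2norm μ u ≠ ∞) :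
    ∀ᵐ x ∂μ, u x < ∞ := by
  have h2 : ∫⁻ x, u x ^ 2 ∂μ ≠ ∞ := by
    rw [← l2norm_sq]
    exact ENNReal.pow_ne_top h
  filter_upwards [ae_lt_top' (hu.pow_const 2) h2] with x hx
  simpa using hx

theorem IsFunctionNorm.l2norm (μ : Measure α) : IsFunctionNorm μ (l2norm μ) where
  mono u v h := l2norm_mono_ae h
  const_mul c u hu := l2norm_const_mul _ hu
  tsum_le u hu := l2norm_tsum_le hu
  tendsto_zero u v hu hv huv hNv hlim := by
    have h := tendsto_lintegral_of_dominated_convergence' (μ := μ) (F := fun n x => u n x ^ 2)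
      (f := fun _ => 0) (fun x => v x ^ 2) (fun n => (hu n).pow_const 2)
      (fun n => (huv n).mono fun x hx => pow_le_pow_left' hx 2)
      (by rw [← l2norm_sq]; exact ENNReal.pow_ne_top hNv)
      (hlim.mono fun x hx => by simpa using ENNReal.Tendsto.pow (n := 2) hx)
    have h2 := ((ENNReal.continuous_rpow_const (y := (1 / 2 : ℝ))).tendsto _).comp h
    simpa [Function.comp_def, FrequencySpace.l2norm] using h2

theorem eLpNorm_two_eq {f : α → ℂ} : eLpNorm f 2 μ = l2norm μ (fun x => ‖f x‖ₑ) := by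
  rw [eLpNorm_eq_lintegral_rpow_enorm_toReal (by norm_num) (by norm_num)]
  simp [l2norm]

end l2norm

/-- The norm of the sum of two spaces, for `[0, ∞]`-valued functions: the infimum over all ways to
dominate the function by a sum. -/
noncomputable def sumNorm {α : Type*} [MeasurableSpace α] (μ : Measure α)
    (N₁ N₂ : (α → ℝ≥0∞) → ℝ≥0∞) (u : α → ℝ≥0∞) : ℝ≥0∞ :=
  ⨅ (u₁ : α → ℝ≥0∞) (u₂ : α → ℝ≥0∞) (_ : AEMeasurable u₁ μ) (_ : AEMeasurable u₂ μ)
    (_ : u ≤ᵐ[μ] fun x => u₁ x + u₂ x), N₁ u₁ + N₂ u₂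

section sumNorm

variable {α : Type*} [MeasurableSpace α] {μ : Measure α} {N₁ N₂ : (α → ℝ≥0∞) → ℝ≥0∞}

theorem sumNorm_le {u u₁ u₂ : α → ℝ≥0∞} (h₁ : AEMeasurable u₁ μ) (h₂ : AEMeasurable u₂ μ)
    (h : u ≤ᵐ[μ] fun x => u₁ x + u₂ x) : sumNorm μ N₁ N₂ u ≤ N₁ u₁ + N₂ u₂ :=
  iInf_le_of_le u₁ (iInf_le_of_le u₂ (iInf_le_of_le h₁ (iInf_le_of_le h₂ (iInf_le _ h))))

theorem le_sumNorm {u : α → ℝ≥0∞} {b : ℝ≥0∞}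
    (h : ∀ u₁ u₂, AEMeasurable u₁ μ → AEMeasurable u₂ μ → (u ≤ᵐ[μ] fun x => u₁ x + u₂ x) →
      b ≤ N₁ u₁ + N₂ u₂) : b ≤ sumNorm μ N₁ N₂ u :=
  le_iInf fun u₁ => le_iInf fun u₂ => le_iInf fun h₁ => le_iInf fun h₂ => le_iInf fun h' =>
    h u₁ u₂ h₁ h₂ h'

theorem exists_of_sumNorm_lt {u : α → ℝ≥0∞} {b : ℝ≥0∞} (h : sumNorm μ N₁ N₂ u < b) :
    ∃ u₁ u₂, AEMeasurable u₁ μ ∧ AEMeasurable u₂ μ ∧ (u ≤ᵐ[μ] fun x => u₁ x + u₂ x) ∧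
      N₁ u₁ + N₂ u₂ < b := by
  simp only [sumNorm, iInf_lt_iff] at h
  obtain ⟨u₁, u₂, h₁, h₂, h', hb⟩ := h
  exact ⟨u₁, u₂, h₁, h₂, h', hb⟩

theorem IsFunctionNorm.sumNorm (h₁ : IsFunctionNorm μ N₁) (h₂ : IsFunctionNorm μ N₂) :
    IsFunctionNorm μ (sumNorm μ N₁ N₂) where
  mono u v h := le_sumNorm fun v₁ v₂ hv₁ hv₂ hv => sumNorm_le hv₁ hv₂ (h.trans hv)
  const_mul c u hu := by
    have hle : ∀ (c : ℝ≥0) (u : α → ℝ≥0∞), c ≠ 0 →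
        FrequencySpace.sumNorm μ N₁ N₂ (fun x => c * u x) ≤
          c * FrequencySpace.sumNorm μ N₁ N₂ u := by
      intro c u hc
      have hc' : (c : ℝ≥0∞) ≠ 0 := by simpa using hc
      rw [mul_comm, ← ENNReal.div_le_iff hc' ENNReal.coe_ne_top]
      refine le_sumNorm fun u₁ u₂ hu₁ hu₂ hu => ?_
      rw [ENNReal.div_le_iff hc' ENNReal.coe_ne_top, mul_comm, mul_add, ← h₁.const_mul c _ hu₁,
        ← h₂.const_mul c _ hu₂]
      refine sumNorm_le (hu₁.const_mul _) (hu₂.const_mul _) (hu.mono fun x hx => ?_)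
      exact (mul_le_mul_right hx _).trans (mul_add _ _ _).le
    rcases eq_or_ne c 0 with rfl | hc
    · refine le_antisymm ?_ (by simp)
      refine (sumNorm_le (u₁ := fun _ => 0) (u₂ := fun _ => 0) aemeasurable_const
        aemeasurable_const (ae_of_all _ fun x => by simp)).trans ?_
      simp [h₁.zero, h₂.zero]
    · refine le_antisymm (hle c u hc) ?_
      have := hle c⁻¹ (fun x => c * u x) (inv_ne_zero hc)
      simp only [← mul_assoc, ← ENNReal.coe_mul, inv_mul_cancel₀ hc, ENNReal.coe_one,
        one_mul] at this
      calc (c : ℝ≥0∞) * FrequencySpace.sumNorm μ N₁ N₂ u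
          ≤ c * ((c⁻¹ : ℝ≥0) * FrequencySpace.sumNorm μ N₁ N₂ (fun x => c * u x)) :=
            mul_le_mul_right this _
        _ = FrequencySpace.sumNorm μ N₁ N₂ (fun x => c * u x) := by
            rw [← mul_assoc, ← ENNReal.coe_mul, mul_inv_cancel₀ hc, ENNReal.coe_one, one_mul]
  tsum_le u hu := by
    refine ENNReal.le_of_forall_pos_le_add fun ε hε hfin => ?_
    obtain ⟨δ, hδ, hδε⟩ := ENNReal.exists_pos_sum_of_countable (ε := (ε : ℝ≥0∞))
      (by simpa using hε.ne') ℕ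
    have hex : ∀ n, ∃ u₁ u₂, AEMeasurable u₁ μ ∧ AEMeasurable u₂ μ ∧
        (u n ≤ᵐ[μ] fun x => u₁ x + u₂ x) ∧
        N₁ u₁ + N₂ u₂ < FrequencySpace.sumNorm μ N₁ N₂ (u n) + δ n := fun n =>
      exists_of_sumNorm_lt (ENNReal.lt_add_right
        (ENNReal.ne_top_of_tsum_ne_top hfin.ne n) (by simpa using (hδ n).ne'))
    choose v₁ v₂ hv₁ hv₂ hv hlt using hex
    calc FrequencySpace.sumNorm μ N₁ N₂ (fun x => ∑' n, u n x)
        ≤ N₁ (fun x => ∑' n, v₁ n x) + N₂ (fun x => ∑' n, v₂ n x) := by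
          refine sumNorm_le (AEMeasurable.tsum hv₁) (AEMeasurable.tsum hv₂) ?_
          filter_upwards [ae_all_iff.2 hv] with x hx
          rw [← ENNReal.tsum_add]
          exact ENNReal.tsum_le_tsum hx
      _ ≤ ∑' n, N₁ (v₁ n) + ∑' n, N₂ (v₂ n) := add_le_add (h₁.tsum_le _ hv₁) (h₂.tsum_le _ hv₂)
      _ = ∑' n, (N₁ (v₁ n) + N₂ (v₂ n)) := ENNReal.tsum_add.symm
      _ ≤ ∑' n, (FrequencySpace.sumNorm μ N₁ N₂ (u n) + δ n) :=
          ENNReal.tsum_le_tsum fun n => (hlt n).le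
      _ = ∑' n, FrequencySpace.sumNorm μ N₁ N₂ (u n) + ∑' n, (δ n : ℝ≥0∞) := ENNReal.tsum_add
      _ ≤ _ := by gcongr
  tendsto_zero u v hu hv huv hNv hlim := by
    obtain ⟨v₁, v₂, hv₁, hv₂, hle, hlt⟩ := exists_of_sumNorm_lt (lt_top_iff_ne_top.2 hNv)
    rw [ENNReal.add_lt_top] at hlt
    have hl₁ := h₁.tendsto_zero (fun n x => min (u n x) (v₁ x)) v₁ (fun n => (hu n).min hv₁) hv₁
      (fun n => ae_of_all _ fun x => min_le_right _ _) hlt.1.ne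
      (hlim.mono fun x hx => tendsto_of_tendsto_of_tendsto_of_le_of_le tendsto_const_nhds hx
        (fun _ => zero_le) fun _ => min_le_left _ _)
    have hl₂ := h₂.tendsto_zero (fun n x => min (u n x) (v₂ x)) v₂ (fun n => (hu n).min hv₂) hv₂
      (fun n => ae_of_all _ fun x => min_le_right _ _) hlt.2.ne
      (hlim.mono fun x hx => tendsto_of_tendsto_of_tendsto_of_le_of_le tendsto_const_nhds hx
        (fun _ => zero_le) fun _ => min_le_left _ _)
    have hl := hl₁.add hl₂
    rw [add_zero] at hl
    refine tendsto_of_tendsto_of_tendsto_of_le_of_le tendsto_const_nhds hl (fun _ => zero_le)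
      fun n => sumNorm_le ((hu n).min hv₁) ((hu n).min hv₂) ?_
    filter_upwards [huv n, hle] with x hx hx'
    rcases le_total (u n x) (v₁ x) with h | h
    · simp [min_eq_left h]
    · rcases le_total (u n x) (v₂ x) with h' | h'
      · simp [min_eq_left h']
      · simpa [min_eq_right h, min_eq_right h'] using hx.trans hx'

end sumNorm


/-! ### The norms of the spaces `X̂`, `Y` and `Z` as function norms -/

theorem one_le_jap (x : ℝ) : 1 ≤ jap x := by
  rw [jap, Real.one_le_sqrt]
  nlinarith [sq_nonneg x]

theorem jap_pos (x : ℝ) : 0 < jap x := one_pos.trans_le (one_le_jap x)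

theorem jap_sq (x : ℝ) : jap x ^ 2 = 1 + x ^ 2 := Real.sq_sqrt (by positivity)

theorem continuous_jap : Continuous jap := by
  unfold jap
  fun_prop

theorem measurable_jap : Measurable jap := continuous_jap.measurable

theorem continuous_modulation : Continuous modulation := by
  unfold modulation
  exact continuous_jap.comp (by fun_prop)

theorem measurable_modulation : Measurable modulation := continuous_modulation.measurable

theorem one_le_modulation (p : Freq) : 1 ≤ modulation p := one_le_jap _

theorem modulation_pos (p : Freq) : 0 < modulation p := jap_pos _

theorem ae_ae_slice {P : Freq → Prop} (h : ∀ᵐ p ∂(volume : Measure Freq), P p) :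
    ∀ᵐ ξ : ℝ, ∀ᵐ τ : ℝ, P (τ, ξ) := by
  have h2 : ∀ᵐ p ∂(volume : Measure Freq), P p.swap :=
    (Measure.measurePreserving_swap (μ := (volume : Measure ℝ))
      (ν := (volume : Measure ℝ))).quasiMeasurePreserving.ae h
  exact Measure.ae_ae_of_ae_prod h2

theorem aemeasurable_slice {u : Freq → ℝ≥0∞} (hu : AEMeasurable u volume) :
    ∀ᵐ ξ : ℝ, AEMeasurable (fun τ => u (τ, ξ)) volume := by
  obtain ⟨v, hv, huv⟩ := hu
  filter_upwards [ae_ae_slice huv] with ξ hξ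
  exact ⟨fun τ => v (τ, ξ), hv.comp (by fun_prop), hξ⟩

theorem aemeasurable_lintegral_slice {u : Freq → ℝ≥0∞} (hu : AEMeasurable u volume) :
    AEMeasurable (fun ξ : ℝ => ∫⁻ τ : ℝ, u (τ, ξ)) volume :=
  AEMeasurable.lintegral_prod_left' (μ := (volume : Measure ℝ)) (ν := (volume : Measure ℝ)) hu

theorem lintegral_freq {u : Freq → ℝ≥0∞} (hu : AEMeasurable u volume) :
    ∫⁻ p, u p = ∫⁻ ξ : ℝ, ∫⁻ τ : ℝ, u (τ, ξ) :=
  lintegral_prod_symm (μ := (volume : Measure ℝ)) (ν := (volume : Measure ℝ)) u hu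

/-- The norm of `L²_ξ L¹_τ` for `[0, ∞]`-valued functions. -/
noncomputable def mixedNorm (u : Freq → ℝ≥0∞) : ℝ≥0∞ :=
  l2norm volume (fun ξ : ℝ => ∫⁻ τ : ℝ, u (τ, ξ))

theorem mixedNorm_mono_ae {u v : Freq → ℝ≥0∞} (h : u ≤ᵐ[volume] v) :
    mixedNorm u ≤ mixedNorm v :=
  l2norm_mono_ae ((ae_ae_slice h).mono fun _ hξ => lintegral_mono_ae hξ)

theorem IsFunctionNorm.mixedNorm : IsFunctionNorm volume mixedNorm where
  mono u v h := mixedNorm_mono_ae h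
  const_mul c u hu := by
    unfold FrequencySpace.mixedNorm
    rw [← l2norm_const_mul _ (aemeasurable_lintegral_slice hu)]
    refine (IsFunctionNorm.l2norm volume).congr_ae ?_
    filter_upwards [aemeasurable_slice hu] with ξ hξ
    exact lintegral_const_mul'' _ hξ
  tsum_le u hu := by
    refine le_trans (l2norm_mono_ae ?_)
      (l2norm_tsum_le fun n => aemeasurable_lintegral_slice (hu n))
    filter_upwards [ae_all_iff.2 fun n => aemeasurable_slice (hu n)] with ξ hξ
    exact (lintegral_tsum hξ).le
  tendsto_zero u v hu hv huv hNv hlim := by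
    refine (IsFunctionNorm.l2norm volume).tendsto_zero _ _
      (fun n => aemeasurable_lintegral_slice (hu n)) (aemeasurable_lintegral_slice hv)
      (fun n => (ae_ae_slice (huv n)).mono fun _ hξ => lintegral_mono_ae hξ) hNv ?_
    filter_upwards [ae_all_iff.2 fun n => aemeasurable_slice (hu n), aemeasurable_slice hv,
      ae_all_iff.2 fun n => ae_ae_slice (huv n), ae_ae_slice hlim,
      l2norm_ae_lt_top (aemeasurable_lintegral_slice hv) hNv] with ξ h1 h2 h3 h4 h5
    exact (IsFunctionNorm.lintegral volume).tendsto_zero _ _ h1 h2 h3 h5.ne h4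

theorem mixedNorm_eq_zero {u : Freq → ℝ≥0∞} (hu : AEMeasurable u volume)
    (h : mixedNorm u = 0) : u =ᵐ[volume] 0 := by
  rw [← lintegral_eq_zero_iff' hu, lintegral_freq hu,
    lintegral_eq_zero_iff' (aemeasurable_lintegral_slice hu)]
  exact l2norm_eq_zero (aemeasurable_lintegral_slice hu) h

/-- The norm `‖⟨ξ⟩⁻¹ u‖` in `L²_ξ L¹_τ`, for `[0, ∞]`-valued functions. -/
noncomputable def energyNorm (u : Freq → ℝ≥0∞) : ℝ≥0∞ :=
  mixedNorm (fun p => ENNReal.ofReal (jap p.2)⁻¹ * u p)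

theorem measurable_ofReal_jap_inv : Measurable fun p : Freq => ENNReal.ofReal (jap p.2)⁻¹ :=
  (measurable_jap.comp measurable_snd).inv.ennreal_ofReal

theorem IsFunctionNorm.energyNorm : IsFunctionNorm volume energyNorm :=
  IsFunctionNorm.mixedNorm.comp_mul measurable_ofReal_jap_inv.aemeasurable
    fun _ => ENNReal.ofReal_ne_top

theorem energyNorm_eq_zero {u : Freq → ℝ≥0∞} (hu : AEMeasurable u volume)
    (h : energyNorm u = 0) : u =ᵐ[volume] 0 := by
  filter_upwards [mixedNorm_eq_zero (measurable_ofReal_jap_inv.aemeasurable.mul hu) h] with p hp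
  have hne : ENNReal.ofReal (jap p.2)⁻¹ ≠ 0 := by
    simpa using jap_pos p.2
  simpa [hne] using hp

theorem normEnergy_eq (f : Freq → ℂ) : normEnergy f = energyNorm (fun p => ‖f p‖ₑ) := by
  simp only [normEnergy, normL2L1, energyNorm, mixedNorm, l2norm]
  congr 1
  refine lintegral_congr fun ξ => ?_
  congr 1
  refine lintegral_congr fun τ => ?_
  rw [enorm_smul, Real.enorm_eq_ofReal (inv_nonneg.2 (jap_pos ξ).le)]

/-- The norm of `X̂^{-1,1/2,1}` for `[0, ∞]`-valued functions. The sums are written as norms over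
counting measure, in order that the norm is a composition of function norms. -/
noncomputable def besovNorm (u : Freq → ℝ≥0∞) : ℝ≥0∞ :=
  l2norm Measure.count fun j : ℕ => (2 : ℝ≥0∞) ^ (-1 * (j : ℝ)) *
    ∫⁻ d : ℕ, (2 : ℝ≥0∞) ^ (1 / 2 * (d : ℝ)) *
      l2norm (volume.restrict (annulus j ∩ parabolic d)) u ∂Measure.count

theorem besovNorm_eq (u : Freq → ℝ≥0∞) :
    besovNorm u = (∑' j : ℕ, ((2 : ℝ≥0∞) ^ (-1 * (j : ℝ)) *
      ∑' d : ℕ, (2 : ℝ≥0∞) ^ (1 / 2 * (d : ℝ)) *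
        l2norm (volume.restrict (annulus j ∩ parabolic d)) u) ^ 2) ^ (1 / 2 : ℝ) := by
  simp only [besovNorm, l2norm, lintegral_count]

theorem normBesov_eq (f : Freq → ℂ) :
    normBesov (-1) (1 / 2) f = besovNorm (fun p => ‖f p‖ₑ) := by
  rw [besovNorm_eq, normBesov]
  simp_rw [eLpNorm_two_eq]

theorem two_rpow_ne_top (x : ℝ) : (2 : ℝ≥0∞) ^ x ≠ ∞ := by
  simp [ENNReal.rpow_eq_top_iff]

theorem IsFunctionNorm.smul_of_ne_top {α : Type*} [MeasurableSpace α] {μ : Measure α}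
    {N : (α → ℝ≥0∞) → ℝ≥0∞} (hN : IsFunctionNorm μ N) {c : ℝ≥0∞} (hc : c ≠ ∞) :
    IsFunctionNorm μ (fun u => c * N u) := by
  lift c to ℝ≥0 using hc
  exact hN.smul c

theorem IsFunctionNorm.besovNorm : IsFunctionNorm volume besovNorm := by
  have h1 : ∀ j d : ℕ, IsFunctionNorm (volume : Measure Freq) (fun u =>
      (2 : ℝ≥0∞) ^ (1 / 2 * (d : ℝ)) * FrequencySpace.l2norm
        (volume.restrict (annulus j ∩ parabolic d)) u) := fun j d =>
    ((IsFunctionNorm.l2norm _).of_absolutelyContinuous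
      Measure.restrict_le_self.absolutelyContinuous).smul_of_ne_top (two_rpow_ne_top _)
  have h2 : ∀ j : ℕ, IsFunctionNorm (volume : Measure Freq) (fun u =>
      ∫⁻ d : ℕ, (2 : ℝ≥0∞) ^ (1 / 2 * (d : ℝ)) * FrequencySpace.l2norm
        (volume.restrict (annulus j ∩ parabolic d)) u ∂Measure.count) := fun j => by
    refine (IsFunctionNorm.lintegral Measure.count).comp (h1 j)
      (fun u _ => (measurable_of_countable _).aemeasurable) fun u _ hfin => ?_
    exact (MeasureTheory.ae_lt_top (measurable_of_countable _) hfin).mono fun d hd => hd.ne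
  refine (IsFunctionNorm.l2norm Measure.count).comp
    (fun j => (h2 j).smul_of_ne_top (two_rpow_ne_top (-1 * (j : ℝ))))
    (fun u _ => (measurable_of_countable _).aemeasurable) fun u _ hfin => ?_
  exact (l2norm_ae_lt_top (measurable_of_countable _).aemeasurable hfin).mono fun d hd => hd.ne

/-- The norm of `Z` for `[0, ∞]`-valued functions. -/
noncomputable def zNorm : (Freq → ℝ≥0∞) → ℝ≥0∞ :=
  sumNorm volume besovNorm fun u => energyNorm u + l2norm volume u

theorem IsFunctionNorm.zNorm : IsFunctionNorm volume zNorm :=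
  IsFunctionNorm.besovNorm.sumNorm (IsFunctionNorm.energyNorm.add (IsFunctionNorm.l2norm _))

theorem normY_eq (f : Freq → ℂ) :
    normY f = energyNorm (fun p => ‖f p‖ₑ) + l2norm volume fun p => ‖f p‖ₑ := by
  rw [normY, normEnergy_eq, eLpNorm_two_eq]

/-- The norm of `Z` depends on the absolute value of a function only, and decompositions of the
absolute value suffice: `f` splits along `|f| = min(|f|, u₁) + (|f| - u₁)₊`. -/
theorem normZ_eq {f : Freq → ℂ} (hf : AEStronglyMeasurable f volume) :
    normZ f = zNorm (fun p => ‖f p‖ₑ) := by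
  refine le_antisymm (le_sumNorm fun u₁ u₂ hu₁ hu₂ hle => ?_) ?_
  · let θ : Freq → ℝ := fun p => (min 1 (u₁ p / ‖f p‖ₑ)).toReal
    have hθ_meas : AEStronglyMeasurable θ volume :=
      (aemeasurable_const.min (hu₁.div hf.enorm)).ennreal_toReal.aestronglyMeasurable
    have hθ_nonneg : ∀ p, 0 ≤ θ p := fun p => ENNReal.toReal_nonneg
    have hθ_le : ∀ p, θ p ≤ 1 := fun p => by
      have := ENNReal.toReal_mono ENNReal.one_ne_top (min_le_left 1 (u₁ p / ‖f p‖ₑ))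
      simpa using this
    have hθ : ∀ p, ENNReal.ofReal (θ p) = min 1 (u₁ p / ‖f p‖ₑ) := fun p =>
      ENNReal.ofReal_toReal (ne_top_of_le_ne_top ENNReal.one_ne_top (min_le_left _ _))
    have hmul : ∀ p, ENNReal.ofReal (θ p) * ‖f p‖ₑ = min ‖f p‖ₑ (u₁ p) := by
      intro p
      rcases eq_or_ne (f p) 0 with h0 | h0
      · simp [h0]
      · have hne : ‖f p‖ₑ ≠ 0 := by simpa using h0
        rw [hθ, mul_comm, mul_min, mul_one, ENNReal.mul_div_cancel hne enorm_ne_top]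
    have he₁ : ∀ p, ‖θ p • f p‖ₑ = min ‖f p‖ₑ (u₁ p) := fun p => by
      rw [enorm_smul, Real.enorm_eq_ofReal (hθ_nonneg p), hmul]
    have he₂ : ∀ p, ‖(1 - θ p) • f p‖ₑ = ‖f p‖ₑ - min ‖f p‖ₑ (u₁ p) := fun p => by
      rw [enorm_smul, Real.enorm_eq_ofReal (sub_nonneg.2 (hθ_le p)),
        ENNReal.ofReal_sub _ (hθ_nonneg p), ENNReal.ofReal_one,
        ENNReal.sub_mul (fun _ _ => enorm_ne_top), one_mul, hmul]
    refine iInf_le_of_le (fun p => θ p • f p) (iInf_le_of_le (fun p => (1 - θ p) • f p)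
      (iInf_le_of_le (hθ_meas.smul hf) (iInf_le_of_le
        ((aestronglyMeasurable_const.sub hθ_meas).smul hf) (iInf_le_of_le ?_ ?_))))
    · refine ae_of_all _ fun p => ?_
      simp [sub_smul]
    · rw [normBesov_eq, normY_eq]
      have hle₁ : (fun p => ‖θ p • f p‖ₑ) ≤ᵐ[volume] u₁ := ae_of_all _ fun p => by
        dsimp only
        rw [he₁]
        exact min_le_right _ _
      have hle₂ : (fun p => ‖(1 - θ p) • f p‖ₑ) ≤ᵐ[volume] u₂ := by
        filter_upwards [hle] with p hp
        rw [he₂, tsub_le_iff_left]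
        rcases le_total ‖f p‖ₑ (u₁ p) with h | h
        · rw [min_eq_left h]
          exact le_self_add
        · rwa [min_eq_right h]
      exact add_le_add (IsFunctionNorm.besovNorm.mono _ _ hle₁)
        (add_le_add (IsFunctionNorm.energyNorm.mono _ _ hle₂) (l2norm_mono_ae hle₂))
  · refine le_iInf fun f₁ => le_iInf fun f₂ => le_iInf fun h₁ => le_iInf fun h₂ =>
      le_iInf fun h => ?_
    rw [normBesov_eq, normY_eq]
    refine sumNorm_le h₁.enorm h₂.enorm ?_
    filter_upwards [h] with p hp
    rw [hp]
    exact enorm_add_le _ _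

theorem zNorm_le_besovNorm {u : Freq → ℝ≥0∞} (hu : AEMeasurable u volume) :
    zNorm u ≤ besovNorm u := by
  refine (sumNorm_le hu (u₂ := fun _ => 0) aemeasurable_const (ae_of_all _ fun p => ?_)).trans ?_
  · simp
  · simp [IsFunctionNorm.energyNorm.zero, l2norm_zero]

theorem zNorm_le_energyNorm_add {u : Freq → ℝ≥0∞} (hu : AEMeasurable u volume) :
    zNorm u ≤ energyNorm u + l2norm volume u := by
  refine (sumNorm_le (u₁ := fun _ => 0) aemeasurable_const hu (ae_of_all _ fun p => ?_)).trans ?_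
  · simp
  · simp [IsFunctionNorm.besovNorm.zero]


/-! ### Embeddings between the spaces -/

theorem exists_dyadic {x : ℝ} (hx : 1 ≤ x) : ∃ n : ℕ, 2 ^ n ≤ x ∧ x < 2 ^ (n + 1) := by
  obtain ⟨n, hn⟩ := exists_nat_pow_near hx one_lt_two
  exact ⟨n, hn⟩

theorem dyadic_unique {x : ℝ} {m n : ℕ} (hm : (2 : ℝ) ^ m ≤ x) (hm' : x < 2 ^ (m + 1))
    (hn : (2 : ℝ) ^ n ≤ x) (hn' : x < 2 ^ (n + 1)) : m = n := by
  have h1 : m < n + 1 := (pow_lt_pow_iff_right₀ (one_lt_two (α := ℝ))).1 (hm.trans_lt hn')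
  have h2 : n < m + 1 := (pow_lt_pow_iff_right₀ (one_lt_two (α := ℝ))).1 (hn.trans_lt hm')
  omega

theorem measurableSet_annulus (j : ℕ) : MeasurableSet (annulus j) :=
  (measurableSet_le measurable_const (measurable_jap.comp measurable_snd)).inter
    (measurableSet_lt (measurable_jap.comp measurable_snd) measurable_const)

theorem measurableSet_parabolic (d : ℕ) : MeasurableSet (parabolic d) :=
  (measurableSet_le measurable_const measurable_modulation).inter
    (measurableSet_lt measurable_modulation measurable_const)

theorem lintegral_eq_tsum_annulus_parabolic (u : Freq → ℝ≥0∞) :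
    ∫⁻ p, u p = ∑' j : ℕ, ∑' d : ℕ, ∫⁻ p in annulus j ∩ parabolic d, u p := by
  have hU : (⋃ q : ℕ × ℕ, annulus q.1 ∩ parabolic q.2) = Set.univ := by
    refine Set.eq_univ_of_forall fun p => ?_
    obtain ⟨j, hj⟩ := exists_dyadic (one_le_jap p.2)
    obtain ⟨d, hd⟩ := exists_dyadic (one_le_modulation p)
    exact Set.mem_iUnion.2 ⟨(j, d), hj, hd⟩
  have hd : Pairwise (Function.onFun Disjoint fun q : ℕ × ℕ => annulus q.1 ∩ parabolic q.2) := by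
    intro q r hqr
    refine Set.disjoint_left.2 fun p hp hp' => hqr ?_
    exact Prod.ext (dyadic_unique hp.1.1 hp.1.2 hp'.1.1 hp'.1.2)
      (dyadic_unique hp.2.1 hp.2.2 hp'.2.1 hp'.2.2)
  rw [← setLIntegral_univ, ← hU, lintegral_iUnion
    (fun q => (measurableSet_annulus _).inter (measurableSet_parabolic _)) hd,
    ENNReal.tsum_prod (f := fun j d => ∫⁻ p in annulus j ∩ parabolic d, u p)]

theorem l2norm_volume_sq_eq (u : Freq → ℝ≥0∞) :
    ∫⁻ p, u p ^ 2 =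
      ∑' j : ℕ, ∑' d : ℕ, l2norm (volume.restrict (annulus j ∩ parabolic d)) u ^ 2 := by
  simp_rw [lintegral_eq_tsum_annulus_parabolic fun p => u p ^ 2, l2norm_sq]

theorem two_rpow_eq_ofReal (x : ℝ) : (2 : ℝ≥0∞) ^ x = ENNReal.ofReal ((2 : ℝ) ^ x) := by
  rw [← ENNReal.ofReal_rpow_of_pos two_pos]
  simp

theorem tsum_sq_le_sq_tsum (a : ℕ → ℝ≥0∞) : ∑' n, a n ^ 2 ≤ (∑' n, a n) ^ 2 := by
  calc ∑' n, a n ^ 2 ≤ ∑' n, a n * ∑' m, a m := by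
        refine ENNReal.tsum_le_tsum fun n => ?_
        rw [sq]
        exact mul_le_mul_right (ENNReal.le_tsum n) _
    _ = (∑' n, a n) ^ 2 := by rw [ENNReal.tsum_mul_right, sq]

theorem sq_tsum_mul_le (a b : ℕ → ℝ≥0∞) :
    (∑' n, a n * b n) ^ 2 ≤ (∑' n, a n ^ 2) * ∑' n, b n ^ 2 := by
  have := lintegral_mul_le_l2norm (μ := (Measure.count : Measure ℕ)) (u := a) (v := b)
    (measurable_of_countable _).aemeasurable (measurable_of_countable _).aemeasurable
  have h2 := pow_le_pow_left' this 2
  rw [mul_pow, l2norm_sq, l2norm_sq] at h2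
  simpa only [lintegral_count] using h2

/-- The weight `⟨ξ⟩⁻¹ ⟨τ - ξ²⟩^b` of the space `X̂^{-1,b}`. -/
noncomputable def xWeight (b : ℝ) (p : Freq) : ℝ≥0∞ :=
  ENNReal.ofReal ((jap p.2)⁻¹ * modulation p ^ b)

theorem measurable_xWeight (b : ℝ) : Measurable (xWeight b) :=
  (((measurable_jap.comp measurable_snd).inv).mul
    (measurable_modulation.pow_const b)).ennreal_ofReal

theorem l2norm_restrict_mono {s : Set Freq} (hs : MeasurableSet s) {u v : Freq → ℝ≥0∞}
    (h : ∀ p ∈ s, u p ≤ v p) : l2norm (volume.restrict s) u ≤ l2norm (volume.restrict s) v :=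
  l2norm_mono_ae ((ae_restrict_iff' hs).2 (ae_of_all _ h))

theorem xWeight_half_le {j d : ℕ} {p : Freq} (hp : p ∈ annulus j ∩ parabolic d) :
    xWeight (1 / 2) p ≤ 2 * ((2 : ℝ≥0∞) ^ (-1 * (j : ℝ)) * (2 : ℝ≥0∞) ^ (1 / 2 * (d : ℝ))) := by
  rw [two_rpow_eq_ofReal, two_rpow_eq_ofReal, ← ENNReal.ofReal_mul (by positivity),
    ← ENNReal.ofReal_ofNat 2, ← ENNReal.ofReal_mul (by positivity)]
  refine ENNReal.ofReal_le_ofReal ?_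
  have h1 : (jap p.2)⁻¹ ≤ (2 : ℝ) ^ (-1 * (j : ℝ)) := by
    rw [neg_one_mul, Real.rpow_neg two_pos.le, Real.rpow_natCast]
    exact inv_anti₀ (by positivity) hp.1.1
  have h2 : modulation p ^ (1 / 2 : ℝ) ≤ 2 * (2 : ℝ) ^ (1 / 2 * (d : ℝ)) := by
    calc modulation p ^ (1 / 2 : ℝ) ≤ ((2 : ℝ) ^ (d + 1)) ^ (1 / 2 : ℝ) :=
          Real.rpow_le_rpow (modulation_pos p).le hp.2.2.le (by norm_num)
      _ = (2 : ℝ) ^ (1 / 2 : ℝ) * (2 : ℝ) ^ (1 / 2 * (d : ℝ)) := by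
          rw [← Real.rpow_natCast, ← Real.rpow_mul two_pos.le, ← Real.rpow_add two_pos]
          congr 1
          push_cast
          ring
      _ ≤ 2 * (2 : ℝ) ^ (1 / 2 * (d : ℝ)) := by
          gcongr
          calc (2 : ℝ) ^ (1 / 2 : ℝ) ≤ 2 ^ (1 : ℝ) :=
                Real.rpow_le_rpow_of_exponent_le one_le_two (by norm_num)
            _ = 2 := by norm_num
  calc (jap p.2)⁻¹ * modulation p ^ (1 / 2 : ℝ)
      ≤ (2 : ℝ) ^ (-1 * (j : ℝ)) * (2 * (2 : ℝ) ^ (1 / 2 * (d : ℝ))) := by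
        have := modulation_pos p
        gcongr
    _ = _ := by ring

theorem le_xWeight {j d : ℕ} {p : Freq} (hp : p ∈ annulus j ∩ parabolic d) :
    (2 : ℝ≥0∞) ^ (-1 * (j : ℝ)) * (2 : ℝ≥0∞) ^ (9 / 16 * (d : ℝ)) ≤ 2 * xWeight (9 / 16) p := by
  rw [two_rpow_eq_ofReal, two_rpow_eq_ofReal, ← ENNReal.ofReal_mul (by positivity), xWeight,
    ← ENNReal.ofReal_ofNat 2, ← ENNReal.ofReal_mul (by positivity)]
  refine ENNReal.ofReal_le_ofReal ?_
  have h1 : (2 : ℝ) ^ (-1 * (j : ℝ)) ≤ 2 * (jap p.2)⁻¹ := by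
    rw [neg_one_mul, Real.rpow_neg two_pos.le, Real.rpow_natCast, ← div_eq_mul_inv,
      inv_le_comm₀ (by positivity) (div_pos two_pos (jap_pos _)), inv_div, div_le_iff₀ two_pos,
      ← pow_succ]
    exact hp.1.2.le
  have h2 : (2 : ℝ) ^ (9 / 16 * (d : ℝ)) ≤ modulation p ^ (9 / 16 : ℝ) := by
    rw [mul_comm, Real.rpow_mul two_pos.le, Real.rpow_natCast]
    exact Real.rpow_le_rpow (by positivity) hp.2.1 (by norm_num)
  rw [← mul_assoc]
  have := jap_pos p.2
  gcongr

/-- `X̂^{-1,1/2,1}` embeds into `X̂^{-1,1/2}`. -/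
theorem l2norm_xWeight_le_besovNorm {u : Freq → ℝ≥0∞} (hu : AEMeasurable u volume) :
    l2norm volume (fun p => xWeight (1 / 2) p * u p) ≤ 2 * besovNorm u := by
  rw [l2norm_le_iff, l2norm_volume_sq_eq, mul_pow, besovNorm_eq, rpow_half_sq,
    ← ENNReal.tsum_mul_left]
  refine ENNReal.tsum_le_tsum fun j => (tsum_sq_le_sq_tsum _).trans ?_
  rw [← mul_pow]
  refine pow_le_pow_left' ?_ 2
  rw [← ENNReal.tsum_mul_left, ← ENNReal.tsum_mul_left]
  refine ENNReal.tsum_le_tsum fun d => ?_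
  refine (l2norm_restrict_mono ((measurableSet_annulus j).inter (measurableSet_parabolic d))
    fun p hp => mul_le_mul_left (xWeight_half_le hp) _).trans ?_
  rw [l2norm_const_mul _ (hu.mono_ac Measure.restrict_le_self.absolutelyContinuous)]
  exact le_of_eq (by ring)

theorem tsum_two_rpow_ne_top {a : ℝ} (ha : 0 < a) :
    ∑' d : ℕ, (2 : ℝ≥0∞) ^ (-a * (d : ℝ)) ≠ ∞ := by
  have : ∀ d : ℕ, (2 : ℝ≥0∞) ^ (-a * (d : ℝ)) = ((2 : ℝ≥0∞) ^ (-a)) ^ d := fun d => by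
    rw [ENNReal.rpow_mul, ENNReal.rpow_natCast]
  simp_rw [this]
  rw [ENNReal.tsum_geometric, ENNReal.inv_ne_top]
  exact (tsub_pos_iff_lt.2 <| ENNReal.rpow_lt_one_of_one_lt_of_neg (by norm_num) (by linarith)).ne'

/-- `X̂^{-1,9/16}` embeds into `X̂^{-1,1/2,1}`. -/
theorem exists_besovNorm_le_l2norm_xWeight : ∃ C : ℝ≥0, ∀ u : Freq → ℝ≥0∞,
    AEMeasurable u volume →
      besovNorm u ≤ C * l2norm volume (fun p => xWeight (9 / 16) p * u p) := by
  have hfin : (∑' d : ℕ, (2 : ℝ≥0∞) ^ (-(1 / 8) * (d : ℝ))) ^ (1 / 2 : ℝ) ≠ ∞ :=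
    ENNReal.rpow_ne_top_of_nonneg (by norm_num) (tsum_two_rpow_ne_top (by norm_num))
  refine ⟨2 * ((∑' d : ℕ, (2 : ℝ≥0∞) ^ (-(1 / 8) * (d : ℝ))) ^ (1 / 2 : ℝ)).toNNReal,
    fun u hu => ?_⟩
  rw [ENNReal.coe_mul, ENNReal.coe_toNNReal hfin, besovNorm_eq, rpow_half_le_iff, mul_pow, mul_pow,
    rpow_half_sq, l2norm_sq, l2norm_volume_sq_eq, ← ENNReal.tsum_mul_left]
  refine ENNReal.tsum_le_tsum fun j => ?_
  have hsplit : (2 : ℝ≥0∞) ^ (-1 * (j : ℝ)) * ∑' d : ℕ, (2 : ℝ≥0∞) ^ (1 / 2 * (d : ℝ)) *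
      l2norm (volume.restrict (annulus j ∩ parabolic d)) u =
      ∑' d : ℕ, (2 : ℝ≥0∞) ^ (-(1 / 16) * (d : ℝ)) *
        ((2 : ℝ≥0∞) ^ (-1 * (j : ℝ)) * (2 : ℝ≥0∞) ^ (9 / 16 * (d : ℝ)) *
          l2norm (volume.restrict (annulus j ∩ parabolic d)) u) := by
    rw [← ENNReal.tsum_mul_left]
    refine tsum_congr fun d => ?_
    have : (2 : ℝ≥0∞) ^ (1 / 2 * (d : ℝ)) =
        (2 : ℝ≥0∞) ^ (-(1 / 16) * (d : ℝ)) * (2 : ℝ≥0∞) ^ (9 / 16 * (d : ℝ)) := by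
      rw [← ENNReal.rpow_add _ _ (by norm_num) (by norm_num)]
      congr 1
      ring
    rw [this]
    ring
  rw [hsplit]
  refine (sq_tsum_mul_le _ _).trans ?_
  have hsq : ∀ d : ℕ, ((2 : ℝ≥0∞) ^ (-(1 / 16) * (d : ℝ))) ^ 2 = 2 ^ (-(1 / 8) * (d : ℝ)) := by
    intro d
    rw [← ENNReal.rpow_natCast, ← ENNReal.rpow_mul]
    congr 1
    push_cast
    ring
  simp_rw [hsq]
  rw [mul_comm (((2 : ℝ≥0) : ℝ≥0∞) ^ 2), mul_assoc]
  refine mul_le_mul_right ?_ _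
  rw [← ENNReal.tsum_mul_left]
  refine ENNReal.tsum_le_tsum fun d => ?_
  rw [← mul_pow]
  refine pow_le_pow_left' ?_ 2
  have hu' := hu.mono_ac
    (Measure.restrict_le_self (s := annulus j ∩ parabolic d)).absolutelyContinuous
  have hw' : AEMeasurable (fun p => xWeight (9 / 16) p * u p)
      (volume.restrict (annulus j ∩ parabolic d)) :=
    (((measurable_xWeight (9 / 16)).aemeasurable (μ := volume)).mul hu).mono_ac
    (Measure.restrict_le_self (s := annulus j ∩ parabolic d)).absolutelyContinuous
  rw [← l2norm_const_mul _ hu', ← l2norm_const_mul _ hw']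
  refine l2norm_restrict_mono ((measurableSet_annulus j).inter (measurableSet_parabolic d))
    fun p hp => ?_
  rw [← mul_assoc]
  exact mul_le_mul_left (by simpa using le_xWeight hp) _

theorem abs_le_jap (x : ℝ) : |x| ≤ jap x := by
  rw [← Real.sqrt_sq_eq_abs]
  exact Real.sqrt_le_sqrt (by linarith)

theorem volume_parabolic_slice_le (d : ℕ) (ξ : ℝ) :
    volume {τ : ℝ | (τ, ξ) ∈ parabolic d} ≤ (2 * 2 ^ (1 / 2 * (d : ℝ))) ^ 2 := by
  calc volume {τ : ℝ | (τ, ξ) ∈ parabolic d}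
      ≤ volume (Icc (ξ ^ 2 - 2 ^ (d + 1)) (ξ ^ 2 + 2 ^ (d + 1))) := by
        refine measure_mono fun τ hτ => ?_
        have h1 : modulation (τ, ξ) < 2 ^ (d + 1) := hτ.2
        have h2 : |τ - ξ ^ 2| ≤ 2 ^ (d + 1) := (abs_le_jap _).trans h1.le
        rw [abs_le] at h2
        exact ⟨by linarith [h2.1], by linarith [h2.2]⟩
    _ = (2 * 2 ^ (1 / 2 * (d : ℝ))) ^ 2 := by
        rw [Real.volume_Icc, mul_pow, ← ENNReal.rpow_natCast (_ ^ _), ← ENNReal.rpow_mul,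
          two_rpow_eq_ofReal]
        have : (1 / 2 * (d : ℝ) * ((2 : ℕ) : ℝ)) = d := by push_cast; ring
        rw [this, Real.rpow_natCast, ← ENNReal.ofReal_ofNat 2, ← ENNReal.ofReal_pow (by norm_num),
          ← ENNReal.ofReal_mul (by norm_num)]
        congr 1
        ring

theorem indicator_parabolic_tsum (u : Freq → ℝ≥0∞) (p : Freq) :
    u p ≤ ∑' d : ℕ, (parabolic d).indicator u p := by
  obtain ⟨d, hd⟩ := exists_dyadic (one_le_modulation p)
  refine le_trans (le_of_eq ?_) (ENNReal.le_tsum d)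
  rw [Set.indicator_of_mem]
  exact hd

/-- `X̂^{-1,1/2,1}` embeds into the energy space: on each slice of `B_d`, which has length at most
`2^{d+2}`, the `L¹` norm is controlled by the `L²` norm. -/
theorem energyNorm_le_besovNorm {u : Freq → ℝ≥0∞} (hu : Measurable u) :
    energyNorm u ≤ 2 * besovNorm u := by
  let A : ℕ → Set ℝ := fun j => {ξ | 2 ^ j ≤ jap ξ ∧ jap ξ < 2 ^ (j + 1)}
  have hA : ∀ j, MeasurableSet (A j) := fun j => (measurableSet_le measurable_const
    measurable_jap).inter (measurableSet_lt measurable_jap measurable_const)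
  have hcover : (⋃ j, A j) = Set.univ := Set.eq_univ_of_forall fun ξ => by
    obtain ⟨j, hj⟩ := exists_dyadic (one_le_jap ξ)
    exact Set.mem_iUnion.2 ⟨j, hj⟩
  have hslice : ∀ v : Freq → ℝ≥0∞, Measurable v → Measurable fun ξ : ℝ => ∫⁻ τ : ℝ, v (τ, ξ) :=
    fun v hv => hv.lintegral_prod_left'
  rw [energyNorm, mixedNorm, l2norm_le_iff, mul_pow, besovNorm_eq, rpow_half_sq,
    ← setLIntegral_univ, ← hcover, ← ENNReal.tsum_mul_left]
  refine (lintegral_iUnion_le _ _).trans (ENNReal.tsum_le_tsum fun j => ?_)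
  rw [← mul_pow]
  refine l2norm_le_iff.1 ?_
  have hBd : ∀ d : ℕ, Measurable ((parabolic d).indicator u) := fun d =>
    hu.indicator (measurableSet_parabolic d)
  have hpiece : ∀ d : ℕ, l2norm (volume.restrict (A j))
      (fun ξ => ∫⁻ τ : ℝ, (parabolic d).indicator u (τ, ξ)) ≤
      2 * 2 ^ (1 / 2 * (d : ℝ)) * l2norm (volume.restrict (annulus j ∩ parabolic d)) u := by
    intro d
    rw [l2norm_le_iff, mul_pow, l2norm_sq]
    have hcs : ∀ ξ : ℝ, (∫⁻ τ : ℝ, (parabolic d).indicator u (τ, ξ)) ^ 2 ≤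
        (2 * 2 ^ (1 / 2 * (d : ℝ))) ^ 2 *
          ∫⁻ τ : ℝ, (parabolic d).indicator (fun p => u p ^ 2) (τ, ξ) := by
      intro ξ
      have hm : MeasurableSet {τ : ℝ | (τ, ξ) ∈ parabolic d} :=
        (measurableSet_parabolic d).preimage (by fun_prop : Measurable fun τ : ℝ => (τ, ξ))
      have h := lintegral_mul_le_l2norm (μ := (volume : Measure ℝ))
        (u := {τ : ℝ | (τ, ξ) ∈ parabolic d}.indicator 1)
        (v := fun τ => (parabolic d).indicator u (τ, ξ))
        (measurable_one.indicator hm).aemeasurable ((hBd d).comp (by fun_prop)).aemeasurable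
      have h2 := pow_le_pow_left' h 2
      rw [mul_pow, l2norm_sq, l2norm_sq] at h2
      refine le_trans (le_of_eq ?_) (h2.trans (mul_le_mul' ?_ (le_of_eq ?_)))
      · congr 1
        refine lintegral_congr fun τ => ?_
        by_cases hτ : (τ, ξ) ∈ parabolic d <;> simp [hτ, Set.indicator]
      · refine le_trans (le_of_eq ?_) (volume_parabolic_slice_le d ξ)
        rw [← lintegral_indicator_one hm]
        refine lintegral_congr fun τ => ?_
        by_cases hτ : (τ, ξ) ∈ parabolic d <;> simp [hτ, Set.indicator]
      · refine lintegral_congr fun τ => ?_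
        by_cases hτ : (τ, ξ) ∈ parabolic d <;> simp [hτ, Set.indicator]
    refine (lintegral_mono fun ξ => hcs ξ).trans ?_
    have hm2 : Measurable ((parabolic d).indicator fun p => u p ^ 2) :=
      (hu.pow_const 2).indicator (measurableSet_parabolic d)
    rw [lintegral_const_mul _ (hslice _ hm2)]
    refine mul_le_mul_right (le_of_eq ?_) _
    rw [← lintegral_indicator (hA j), ← lintegral_indicator ((measurableSet_annulus j).inter
      (measurableSet_parabolic d)), lintegral_freq (((hu.pow_const 2).indicator
      ((measurableSet_annulus j).inter (measurableSet_parabolic d))).aemeasurable)]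
    refine lintegral_congr fun ξ => ?_
    by_cases hξ : ξ ∈ A j
    · rw [Set.indicator_of_mem hξ]
      refine lintegral_congr fun τ => ?_
      have hξ' : (τ, ξ) ∈ annulus j := hξ
      by_cases hτ : (τ, ξ) ∈ parabolic d <;> simp [hτ, hξ', Set.indicator]
    · rw [Set.indicator_of_notMem hξ]
      symm
      have : ∀ τ : ℝ, (τ, ξ) ∉ annulus j := fun τ h => hξ h
      simp [Set.indicator, this]
  calc l2norm (volume.restrict (A j))
        (fun ξ => ∫⁻ τ : ℝ, ENNReal.ofReal (jap ξ)⁻¹ * u (τ, ξ))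
      ≤ l2norm (volume.restrict (A j)) (fun ξ => 2 ^ (-1 * (j : ℝ)) *
          ∑' d : ℕ, ∫⁻ τ : ℝ, (parabolic d).indicator u (τ, ξ)) := by
        refine l2norm_mono_ae ((ae_restrict_iff' (hA j)).2 (ae_of_all _ fun ξ hξ => ?_))
        dsimp only
        have hs : Measurable fun τ : ℝ => (τ, ξ) := by fun_prop
        rw [lintegral_const_mul (f := fun τ => u (τ, ξ)) _ (hu.comp hs),
          ← lintegral_tsum (f := fun d τ => (parabolic d).indicator u (τ, ξ))
            fun d => ((hBd d).comp hs).aemeasurable]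
        refine mul_le_mul' ?_ (lintegral_mono fun τ => indicator_parabolic_tsum u _)
        rw [two_rpow_eq_ofReal, neg_one_mul, Real.rpow_neg two_pos.le, Real.rpow_natCast]
        exact ENNReal.ofReal_le_ofReal (inv_anti₀ (by positivity) hξ.1)
    _ ≤ 2 ^ (-1 * (j : ℝ)) * ∑' d : ℕ, l2norm (volume.restrict (A j))
          (fun ξ => ∫⁻ τ : ℝ, (parabolic d).indicator u (τ, ξ)) := by
        rw [l2norm_const_mul _ (Measurable.tsum fun d => hslice _ (hBd d)).aemeasurable]
        exact mul_le_mul_right (l2norm_tsum_le fun d => (hslice _ (hBd d)).aemeasurable) _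
    _ ≤ 2 ^ (-1 * (j : ℝ)) * ∑' d : ℕ, 2 * 2 ^ (1 / 2 * (d : ℝ)) *
          l2norm (volume.restrict (annulus j ∩ parabolic d)) u :=
        mul_le_mul_right (ENNReal.tsum_le_tsum hpiece) _
    _ = 2 * (2 ^ (-1 * (j : ℝ)) * ∑' d : ℕ, 2 ^ (1 / 2 * (d : ℝ)) *
          l2norm (volume.restrict (annulus j ∩ parabolic d)) u) := by
        simp_rw [mul_assoc (2 : ℝ≥0∞)]
        rw [ENNReal.tsum_mul_left]
        ring

/-- `Z` embeds into the energy space. -/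
theorem energyNorm_le_zNorm (u : Freq → ℝ≥0∞) : energyNorm u ≤ 2 * zNorm u := by
  rw [mul_comm, ← ENNReal.div_le_iff (by norm_num) (by norm_num)]
  refine le_sumNorm fun u₁ u₂ h₁ h₂ h => ?_
  rw [ENNReal.div_le_iff (by norm_num) (by norm_num)]
  calc energyNorm u ≤ energyNorm u₁ + energyNorm u₂ :=
        (IsFunctionNorm.energyNorm.mono _ _ h).trans (IsFunctionNorm.energyNorm.add_le h₁ h₂)
    _ ≤ 2 * besovNorm u₁ + 2 * (energyNorm u₂ + l2norm volume u₂) := by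
        refine add_le_add ?_ ?_
        · rw [IsFunctionNorm.energyNorm.congr_ae h₁.ae_eq_mk,
            IsFunctionNorm.besovNorm.congr_ae h₁.ae_eq_mk]
          exact energyNorm_le_besovNorm h₁.measurable_mk
        · rw [two_mul]
          exact le_add_right le_self_add
    _ = _ := by ring

theorem zNorm_eq_zero {u : Freq → ℝ≥0∞} (hu : AEMeasurable u volume) (h : zNorm u = 0) :
    u =ᵐ[volume] 0 := by
  refine energyNorm_eq_zero hu ?_
  have := energyNorm_le_zNorm u
  rwa [h, mul_zero, nonpos_iff_eq_zero] at this

/-- The weight `ρ = min(1, ⟨ξ⟩⁻¹ ⟨τ - ξ²⟩^{1/2})`. -/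
noncomputable def rho (p : Freq) : ℝ := min 1 ((jap p.2)⁻¹ * modulation p ^ (1 / 2 : ℝ))

theorem measurable_rho : Measurable rho :=
  measurable_const.min (((measurable_jap.comp measurable_snd).inv).mul
    (measurable_modulation.pow_const _))

theorem rho_pos (p : Freq) : 0 < rho p :=
  lt_min one_pos (mul_pos (inv_pos.2 (jap_pos _)) (Real.rpow_pos_of_pos (modulation_pos p) _))

/-- `Z` embeds into `L²` with the weight `ρ`, since `X̂^{-1,1/2,1}` embeds into `X̂^{-1,1/2}` and
`Y` into `L²`. -/
theorem l2norm_rho_le_zNorm {u : Freq → ℝ≥0∞} :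
    l2norm volume (fun p => ENNReal.ofReal (rho p) * u p) ≤ 2 * zNorm u := by
  have hρ := IsFunctionNorm.comp_mul (IsFunctionNorm.l2norm (volume : Measure Freq))
    measurable_rho.ennreal_ofReal.aemeasurable fun _ => ENNReal.ofReal_ne_top
  rw [mul_comm (2 : ℝ≥0∞), ← ENNReal.div_le_iff (by norm_num) (by norm_num)]
  refine le_sumNorm fun u₁ u₂ h₁ h₂ h => ?_
  rw [ENNReal.div_le_iff (by norm_num) (by norm_num)]
  calc l2norm volume (fun p => ENNReal.ofReal (rho p) * u p)
      ≤ l2norm volume (fun p => ENNReal.ofReal (rho p) * u₁ p) +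
          l2norm volume (fun p => ENNReal.ofReal (rho p) * u₂ p) :=
        (hρ.mono _ _ h).trans (hρ.add_le h₁ h₂)
    _ ≤ 2 * besovNorm u₁ + 2 * (energyNorm u₂ + l2norm volume u₂) := by
        refine add_le_add ?_ ?_
        · refine le_trans (l2norm_mono fun p => ?_) (l2norm_xWeight_le_besovNorm h₁)
          exact mul_le_mul_left (ENNReal.ofReal_le_ofReal (min_le_right _ _)) _
        · refine le_trans (l2norm_mono (v := u₂) fun p => ?_) ?_
          · refine (mul_le_mul_left (ENNReal.ofReal_le_ofReal (min_le_left _ _)) _).trans ?_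
            simp
          · rw [two_mul]
            exact le_add_right le_add_self
    _ = _ := by ring


/-! ### Weighted convolutions -/

/-- The converse of the Cauchy–Schwarz inequality. -/
theorem l2norm_le_of_forall_lintegral_mul_le {α : Type*} [MeasurableSpace α] {μ : Measure α}
    [SigmaFinite μ] {u : α → ℝ≥0∞} (hu : Measurable u) {C : ℝ≥0∞}
    (h : ∀ v : α → ℝ≥0∞, Measurable v → ∫⁻ x, u x * v x ∂μ ≤ C * l2norm μ v) :
    l2norm μ u ≤ C := by
  -- The truncations of `u` have finite norm, so that a factor of the norm cancels.
  let t : ℕ → α → ℝ≥0∞ := fun n => (spanningSets μ n).indicator fun x => min (u x) n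
  have ht : ∀ n, Measurable (t n) := fun n =>
    (hu.min measurable_const).indicator (measurableSet_spanningSets μ n)
  have ht_le : ∀ n x, t n x ≤ u x := fun n x =>
    (Set.indicator_le_self _ _ x).trans (min_le_left _ _)
  have ht_fin : ∀ n, ∫⁻ x, t n x ^ 2 ∂μ ≠ ∞ := by
    intro n
    refine ne_top_of_le_ne_top
      (b := ∫⁻ x, (spanningSets μ n).indicator (fun _ => (n : ℝ≥0∞) ^ 2) x ∂μ)
      ?_ (lintegral_mono fun x => ?_)
    · rw [lintegral_indicator_const (measurableSet_spanningSets μ n)]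
      exact ENNReal.mul_ne_top (by simp) (measure_spanningSets_lt_top μ n).ne
    · by_cases hx : x ∈ spanningSets μ n
      · simp only [t, Set.indicator_of_mem hx]
        exact pow_le_pow_left' (min_le_right _ _) 2
      · simp [t, Set.indicator_of_notMem hx]
  have ht_norm : ∀ n, l2norm μ (t n) ≤ C := by
    intro n
    rcases eq_or_ne (l2norm μ (t n)) 0 with h0 | h0
    · simp [h0]
    · have hne : l2norm μ (t n) ≠ ∞ := fun htop => ht_fin n (by rw [← l2norm_sq, htop]; simp)
      have h1 : l2norm μ (t n) * l2norm μ (t n) ≤ C * l2norm μ (t n) := by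
        rw [← sq, l2norm_sq]
        refine le_trans (lintegral_mono fun x => ?_) (h (t n) (ht n))
        rw [sq]
        exact mul_le_mul_left (ht_le n x) _
      exact (ENNReal.mul_le_mul_iff_left h0 hne).1 h1
  have hsup : ∀ x, u x ^ 2 = ⨆ n, t n x ^ 2 := by
    intro x
    rw [← ENNReal.iSup_pow]
    congr 1
    refine le_antisymm (le_of_forall_lt fun b hb => ?_) (iSup_le fun n => ht_le n x)
    obtain ⟨m, hm⟩ := ENNReal.exists_nat_gt hb.ne_top
    refine lt_of_lt_of_le ?_ (le_iSup _ (max m (spanningSetsIndex μ x)))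
    have hx : x ∈ spanningSets μ (max m (spanningSetsIndex μ x)) :=
      monotone_spanningSets μ (le_max_right _ _) (mem_spanningSetsIndex μ x)
    simp only [t, Set.indicator_of_mem hx]
    exact lt_min hb (hm.trans_le (by exact_mod_cast le_max_left _ _))
  rw [l2norm_le_iff]
  simp_rw [hsup]
  rw [lintegral_iSup (fun n => (ht n).pow_const 2)]
  · exact iSup_le fun n => l2norm_le_iff.1 (ht_norm n)
  · intro m n hmn x
    refine pow_le_pow_left' ?_ 2
    by_cases hx : x ∈ spanningSets μ m
    · have hx' := monotone_spanningSets μ hmn hx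
      simp only [t, Set.indicator_of_mem hx, Set.indicator_of_mem hx']
      exact min_le_min_left _ (by exact_mod_cast hmn)
    · simp [t, Set.indicator_of_notMem hx]

/-- The convolution of `u` and `v`, weighted with a kernel `κ` which depends on the two
frequencies. -/
noncomputable def bil (κ : Freq → Freq → ℝ≥0∞) (u v : Freq → ℝ≥0∞) (p : Freq) : ℝ≥0∞ :=
  ∫⁻ q, κ q (p - q) * (u q * v (p - q))

section bil

variable {κ κ' : Freq → Freq → ℝ≥0∞} {u v : Freq → ℝ≥0∞} {K : ℝ≥0∞}

theorem measurable_bil_integrand (hκ : Measurable (Function.uncurry κ)) (hu : Measurable u)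
    (hv : Measurable v) :
    Measurable fun z : Freq × Freq => κ z.2 (z.1 - z.2) * (u z.2 * v (z.1 - z.2)) := by
  have h1 : Measurable fun z : Freq × Freq => (z.2, z.1 - z.2) := by fun_prop
  exact (hκ.comp h1).mul
    ((hu.comp measurable_snd).mul (hv.comp (measurable_fst.sub measurable_snd)))

theorem measurable_bil (hκ : Measurable (Function.uncurry κ)) (hu : Measurable u)
    (hv : Measurable v) : Measurable (bil κ u v) :=
  (measurable_bil_integrand hκ hu hv).lintegral_prod_right'

theorem bil_mono (h : ∀ q r, κ q r ≤ κ' q r) (p : Freq) : bil κ u v p ≤ bil κ' u v p :=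
  lintegral_mono fun _ => mul_le_mul_left (h _ _) _

theorem bil_add_left (hκ : Measurable (Function.uncurry κ))
    (hu : Measurable u) (hv : Measurable v) (p : Freq) :
    bil (fun q r => κ q r + κ' q r) u v p = bil κ u v p + bil κ' u v p := by
  unfold bil
  rw [← lintegral_add_left]
  · exact lintegral_congr fun q => add_mul _ _ _
  · exact (measurable_bil_integrand hκ hu hv).comp measurable_prodMk_left

theorem bil_const_mul {c : ℝ≥0∞} (hc : c ≠ ∞) (p : Freq) :
    bil (fun q r => c * κ q r) u v p = c * bil κ u v p := by
  unfold bil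
  rw [← lintegral_const_mul' _ _ hc]
  exact lintegral_congr fun q => mul_assoc _ _ _

theorem bil_comm (p : Freq) : bil κ u v p = bil (fun q r => κ r q) v u p := by
  unfold bil
  rw [← lintegral_sub_left_eq_self (fun q => κ q (p - q) * (u q * v (p - q))) p]
  refine lintegral_congr fun q => ?_
  rw [sub_sub_cancel, mul_comm (u _)]

theorem lintegral_lintegral_sub_mul (hu : Measurable u) (hv : Measurable v) :
    ∫⁻ p : Freq, ∫⁻ q : Freq, u q * v (p - q) = (∫⁻ q, u q) * ∫⁻ q, v q := by
  rw [lintegral_lintegral_swap]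
  · rw [← lintegral_mul_const _ hu]
    refine lintegral_congr fun q => ?_
    have hvq : Measurable fun p => v (p - q) := hv.comp (measurable_id.sub_const q)
    rw [lintegral_const_mul _ hvq, lintegral_sub_right_eq_self]
  · exact ((hu.comp measurable_snd).mul
      (hv.comp (measurable_fst.sub measurable_snd))).aemeasurable

/-- An `L²` bound for a weighted convolution from the `L²` norm of the kernel on the set of pairs
of frequencies with a given sum. -/
theorem l2norm_bil_le_of_sum (hκ : Measurable (Function.uncurry κ)) (hu : Measurable u)
    (hv : Measurable v) (h : ∀ p, ∫⁻ q, κ q (p - q) ^ 2 ≤ K ^ 2) :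
    l2norm volume (bil κ u v) ≤ K * (l2norm volume u * l2norm volume v) := by
  rw [l2norm_le_iff, mul_pow, mul_pow, l2norm_sq, l2norm_sq,
    ← lintegral_lintegral_sub_mul (hu.pow_const 2) (hv.pow_const 2)]
  have hm : Measurable fun p : Freq => ∫⁻ q : Freq, u q ^ 2 * v (p - q) ^ 2 := by
    refine Measurable.lintegral_prod_right'
      (f := fun z : Freq × Freq => u z.2 ^ 2 * v (z.1 - z.2) ^ 2)
      (((hu.comp measurable_snd).pow_const 2).mul
        ((hv.comp (measurable_fst.sub measurable_snd)).pow_const 2))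
  rw [← lintegral_const_mul _ hm]
  refine lintegral_mono fun p => ?_
  have h1 : Measurable fun q : Freq => κ q (p - q) :=
    hκ.comp (by fun_prop : Measurable fun q : Freq => (q, p - q))
  have h2 : Measurable fun q : Freq => u q * v (p - q) :=
    hu.mul (hv.comp (measurable_const.sub measurable_id))
  have h3 := pow_le_pow_left' (lintegral_mul_le_l2norm (μ := (volume : Measure Freq))
    h1.aemeasurable h2.aemeasurable) 2
  rw [mul_pow, l2norm_sq, l2norm_sq] at h3
  refine h3.trans (mul_le_mul' (h p) (le_of_eq ?_))
  simp_rw [mul_pow]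

/-- An `L²` bound for a weighted convolution from the `L²` norm of the kernel in the second
frequency: the dual of `l2norm_bil_le_of_sum`. -/
theorem l2norm_bil_le_of_left (hκ : Measurable (Function.uncurry κ)) (hu : Measurable u)
    (hv : Measurable v) (h : ∀ q, ∫⁻ r, κ q r ^ 2 ≤ K ^ 2) :
    l2norm volume (bil κ u v) ≤ K * (l2norm volume u * l2norm volume v) := by
  refine l2norm_le_of_forall_lintegral_mul_le (measurable_bil hκ hu hv) fun w hw => ?_
  have hvw : Measurable fun z : Freq × Freq => v z.2 * w (z.1 + z.2) :=
    (hv.comp measurable_snd).mul (hw.comp (measurable_fst.add measurable_snd))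
  -- The norm of `r ↦ v r * w (q + r)`, as a function of `q`, is `‖v‖ ‖w‖`.
  let m : Freq → ℝ≥0∞ := fun q => l2norm volume fun r => v r * w (q + r)
  have hm : Measurable m := by
    refine Measurable.pow_const ?_ _
    exact Measurable.lintegral_prod_right'
      (f := fun z : Freq × Freq => (v z.2 * w (z.1 + z.2)) ^ 2) (hvw.pow_const 2)
  have hm_norm : l2norm volume m = l2norm volume v * l2norm volume w := by
    have hsq : ∫⁻ q, m q ^ 2 = (l2norm volume v * l2norm volume w) ^ 2 := by
      simp_rw [m, l2norm_sq, mul_pow]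
      have hvw2 : Measurable (Function.uncurry fun q r : Freq => v r ^ 2 * w (q + r) ^ 2) :=
        ((hv.comp measurable_snd).pow_const 2).mul
          ((hw.comp (measurable_fst.add measurable_snd)).pow_const 2)
      rw [lintegral_lintegral_swap hvw2.aemeasurable, l2norm_sq, l2norm_sq,
        ← lintegral_mul_const _ (hv.pow_const 2)]
      refine lintegral_congr fun r => ?_
      have hwr : Measurable fun q => w (q + r) := hw.comp (measurable_id.add_const r)
      rw [lintegral_const_mul _ (hwr.pow_const 2),
        lintegral_add_right_eq_self (fun q => w q ^ 2)]
    rw [l2norm, hsq, sq_rpow_half]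
  have hinner : ∀ q, ∫⁻ r, κ q r * (v r * w (q + r)) ≤ K * m q := by
    intro q
    refine (lintegral_mul_le_l2norm (hκ.comp measurable_prodMk_left).aemeasurable
      (hvw.comp measurable_prodMk_left).aemeasurable).trans (mul_le_mul_left ?_ _)
    exact l2norm_le_iff.2 (h q)
  have hmeas := measurable_bil_integrand hκ hu hv
  calc ∫⁻ p, bil κ u v p * w p
      = ∫⁻ p, ∫⁻ q, κ q (p - q) * (u q * v (p - q)) * w p := by
        refine lintegral_congr fun p => ?_
        have hp : Measurable fun q => κ q (p - q) * (u q * v (p - q)) :=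
          hmeas.comp measurable_prodMk_left
        rw [bil, lintegral_mul_const _ hp]
    _ = ∫⁻ q, ∫⁻ p, κ q (p - q) * (u q * v (p - q)) * w p :=
        lintegral_lintegral_swap (hmeas.mul (hw.comp measurable_fst)).aemeasurable
    _ = ∫⁻ q, ∫⁻ r, κ q r * (u q * v r) * w (q + r) := by
        refine lintegral_congr fun q => ?_
        rw [← lintegral_add_left_eq_self _ q]
        refine lintegral_congr fun r => ?_
        rw [add_sub_cancel_left]
    _ = ∫⁻ q, u q * ∫⁻ r, κ q r * (v r * w (q + r)) := by
        refine lintegral_congr fun q => ?_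
        have hκq : Measurable fun r => κ q r := hκ.comp measurable_prodMk_left
        have hvwq : Measurable fun r => κ q r * (v r * w (q + r)) :=
          hκq.mul (hvw.comp measurable_prodMk_left)
        rw [← lintegral_const_mul _ hvwq]
        refine lintegral_congr fun r => ?_
        ring
    _ ≤ ∫⁻ q, K * (u q * m q) := by
        refine lintegral_mono fun q => ?_
        rw [mul_left_comm K]
        exact mul_le_mul_right (hinner q) _
    _ = K * ∫⁻ q, u q * m q := lintegral_const_mul _ (hu.mul hm)
    _ ≤ K * (l2norm volume u * l2norm volume m) :=
        mul_le_mul_right (lintegral_mul_le_l2norm hu.aemeasurable hm.aemeasurable) _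
    _ = K * (l2norm volume u * l2norm volume v) * l2norm volume w := by
        rw [hm_norm]
        ring

theorem l2norm_bil_le_of_right (hκ : Measurable (Function.uncurry κ)) (hu : Measurable u)
    (hv : Measurable v) (h : ∀ r, ∫⁻ q, κ q r ^ 2 ≤ K ^ 2) :
    l2norm volume (bil κ u v) ≤ K * (l2norm volume u * l2norm volume v) := by
  have heq : bil κ u v = bil (fun q r => κ r q) v u := funext fun p => bil_comm p
  rw [heq, mul_comm (l2norm volume u)]
  exact l2norm_bil_le_of_left (hκ.comp measurable_swap) hv hu h

/-- Young's inequality `L² * L¹ ⊆ L²`. -/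
theorem l2norm_bil_one_le (hu : Measurable u) (hv : Measurable v) :
    l2norm volume (bil (fun _ _ => 1) u v) ≤ l2norm volume u * ∫⁻ q, v q := by
  rw [l2norm_le_iff, mul_pow, l2norm_sq, sq (∫⁻ q, v q), ← mul_assoc,
    ← lintegral_lintegral_sub_mul (hu.pow_const 2) hv]
  have hm : Measurable fun p : Freq => ∫⁻ q : Freq, u q ^ 2 * v (p - q) :=
    Measurable.lintegral_prod_right' (f := fun z : Freq × Freq => u z.2 ^ 2 * v (z.1 - z.2))
      (((hu.comp measurable_snd).pow_const 2).mul (hv.comp (measurable_fst.sub measurable_snd)))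
  rw [← lintegral_mul_const _ hm]
  refine lintegral_mono fun p => ?_
  have hvp : Measurable fun q : Freq => v (p - q) := hv.comp (measurable_const.sub measurable_id)
  have h3 := pow_le_pow_left' (lintegral_mul_le_l2norm (μ := (volume : Measure Freq))
    (u := fun q => u q * v (p - q) ^ (1 / 2 : ℝ)) (v := fun q => v (p - q) ^ (1 / 2 : ℝ))
    (hu.mul (hvp.pow_const _)).aemeasurable (hvp.pow_const _).aemeasurable) 2
  rw [mul_pow, l2norm_sq, l2norm_sq] at h3
  simp_rw [mul_pow, rpow_half_sq, lintegral_sub_left_eq_self] at h3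
  refine le_trans (le_of_eq ?_) h3
  simp only [bil, one_mul]
  congr 1
  refine lintegral_congr fun q => ?_
  rw [mul_assoc, ← sq, rpow_half_sq]

end bil


/-! ### Integrals of powers of the bracket -/

theorem jap_neg (x : ℝ) : jap (-x) = jap x := by simp [jap]

/-- The power `⟨x⟩^a`, with values in `[0, ∞]`. -/
noncomputable def japPow (a x : ℝ) : ℝ≥0∞ := ENNReal.ofReal (jap x ^ a)

theorem measurable_japPow (a : ℝ) : Measurable (japPow a) :=
  (measurable_jap.pow_const a).ennreal_ofReal

theorem japPow_ne_top (a x : ℝ) : japPow a x ≠ ∞ := ENNReal.ofReal_ne_top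

theorem japPow_neg (a x : ℝ) : japPow a (-x) = japPow a x := by rw [japPow, jap_neg, japPow]

theorem japPow_mul_japPow (a b x : ℝ) : japPow a x * japPow b x = japPow (a + b) x := by
  rw [japPow, japPow, japPow, Real.rpow_add (jap_pos x),
    ENNReal.ofReal_mul (Real.rpow_nonneg (jap_pos x).le _)]

theorem japPow_sq (a x : ℝ) : japPow a x ^ 2 = japPow (2 * a) x := by
  rw [sq, japPow_mul_japPow, two_mul]

theorem lintegral_japPow_ne_top {a : ℝ} (ha : a < -1) : ∫⁻ x, japPow a x ≠ ∞ := by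
  have h := integrable_rpow_neg_one_add_norm_sq (E := ℝ) (μ := volume) (r := -a)
    (by simpa using by linarith)
  refine ne_top_of_le_ne_top h.2.ne (lintegral_mono fun x => le_of_eq ?_)
  rw [Real.enorm_eq_ofReal (by positivity), japPow, jap, Real.sqrt_eq_rpow,
    ← Real.rpow_mul (by positivity)]
  simp only [Real.norm_eq_abs, sq_abs]
  congr 2
  ring

theorem lintegral_comp_mul_left {f : ℝ → ℝ≥0∞} (hf : Measurable f) {m : ℝ} (hm : m ≠ 0) :
    ENNReal.ofReal |m| * ∫⁻ x, f (m * x) = ∫⁻ x, f x := by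
  conv_rhs => rw [← Real.smul_map_volume_mul_left hm]
  rw [lintegral_smul_measure, lintegral_map hf (measurable_const_mul m), smul_eq_mul]

theorem lintegral_japPow_affine_le (a c m : ℝ) :
    ∫⁻ x, ENNReal.ofReal |m| * japPow a (c - 2 * m * x) ≤ ∫⁻ x, japPow a x := by
  rcases eq_or_ne m 0 with rfl | hm
  · simp
  · have hmeas : Measurable fun x => japPow a (c - x) :=
      (measurable_japPow a).comp (measurable_const.sub measurable_id)
    rw [lintegral_const_mul' _ _ ENNReal.ofReal_ne_top,
      ← lintegral_sub_left_eq_self (japPow a) c,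
      ← lintegral_comp_mul_left hmeas (mul_ne_zero two_ne_zero hm)]
    refine mul_le_mul_left (ENNReal.ofReal_le_ofReal ?_) _
    rw [abs_mul]
    nlinarith [abs_nonneg m, abs_two (α := ℝ)]

/-- Integration over frequency space of a product in coordinates sheared in the direction of `τ`. -/
theorem lintegral_sheared {g : ℝ → ℝ≥0∞} (hg : Measurable g) (a : ℝ) {c : ℝ → ℝ}
    (hc : Measurable c) :
    ∫⁻ q : Freq, g q.2 * japPow a (q.1 + c q.2) = (∫⁻ x, g x) * ∫⁻ x, japPow a x := by
  have hm : Measurable fun q : Freq => g q.2 * japPow a (q.1 + c q.2) :=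
    (hg.comp measurable_snd).mul ((measurable_japPow a).comp
      (measurable_fst.add (hc.comp measurable_snd)))
  rw [lintegral_freq hm.aemeasurable, ← lintegral_mul_const _ hg]
  refine lintegral_congr fun ξ => ?_
  dsimp only
  have hm : Measurable fun τ => japPow a (τ + c ξ) :=
    (measurable_japPow a).comp (measurable_id.add_const _)
  rw [lintegral_const_mul _ hm, lintegral_add_right_eq_self (japPow a)]

/-- Near its zeros `±s` the phase `a - 2 x²` dominates the square of the distance to the zeros. -/
theorem jap_quadratic_ge (a : ℝ) : ∃ s : ℝ, ∀ x,
    jap (x - s) ^ 2 ≤ 2 * jap (a - 2 * x ^ 2) ∨ jap (x + s) ^ 2 ≤ 2 * jap (a - 2 * x ^ 2) := by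
  have key : ∀ y z : ℝ, 2 * y ^ 2 ≤ |z| → jap y ^ 2 ≤ 2 * jap z := by
    intro y z h
    have h1 := abs_le_jap z
    have h2 := one_le_jap z
    rw [jap_sq]
    linarith
  rcases le_total a 0 with ha | ha
  · refine ⟨0, fun x => Or.inl (key _ _ ?_)⟩
    rw [sub_zero, abs_of_nonpos (by nlinarith [sq_nonneg x])]
    linarith
  · refine ⟨√(a / 2), fun x => ?_⟩
    have hs : √(a / 2) ^ 2 = a / 2 := Real.sq_sqrt (by positivity)
    have hs0 := Real.sqrt_nonneg (a / 2)
    set s := √(a / 2)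
    have hfac : a - 2 * x ^ 2 = 2 * ((s - x) * (s + x)) := by linear_combination -2 * hs
    rcases le_total 0 x with hx | hx
    · refine Or.inl (key _ _ ?_)
      rw [hfac, abs_mul, abs_mul, abs_two, ← sq_abs (x - s), sq, abs_sub_comm s x,
        abs_of_nonneg (add_nonneg hs0 hx)]
      have : |x - s| ≤ s + x := abs_le.2 ⟨by linarith, by linarith⟩
      nlinarith [abs_nonneg (x - s)]
    · refine Or.inr (key _ _ ?_)
      rw [hfac, abs_mul, abs_mul, abs_two, ← sq_abs (x + s), sq, add_comm s x,
        abs_of_nonneg (by linarith : 0 ≤ s - x)]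
      have : |x + s| ≤ s - x := abs_le.2 ⟨by linarith, by linarith⟩
      nlinarith [abs_nonneg (x + s)]

/-- A uniform bound for the integral of a power of the bracket of a quadratic phase. -/
theorem exists_lintegral_japPow_quadratic_le : ∃ C : ℝ≥0∞, C ≠ ∞ ∧ ∀ a b : ℝ,
    ∫⁻ x, japPow (-(3 / 4)) (a - x ^ 2 - (b - x) ^ 2) ≤ C := by
  have hI := lintegral_japPow_ne_top (a := -(3 / 2)) (by norm_num)
  refine ⟨2 * ((∫⁻ x, japPow (-(3 / 2)) x) + ∫⁻ x, japPow (-(3 / 2)) x),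
    ENNReal.mul_ne_top (by norm_num) (ENNReal.add_ne_top.2 ⟨hI, hI⟩), fun a b => ?_⟩
  obtain ⟨s, hs⟩ := jap_quadratic_ge (a - b ^ 2 / 2)
  have hpow : ∀ y z : ℝ, jap y ^ 2 ≤ 2 * jap z → japPow (-(3 / 4)) z ≤ 2 * japPow (-(3 / 2)) y := by
    intro y z h
    have hy := jap_pos y
    have hz := jap_pos z
    rw [japPow, japPow, ← ENNReal.ofReal_ofNat 2, ← ENNReal.ofReal_mul (by norm_num)]
    refine ENNReal.ofReal_le_ofReal ?_
    calc jap z ^ (-(3 / 4) : ℝ) ≤ (jap y ^ 2 / 2) ^ (-(3 / 4) : ℝ) :=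
          Real.rpow_le_rpow_of_nonpos (by positivity) (by linarith) (by norm_num)
      _ = 2 ^ (3 / 4 : ℝ) * jap y ^ (-(3 / 2) : ℝ) := by
          rw [Real.div_rpow (by positivity) (by norm_num), ← Real.rpow_natCast,
            ← Real.rpow_mul hy.le, Real.rpow_neg two_pos.le, div_inv_eq_mul, mul_comm]
          norm_num
      _ ≤ 2 * jap y ^ (-(3 / 2) : ℝ) := by
          gcongr
          calc (2 : ℝ) ^ (3 / 4 : ℝ) ≤ 2 ^ (1 : ℝ) :=
                Real.rpow_le_rpow_of_exponent_le one_le_two (by norm_num)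
            _ = 2 := by norm_num
  have hm1 : Measurable fun x => japPow (-(3 / 2)) (x - s) :=
    (measurable_japPow _).comp (measurable_id.sub_const _)
  have hm2 : Measurable fun x => japPow (-(3 / 2)) (x + s) :=
    (measurable_japPow _).comp (measurable_id.add_const _)
  calc ∫⁻ x, japPow (-(3 / 4)) (a - x ^ 2 - (b - x) ^ 2)
      = ∫⁻ x, japPow (-(3 / 4)) (a - b ^ 2 / 2 - 2 * x ^ 2) := by
        rw [← lintegral_add_right_eq_self _ (b / 2)]
        refine lintegral_congr fun x => ?_
        congr 1
        ring
    _ ≤ ∫⁻ x, 2 * (japPow (-(3 / 2)) (x - s) + japPow (-(3 / 2)) (x + s)) := by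
        refine lintegral_mono fun x => ?_
        rw [mul_add]
        rcases hs x with h | h
        · exact le_add_right (hpow _ _ h)
        · exact le_add_left (hpow _ _ h)
    _ = _ := by
        rw [lintegral_const_mul' _ _ (by norm_num), lintegral_add_left hm1,
          lintegral_sub_right_eq_self, lintegral_add_right_eq_self]

/-! ### Kernels bounded on `L²` -/

/-- The weighted convolution with kernel `κ` is bounded from `L² × L²` to `L²`. -/
def L2Bounded (κ : Freq → Freq → ℝ≥0∞) : Prop :=
  ∃ C : ℝ≥0, ∀ u v : Freq → ℝ≥0∞, Measurable u → Measurable v →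
    l2norm volume (bil κ u v) ≤ C * (l2norm volume u * l2norm volume v)

namespace L2Bounded

variable {κ κ' : Freq → Freq → ℝ≥0∞}

theorem mono (h : L2Bounded κ) {c : ℝ≥0} (hκ : ∀ q r, κ' q r ≤ c * κ q r)
    (hm : Measurable (Function.uncurry κ)) : L2Bounded κ' := by
  obtain ⟨C, hC⟩ := h
  refine ⟨c * C, fun u v hu hv => ?_⟩
  calc l2norm volume (bil κ' u v) ≤ l2norm volume (fun p => c * bil κ u v p) :=
        l2norm_mono fun p => (bil_mono hκ p).trans (bil_const_mul ENNReal.coe_ne_top p).le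
    _ = c * l2norm volume (bil κ u v) :=
        l2norm_const_mul _ (measurable_bil hm hu hv).aemeasurable
    _ ≤ c * (C * (l2norm volume u * l2norm volume v)) := mul_le_mul_right (hC u v hu hv) _
    _ = _ := by rw [ENNReal.coe_mul, mul_assoc]

theorem add (h : L2Bounded κ) (h' : L2Bounded κ') (hm : Measurable (Function.uncurry κ))
    (hm' : Measurable (Function.uncurry κ')) : L2Bounded (fun q r => κ q r + κ' q r) := by
  obtain ⟨C, hC⟩ := h
  obtain ⟨C', hC'⟩ := h'
  refine ⟨C + C', fun u v hu hv => ?_⟩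
  have : bil (fun q r => κ q r + κ' q r) u v = fun p => bil κ u v p + bil κ' u v p :=
    funext fun p => bil_add_left hm hu hv p
  rw [this, ENNReal.coe_add, add_mul]
  exact (l2norm_add_le (measurable_bil hm hu hv).aemeasurable
    (measurable_bil hm' hu hv).aemeasurable).trans (add_le_add (hC u v hu hv) (hC' u v hu hv))

theorem swap (h : L2Bounded κ) : L2Bounded (fun q r => κ r q) := by
  obtain ⟨C, hC⟩ := h
  refine ⟨C, fun u v hu hv => ?_⟩
  have : bil (fun q r => κ r q) u v = bil κ v u := funext fun p => bil_comm p
  rw [this, mul_comm (l2norm volume u)]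
  exact hC v u hv hu

theorem exists_le_sq {c : ℝ≥0∞} (hc : c ≠ ∞) : ∃ K : ℝ≥0, c ≤ (K : ℝ≥0∞) ^ 2 := by
  lift c to ℝ≥0 using hc
  refine ⟨1 + c, ?_⟩
  norm_cast
  nlinarith [c.2]

theorem of_sum (hκ : Measurable (Function.uncurry κ)) {c : ℝ≥0∞} (hc : c ≠ ∞)
    (h : ∀ p, ∫⁻ q, κ q (p - q) ^ 2 ≤ c) : L2Bounded κ := by
  obtain ⟨K, hK⟩ := exists_le_sq hc
  exact ⟨K, fun u v hu hv => l2norm_bil_le_of_sum hκ hu hv fun p => (h p).trans hK⟩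

theorem of_left (hκ : Measurable (Function.uncurry κ)) {c : ℝ≥0∞} (hc : c ≠ ∞)
    (h : ∀ q, ∫⁻ r, κ q r ^ 2 ≤ c) : L2Bounded κ := by
  obtain ⟨K, hK⟩ := exists_le_sq hc
  exact ⟨K, fun u v hu hv => l2norm_bil_le_of_left hκ hu hv fun p => (h p).trans hK⟩

theorem of_right (hκ : Measurable (Function.uncurry κ)) {c : ℝ≥0∞} (hc : c ≠ ∞)
    (h : ∀ r, ∫⁻ q, κ q r ^ 2 ≤ c) : L2Bounded κ := by
  obtain ⟨K, hK⟩ := exists_le_sq hc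
  exact ⟨K, fun u v hu hv => l2norm_bil_le_of_right hκ hu hv fun p => (h p).trans hK⟩

end L2Bounded

/-- The power `⟨ξ⟩^a` as a function on frequency space. -/
noncomputable def xiPow (a : ℝ) (p : Freq) : ℝ≥0∞ := japPow a p.2

/-- The power `⟨τ - ξ²⟩^a` as a function on frequency space. -/
noncomputable def modPow (a : ℝ) (p : Freq) : ℝ≥0∞ := japPow a (p.1 - p.2 ^ 2)

theorem measurable_xiPow (a : ℝ) : Measurable (xiPow a) := (measurable_japPow a).comp measurable_snd

theorem measurable_modPow (a : ℝ) : Measurable (modPow a) :=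
  (measurable_japPow a).comp (measurable_fst.sub (measurable_snd.pow_const 2))

theorem measurable_add_freq : Measurable fun z : Freq × Freq => z.1 + z.2 :=
  measurable_fst.add measurable_snd

/-- A kernel depending on the sum of the frequencies only, and square integrable in it. -/
theorem l2Bounded_xiPow_modPow_sum :
    L2Bounded fun q r => xiPow (-(3 / 4)) (q + r) * modPow (-(9 / 16)) (q + r) := by
  have hm : Measurable (Function.uncurry fun q r =>
      xiPow (-(3 / 4)) (q + r) * modPow (-(9 / 16)) (q + r)) :=
    ((measurable_xiPow _).comp measurable_add_freq).mul
      ((measurable_modPow _).comp measurable_add_freq)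
  refine L2Bounded.of_left hm
    (ENNReal.mul_ne_top (lintegral_japPow_ne_top (a := 2 * -(3 / 4)) (by norm_num))
      (lintegral_japPow_ne_top (a := 2 * -(9 / 16)) (by norm_num))) fun q => le_of_eq ?_
  rw [lintegral_add_left_eq_self
    (fun p => (xiPow (-(3 / 4)) p * modPow (-(9 / 16)) p) ^ 2) q]
  simp_rw [mul_pow, xiPow, modPow, japPow_sq, sub_eq_add_neg]
  exact lintegral_sheared (g := japPow _) (measurable_japPow _) _ (c := fun x => -x ^ 2)
    (by fun_prop)

/-- The bilinear estimate behind the convolution of two functions in `X̂^{-1,1/2}` whose output has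
the dominant modulation. -/
theorem l2Bounded_modPow_mul_modPow :
    L2Bounded fun q r => modPow (-(1 / 2)) q * modPow (-(1 / 2)) r := by
  obtain ⟨C, hC, hle⟩ := exists_lintegral_japPow_quadratic_le
  have hI := lintegral_japPow_ne_top (a := -(5 / 4)) (by norm_num)
  -- The larger of two brackets controls the bracket of the sum.
  have key : ∀ x y : ℝ, japPow (-1) x * japPow (-1) y ≤
      2 * (japPow (-(3 / 4)) (x + y) * japPow (-(5 / 4)) x +
        japPow (-(3 / 4)) (x + y) * japPow (-(5 / 4)) y) := by
    have aux : ∀ x y : ℝ, jap y ≤ jap x → japPow (-1) x * japPow (-1) y ≤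
        2 * (japPow (-(3 / 4)) (x + y) * japPow (-(5 / 4)) y) := by
      intro x y h
      have hx := jap_pos x
      have hy := jap_pos y
      have hxy := jap_pos (x + y)
      have hsum : jap (x + y) ≤ 2 * jap x := by
        refine abs_le_of_sq_le_sq' ?_ (by positivity) |>.2
        have h1 := jap_sq x
        have h2 := jap_sq y
        have h3 := jap_sq (x + y)
        nlinarith [sq_nonneg (x - y)]
      simp only [japPow]
      rw [← ENNReal.ofReal_mul (by positivity), ← ENNReal.ofReal_mul (by positivity),
        ← ENNReal.ofReal_ofNat 2, ← ENNReal.ofReal_mul (by norm_num)]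
      refine ENNReal.ofReal_le_ofReal ?_
      have e1 : jap x ^ (-1 : ℝ) = jap x ^ (-(3 / 4) : ℝ) * jap x ^ (-(1 / 4) : ℝ) := by
        rw [← Real.rpow_add hx]; norm_num
      have e2 : jap y ^ (-(5 / 4) : ℝ) = jap y ^ (-(1 / 4) : ℝ) * jap y ^ (-1 : ℝ) := by
        rw [← Real.rpow_add hy]; norm_num
      have e3 : jap x ^ (-(3 / 4) : ℝ) ≤ 2 * jap (x + y) ^ (-(3 / 4) : ℝ) := by
        calc jap x ^ (-(3 / 4) : ℝ) ≤ (jap (x + y) / 2) ^ (-(3 / 4) : ℝ) :=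
              Real.rpow_le_rpow_of_nonpos (by positivity) (by linarith) (by norm_num)
          _ = 2 ^ (3 / 4 : ℝ) * jap (x + y) ^ (-(3 / 4) : ℝ) := by
              rw [Real.div_rpow hxy.le (by norm_num), Real.rpow_neg two_pos.le, div_inv_eq_mul,
                mul_comm]
          _ ≤ 2 * jap (x + y) ^ (-(3 / 4) : ℝ) := by
              gcongr
              calc (2 : ℝ) ^ (3 / 4 : ℝ) ≤ 2 ^ (1 : ℝ) :=
                    Real.rpow_le_rpow_of_exponent_le one_le_two (by norm_num)
                _ = 2 := by norm_num
      have e4 : jap x ^ (-(1 / 4) : ℝ) ≤ jap y ^ (-(1 / 4) : ℝ) :=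
        Real.rpow_le_rpow_of_nonpos hy h (by norm_num)
      rw [e1, e2]
      calc jap x ^ (-(3 / 4) : ℝ) * jap x ^ (-(1 / 4) : ℝ) * jap y ^ (-1 : ℝ)
          ≤ (2 * jap (x + y) ^ (-(3 / 4) : ℝ)) * jap y ^ (-(1 / 4) : ℝ) * jap y ^ (-1 : ℝ) := by
            gcongr
        _ = _ := by ring
    intro x y
    rw [mul_add]
    rcases le_total (jap y) (jap x) with h | h
    · exact le_add_left (aux x y h)
    · rw [mul_comm (japPow (-1) x), add_comm x y]
      exact le_add_right (aux y x h)
  refine L2Bounded.of_sum (((measurable_modPow _).comp measurable_fst).mul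
    ((measurable_modPow _).comp measurable_snd))
    (c := 2 * (C * (∫⁻ x, japPow (-(5 / 4)) x) + C * ∫⁻ x, japPow (-(5 / 4)) x))
    (ENNReal.mul_ne_top (by norm_num) (ENNReal.add_ne_top.2 ⟨ENNReal.mul_ne_top hC hI,
      ENNReal.mul_ne_top hC hI⟩)) fun p => ?_
  have hg : Measurable fun x => japPow (-(3 / 4)) (p.1 - x ^ 2 - (p.2 - x) ^ 2) :=
    (measurable_japPow _).comp (by fun_prop)
  have hm : Measurable fun q : Freq => japPow (-(3 / 4)) (p.1 - q.2 ^ 2 - (p.2 - q.2) ^ 2) *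
      japPow (-(5 / 4)) (q.1 + -q.2 ^ 2) :=
    (hg.comp measurable_snd).mul ((measurable_japPow _).comp (by fun_prop))
  have hm' : Measurable fun q : Freq => japPow (-(3 / 4)) (p.1 - q.2 ^ 2 - (p.2 - q.2) ^ 2) *
      japPow (-(5 / 4)) (q.1 + (-p.1 + (p.2 - q.2) ^ 2)) :=
    (hg.comp measurable_snd).mul ((measurable_japPow _).comp (by fun_prop))
  calc ∫⁻ q, (modPow (-(1 / 2)) q * modPow (-(1 / 2)) (p - q)) ^ 2
      ≤ ∫⁻ q : Freq, 2 * (japPow (-(3 / 4)) (p.1 - q.2 ^ 2 - (p.2 - q.2) ^ 2) *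
          japPow (-(5 / 4)) (q.1 + -q.2 ^ 2) +
          japPow (-(3 / 4)) (p.1 - q.2 ^ 2 - (p.2 - q.2) ^ 2) *
            japPow (-(5 / 4)) (q.1 + (-p.1 + (p.2 - q.2) ^ 2))) := by
        refine lintegral_mono fun q => ?_
        rw [mul_pow, modPow, modPow, japPow_sq, japPow_sq]
        norm_num only
        refine (key _ _).trans (le_of_eq ?_)
        have e1 : q.1 - q.2 ^ 2 + ((p - q).1 - (p - q).2 ^ 2) =
            p.1 - q.2 ^ 2 - (p.2 - q.2) ^ 2 := by
          simp only [Prod.fst_sub, Prod.snd_sub]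
          ring
        have e2 : (p - q).1 - (p - q).2 ^ 2 = -(q.1 + (-p.1 + (p.2 - q.2) ^ 2)) := by
          simp only [Prod.fst_sub, Prod.snd_sub]
          ring
        rw [e1, e2, japPow_neg, sub_eq_add_neg q.1]
    _ ≤ _ := by
        rw [lintegral_const_mul' _ _ (by norm_num), lintegral_add_left hm,
          lintegral_sheared hg _ (c := fun x => -x ^ 2) (by fun_prop),
          lintegral_sheared hg _ (c := fun x => -p.1 + (p.2 - x) ^ 2) (by fun_prop)]
        gcongr <;> exact hle _ _


/-- The three regimes for the kernel `⟨σ(q + r)⟩^{-7/16} ⟨σ(r)⟩^{-7/16}`: one of the two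
modulations is the largest and exceeds `⟨ξ⟩²`, or `⟨ξ⟩²` exceeds both. -/
theorem rpow_mul_rpow_le_three {x y : ℝ} (ξ : ℝ) (hx : 1 ≤ x) (hy : 1 ≤ y) :
    x ^ (-(7 / 16) : ℝ) * y ^ (-(7 / 16) : ℝ) ≤
      2 * (jap ξ ^ (-(5 / 8) : ℝ) * y ^ (-(9 / 16) : ℝ) +
        jap ξ ^ (-(5 / 8) : ℝ) * x ^ (-(9 / 16) : ℝ) +
        |ξ| ^ (1 / 2 : ℝ) * (x ^ (-(9 / 16) : ℝ) * y ^ (-(9 / 16) : ℝ))) := by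
  have hz := jap_pos ξ
  have hx0 : 0 < x := by linarith
  have hy0 : 0 < y := by linarith
  have hA : 0 ≤ jap ξ ^ (-(5 / 8) : ℝ) * y ^ (-(9 / 16) : ℝ) := by positivity
  have hB : 0 ≤ jap ξ ^ (-(5 / 8) : ℝ) * x ^ (-(9 / 16) : ℝ) := by positivity
  have hC : 0 ≤ |ξ| ^ (1 / 2 : ℝ) * (x ^ (-(9 / 16) : ℝ) * y ^ (-(9 / 16) : ℝ)) := by positivity
  have aux : ∀ a b : ℝ, 0 < b → b ≤ a → jap ξ ^ 2 ≤ a →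
      a ^ (-(7 / 16) : ℝ) * b ^ (-(7 / 16) : ℝ) ≤
        jap ξ ^ (-(5 / 8) : ℝ) * b ^ (-(9 / 16) : ℝ) := by
    intro a b hb hba hza
    have ha : 0 < a := hb.trans_le hba
    have e1 : a ^ (-(7 / 16) : ℝ) = a ^ (-(5 / 16) : ℝ) * a ^ (-(1 / 8) : ℝ) := by
      rw [← Real.rpow_add ha]; norm_num
    have e2 : b ^ (-(9 / 16) : ℝ) = b ^ (-(1 / 8) : ℝ) * b ^ (-(7 / 16) : ℝ) := by
      rw [← Real.rpow_add hb]; norm_num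
    have e3 : a ^ (-(5 / 16) : ℝ) ≤ jap ξ ^ (-(5 / 8) : ℝ) := by
      calc a ^ (-(5 / 16) : ℝ) ≤ (jap ξ ^ 2) ^ (-(5 / 16) : ℝ) :=
            Real.rpow_le_rpow_of_nonpos (by positivity) hza (by norm_num)
        _ = jap ξ ^ (-(5 / 8) : ℝ) := by
            rw [← Real.rpow_natCast, ← Real.rpow_mul hz.le]; norm_num
    have e4 : a ^ (-(1 / 8) : ℝ) ≤ b ^ (-(1 / 8) : ℝ) :=
      Real.rpow_le_rpow_of_nonpos hb hba (by norm_num)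
    rw [e1, e2, ← mul_assoc]
    gcongr
  rcases le_total (jap ξ ^ 2) (max x y) with h | h
  · rcases le_total y x with hyx | hxy
    · rw [max_eq_left hyx] at h
      linarith [aux x y hy0 hyx h]
    · rw [max_eq_right hxy] at h
      linarith [aux y x hx0 hxy h, mul_comm (x ^ (-(7 / 16) : ℝ)) (y ^ (-(7 / 16) : ℝ))]
  · have hxz : x ≤ jap ξ ^ 2 := (le_max_left _ _).trans h
    have hyz : y ≤ jap ξ ^ 2 := (le_max_right _ _).trans h
    have e : ∀ a : ℝ, 0 < a → a ^ (-(7 / 16) : ℝ) = a ^ (1 / 8 : ℝ) * a ^ (-(9 / 16) : ℝ) := by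
      intro a ha
      rw [← Real.rpow_add ha]; norm_num
    have hle : ∀ a : ℝ, 0 < a → a ≤ jap ξ ^ 2 → a ^ (1 / 8 : ℝ) ≤ jap ξ ^ (1 / 4 : ℝ) := by
      intro a ha haz
      calc a ^ (1 / 8 : ℝ) ≤ (jap ξ ^ 2) ^ (1 / 8 : ℝ) :=
            Real.rpow_le_rpow ha.le haz (by norm_num)
        _ = jap ξ ^ (1 / 4 : ℝ) := by
            rw [← Real.rpow_natCast, ← Real.rpow_mul hz.le]; norm_num
    have hsplit : x ^ (-(7 / 16) : ℝ) * y ^ (-(7 / 16) : ℝ) ≤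
        jap ξ ^ (1 / 2 : ℝ) * (x ^ (-(9 / 16) : ℝ) * y ^ (-(9 / 16) : ℝ)) := by
      have e5 : jap ξ ^ (1 / 2 : ℝ) = jap ξ ^ (1 / 4 : ℝ) * jap ξ ^ (1 / 4 : ℝ) := by
        rw [← Real.rpow_add hz]; norm_num
      rw [e x hx0, e y hy0, e5]
      calc x ^ (1 / 8 : ℝ) * x ^ (-(9 / 16) : ℝ) * (y ^ (1 / 8 : ℝ) * y ^ (-(9 / 16) : ℝ))
          = x ^ (1 / 8 : ℝ) * y ^ (1 / 8 : ℝ) * (x ^ (-(9 / 16) : ℝ) * y ^ (-(9 / 16) : ℝ)) := by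
            ring
        _ ≤ _ := by
            gcongr
            · exact hle x hx0 hxz
            · exact hle y hy0 hyz
    rcases le_total 1 |ξ| with hξ | hξ
    · have h2 : jap ξ ^ (1 / 2 : ℝ) ≤ 2 * |ξ| ^ (1 / 2 : ℝ) := by
        have h3 : jap ξ ≤ 4 * |ξ| := by
          refine abs_le_of_sq_le_sq' ?_ (by positivity) |>.2
          rw [jap_sq, mul_pow, sq_abs]
          nlinarith [sq_abs ξ]
        have h4 : (4 : ℝ) ^ (1 / 2 : ℝ) = 2 := by
          rw [show (4 : ℝ) = 2 ^ (2 : ℝ) by norm_num, ← Real.rpow_mul two_pos.le]; norm_num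
        calc jap ξ ^ (1 / 2 : ℝ) ≤ (4 * |ξ|) ^ (1 / 2 : ℝ) :=
              Real.rpow_le_rpow hz.le h3 (by norm_num)
          _ = 2 * |ξ| ^ (1 / 2 : ℝ) := by rw [Real.mul_rpow (by norm_num) (abs_nonneg _), h4]
      have h5 : jap ξ ^ (1 / 2 : ℝ) * (x ^ (-(9 / 16) : ℝ) * y ^ (-(9 / 16) : ℝ)) ≤
          2 * |ξ| ^ (1 / 2 : ℝ) * (x ^ (-(9 / 16) : ℝ) * y ^ (-(9 / 16) : ℝ)) := by gcongr
      linarith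
    · -- For `|ξ| ≤ 1` all quantities are comparable to `1`.
      have hz2 : jap ξ ^ 2 ≤ 2 := by
        rw [jap_sq, ← sq_abs]
        nlinarith [abs_nonneg ξ]
      have h1 : x ^ (-(7 / 16) : ℝ) * y ^ (-(7 / 16) : ℝ) ≤ 1 :=
        mul_le_one₀ (Real.rpow_le_one_of_one_le_of_nonpos hx (by norm_num)) (by positivity)
          (Real.rpow_le_one_of_one_le_of_nonpos hy (by norm_num))
      have h2 : (2 : ℝ) ^ (-(5 / 16) : ℝ) ≤ jap ξ ^ (-(5 / 8) : ℝ) := by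
        calc (2 : ℝ) ^ (-(5 / 16) : ℝ) ≤ (jap ξ ^ 2) ^ (-(5 / 16) : ℝ) :=
              Real.rpow_le_rpow_of_nonpos (by positivity) hz2 (by norm_num)
          _ = jap ξ ^ (-(5 / 8) : ℝ) := by
              rw [← Real.rpow_natCast, ← Real.rpow_mul hz.le]; norm_num
      have h3 : (2 : ℝ) ^ (-(9 / 16) : ℝ) ≤ y ^ (-(9 / 16) : ℝ) :=
        Real.rpow_le_rpow_of_nonpos hy0 (hyz.trans hz2) (by norm_num)
      have h4 : (2 : ℝ)⁻¹ ≤ jap ξ ^ (-(5 / 8) : ℝ) * y ^ (-(9 / 16) : ℝ) := by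
        calc (2 : ℝ)⁻¹ = 2 ^ (-1 : ℝ) := by rw [Real.rpow_neg_one]
          _ ≤ 2 ^ (-(5 / 16) + -(9 / 16) : ℝ) :=
              Real.rpow_le_rpow_of_exponent_le one_le_two (by norm_num)
          _ = 2 ^ (-(5 / 16) : ℝ) * 2 ^ (-(9 / 16) : ℝ) := Real.rpow_add two_pos _ _
          _ ≤ _ := by gcongr
      linarith

/-- The bilinear estimate for an `L²` function and a function in `X̂^{-1,1/2}`, with output in
`X̂^{-1,1/2}`; a power of the modulations is to spare. -/
theorem l2Bounded_modPow_sum_mul_modPow :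
    L2Bounded fun q r => modPow (-(7 / 16)) (q + r) * modPow (-(7 / 16)) r := by
  have hI54 := lintegral_japPow_ne_top (a := 2 * -(5 / 8)) (by norm_num)
  have hI98 := lintegral_japPow_ne_top (a := 2 * -(9 / 16)) (by norm_num)
  have mA : Measurable (Function.uncurry fun q r =>
      xiPow (-(5 / 8)) q * modPow (-(9 / 16)) r) :=
    ((measurable_xiPow _).comp measurable_fst).mul ((measurable_modPow _).comp measurable_snd)
  have mB : Measurable (Function.uncurry fun q r =>
      xiPow (-(5 / 8)) q * modPow (-(9 / 16)) (q + r)) :=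
    ((measurable_xiPow _).comp measurable_fst).mul ((measurable_modPow _).comp measurable_add_freq)
  have mC : Measurable (Function.uncurry fun q r : Freq =>
      ENNReal.ofReal (|q.2| ^ (1 / 2 : ℝ)) *
        (modPow (-(9 / 16)) (q + r) * modPow (-(9 / 16)) r)) :=
    (((measurable_snd.abs.pow_const _).ennreal_ofReal).comp measurable_fst).mul
      (((measurable_modPow _).comp measurable_add_freq).mul
        ((measurable_modPow _).comp measurable_snd))
  have hA : L2Bounded fun q r => xiPow (-(5 / 8)) q * modPow (-(9 / 16)) r := by
    refine L2Bounded.of_sum mA (ENNReal.mul_ne_top hI54 hI98) fun p => le_of_eq ?_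
    rw [← lintegral_sheared (measurable_japPow _) _ (c := fun x => -p.1 + (p.2 - x) ^ 2)
      (by fun_prop)]
    refine lintegral_congr fun q => ?_
    rw [mul_pow, xiPow, modPow, japPow_sq, japPow_sq]
    congr 1
    rw [← japPow_neg]
    congr 1
    simp only [Prod.fst_sub, Prod.snd_sub]
    ring
  have hB : L2Bounded fun q r => xiPow (-(5 / 8)) q * modPow (-(9 / 16)) (q + r) := by
    refine L2Bounded.of_right mB (ENNReal.mul_ne_top hI54 hI98) fun r => le_of_eq ?_
    rw [← lintegral_sheared (measurable_japPow _) _ (c := fun x => r.1 - (x + r.2) ^ 2)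
      (by fun_prop)]
    refine lintegral_congr fun q => ?_
    rw [mul_pow, xiPow, modPow, japPow_sq, japPow_sq]
    congr 2
    simp only [Prod.fst_add, Prod.snd_add]
    ring
  have hC : L2Bounded fun q r : Freq => ENNReal.ofReal (|q.2| ^ (1 / 2 : ℝ)) *
      (modPow (-(9 / 16)) (q + r) * modPow (-(9 / 16)) r) := by
    refine L2Bounded.of_left mC (ENNReal.mul_ne_top hI98 hI98) fun q => ?_
    set a : ℝ := 2 * -(9 / 16)
    have hsq : ∀ r : Freq, (ENNReal.ofReal (|q.2| ^ (1 / 2 : ℝ)) *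
        (modPow (-(9 / 16)) (q + r) * modPow (-(9 / 16)) r)) ^ 2 =
        ENNReal.ofReal |q.2| * japPow a (q.1 + r.1 - (q.2 + r.2) ^ 2) *
          japPow a (r.1 - r.2 ^ 2) := by
      intro r
      rw [mul_pow, mul_pow, modPow, modPow, japPow_sq, japPow_sq, ← mul_assoc,
        ← ENNReal.ofReal_pow (by positivity), ← Real.rpow_natCast, ← Real.rpow_mul (abs_nonneg _)]
      norm_num [a]
    simp_rw [hsq]
    have m1 : Measurable fun r : Freq => ENNReal.ofReal |q.2| *
        japPow a (q.1 + r.1 - (q.2 + r.2) ^ 2) * japPow a (r.1 - r.2 ^ 2) :=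
      (measurable_const.mul ((measurable_japPow _).comp (by fun_prop))).mul
        ((measurable_japPow _).comp (by fun_prop))
    have m2 : Measurable (Function.uncurry fun (ξ σ : ℝ) => ENNReal.ofReal |q.2| *
        japPow a (q.1 + σ - q.2 ^ 2 - 2 * q.2 * ξ) * japPow a σ) :=
      (measurable_const.mul ((measurable_japPow _).comp (by fun_prop))).mul
        ((measurable_japPow _).comp (by fun_prop))
    -- After the substitution `σ = τ - ξ²` the remaining phase is affine in `ξ` with slope `2 q.2`.
    calc ∫⁻ r : Freq, ENNReal.ofReal |q.2| * japPow a (q.1 + r.1 - (q.2 + r.2) ^ 2) *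
          japPow a (r.1 - r.2 ^ 2)
        = ∫⁻ ξ : ℝ, ∫⁻ σ : ℝ, ENNReal.ofReal |q.2| *
            japPow a (q.1 + σ - q.2 ^ 2 - 2 * q.2 * ξ) * japPow a σ := by
          rw [lintegral_freq m1.aemeasurable]
          refine lintegral_congr fun ξ => ?_
          rw [← lintegral_add_right_eq_self _ (ξ ^ 2)]
          refine lintegral_congr fun σ => ?_
          congr 2
          · congr 1
            ring
          · ring
      _ = ∫⁻ σ : ℝ, ∫⁻ ξ : ℝ, ENNReal.ofReal |q.2| *
            japPow a (q.1 + σ - q.2 ^ 2 - 2 * q.2 * ξ) * japPow a σ :=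
          lintegral_lintegral_swap m2.aemeasurable
      _ ≤ ∫⁻ σ : ℝ, (∫⁻ x, japPow a x) * japPow a σ := by
          refine lintegral_mono fun σ => ?_
          rw [lintegral_mul_const' _ _ (japPow_ne_top _ _)]
          exact mul_le_mul_left (lintegral_japPow_affine_le _ _ _) _
      _ = _ := lintegral_const_mul _ (measurable_japPow a)
  refine ((hA.add hB mA mB).add hC (mA.add mB) mC).mono (c := 2) (fun q r => ?_)
    ((mA.add mB).add mC)
  simp only [xiPow, modPow, japPow]
  have h1 := jap_pos ((q + r).1 - (q + r).2 ^ 2)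
  have h2 := jap_pos (r.1 - r.2 ^ 2)
  have h3 := jap_pos q.2
  rw [← ENNReal.ofReal_mul (by positivity), ← ENNReal.ofReal_mul (by positivity),
    ← ENNReal.ofReal_mul (by positivity), ← ENNReal.ofReal_mul (by positivity),
    ← ENNReal.ofReal_mul (by positivity), ← ENNReal.ofReal_add (by positivity) (by positivity),
    ← ENNReal.ofReal_add (by positivity) (by positivity), ENNReal.coe_ofNat,
    ← ENNReal.ofReal_ofNat 2, ← ENNReal.ofReal_mul (by norm_num)]
  exact ENNReal.ofReal_le_ofReal (rpow_mul_rpow_le_three q.2 (one_le_jap _) (one_le_jap _))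

/-! ### Hilbert's inequality -/

/-- The weight `⟨s⟩^{-1/2}` is suitable for Schur's test of the kernel `1 / max(⟨s⟩, ⟨t⟩)`. -/
theorem exists_lintegral_hilbert_le : ∃ C : ℝ≥0∞, C ≠ ∞ ∧ ∀ M : ℝ, 0 < M →
    ∫⁻ t, ENNReal.ofReal ((max M (jap t))⁻¹ * jap t ^ (-(1 / 2) : ℝ)) ≤
      ENNReal.ofReal (M ^ (-(1 / 2) : ℝ)) * C := by
  let g : ℝ → ℝ≥0∞ := fun x => ENNReal.ofReal ((max 1 |x|)⁻¹ * |x| ^ (-(1 / 2) : ℝ))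
  have hg : Measurable g := by
    refine Measurable.ennreal_ofReal ?_
    exact ((measurable_const.max measurable_id.abs).inv).mul (measurable_id.abs.pow_const _)
  let h : ℝ → ℝ≥0∞ := fun x => (Ioc (0 : ℝ) 1).indicator (fun x => ENNReal.ofReal
    (x ^ (-(1 / 2) : ℝ))) x + (Ioi (1 : ℝ)).indicator (fun x => ENNReal.ofReal
    (x ^ (-(3 / 2) : ℝ))) x
  have hh_meas : ∀ r : ℝ, Measurable fun x : ℝ => ENNReal.ofReal (x ^ r) := fun r =>
    (measurable_id.pow_const r).ennreal_ofReal
  have hh : ∫⁻ x, h x ≠ ∞ := by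
    rw [lintegral_add_left ((hh_meas _).indicator measurableSet_Ioc),
      lintegral_indicator measurableSet_Ioc, lintegral_indicator measurableSet_Ioi]
    refine ENNReal.add_ne_top.2 ⟨?_, ?_⟩
    · have hi := (intervalIntegral.intervalIntegrable_rpow' (a := 0) (b := 1) (r := -(1 / 2))
        (by norm_num)).1
      refine ne_top_of_le_ne_top hi.2.ne (lintegral_mono fun x => ?_)
      exact Real.ofReal_le_enorm _
    · have hi := integrableOn_Ioi_rpow_of_lt (a := -(3 / 2)) (by norm_num) one_pos
      refine ne_top_of_le_ne_top hi.2.ne (lintegral_mono fun x => ?_)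
      exact Real.ofReal_le_enorm _
  have hgh : ∀ x : ℝ, 0 < x → g x ≤ h x := by
    intro x hx
    rcases le_or_gt x 1 with h1 | h1
    · refine le_add_right ?_
      rw [Set.indicator_of_mem (show x ∈ Ioc (0 : ℝ) 1 from ⟨hx, h1⟩)]
      simp only [g]
      rw [abs_of_pos hx, max_eq_left h1, inv_one, one_mul]
    · refine le_add_left ?_
      rw [Set.indicator_of_mem (show x ∈ Ioi (1 : ℝ) from h1)]
      simp only [g]
      rw [abs_of_pos hx, max_eq_right h1.le, ← Real.rpow_neg_one, ← Real.rpow_add hx]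
      norm_num
  have hg_even : ∀ x, g (-x) = g x := fun x => by simp [g]
  have hne : ∀ᵐ x : ℝ, x ≠ 0 := by simp [ae_iff]
  have hG : ∫⁻ x, g x ≠ ∞ := by
    have hle : ∫⁻ x, g x ≤ ∫⁻ x, (h x + h (-x)) := by
      refine lintegral_mono_ae (hne.mono fun x hx => ?_)
      rcases lt_or_gt_of_ne hx with h1 | h1
      · rw [← hg_even]
        exact le_add_left (hgh _ (by linarith))
      · exact le_add_right (hgh _ h1)
    have hhm : Measurable h := ((hh_meas _).indicator measurableSet_Ioc).add
      ((hh_meas _).indicator measurableSet_Ioi)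
    have hneg : ∫⁻ x, h (-x) = ∫⁻ x, h x := by
      simpa using lintegral_sub_left_eq_self h 0
    rw [lintegral_add_left hhm, hneg] at hle
    exact ne_top_of_le_ne_top (ENNReal.add_ne_top.2 ⟨hh, hh⟩) hle
  refine ⟨∫⁻ x, g x, hG, fun M hM => ?_⟩
  have hMinv : M⁻¹ ≠ 0 := (inv_pos.2 hM).ne'
  calc ∫⁻ t, ENNReal.ofReal ((max M (jap t))⁻¹ * jap t ^ (-(1 / 2) : ℝ))
      ≤ ∫⁻ t, ENNReal.ofReal (M ^ (-(1 / 2) : ℝ)) * (ENNReal.ofReal |M⁻¹| * g (M⁻¹ * t)) := by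
        refine lintegral_mono_ae (hne.mono fun t ht => ?_)
        have ht0 : 0 < |t| := abs_pos.2 ht
        have hj := abs_le_jap t
        simp only [g]
        rw [← ENNReal.ofReal_mul (abs_nonneg _), ← ENNReal.ofReal_mul (by positivity)]
        refine ENNReal.ofReal_le_ofReal ?_
        have e1 : |M⁻¹ * t| = M⁻¹ * |t| := by rw [abs_mul, abs_of_pos (inv_pos.2 hM)]
        have e2 : max 1 (M⁻¹ * |t|) = M⁻¹ * max M |t| := by
          rw [mul_max_of_nonneg _ _ (inv_pos.2 hM).le, inv_mul_cancel₀ hM.ne']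
        have e3 : M ^ (-(1 / 2) : ℝ) * M⁻¹ ^ (-(1 / 2) : ℝ) = 1 := by
          rw [← Real.mul_rpow hM.le (inv_pos.2 hM).le, mul_inv_cancel₀ hM.ne', Real.one_rpow]
        rw [e1, e2, abs_of_pos (inv_pos.2 hM), Real.mul_rpow (inv_pos.2 hM).le ht0.le, mul_inv,
          inv_inv]
        have e4 : M ^ (-(1 / 2) : ℝ) * (M⁻¹ * (M * (max M |t|)⁻¹ *
            (M⁻¹ ^ (-(1 / 2) : ℝ) * |t| ^ (-(1 / 2) : ℝ)))) =
            (M ^ (-(1 / 2) : ℝ) * M⁻¹ ^ (-(1 / 2) : ℝ)) * (M⁻¹ * M) *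
              ((max M |t|)⁻¹ * |t| ^ (-(1 / 2) : ℝ)) := by ring
        rw [e4, e3, inv_mul_cancel₀ hM.ne', one_mul, one_mul]
        refine mul_le_mul ?_ ?_ (Real.rpow_nonneg (jap_pos t).le _) (by positivity)
        · exact inv_anti₀ (by positivity) (max_le_max_left _ hj)
        · exact Real.rpow_le_rpow_of_nonpos ht0 hj (by norm_num)
    _ = ENNReal.ofReal (M ^ (-(1 / 2) : ℝ)) * ∫⁻ x, g x := by
        rw [lintegral_const_mul' _ _ ENNReal.ofReal_ne_top,
          lintegral_const_mul' _ _ ENNReal.ofReal_ne_top, lintegral_comp_mul_left hg hMinv]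

/-- The kernel of Hilbert's inequality. -/
noncomputable def hilbertKernel (s t : ℝ) : ℝ≥0∞ := ENNReal.ofReal (max (jap s) (jap t))⁻¹

theorem measurable_hilbertKernel : Measurable (Function.uncurry hilbertKernel) :=
  ((measurable_jap.comp measurable_fst).max
    (measurable_jap.comp measurable_snd)).inv.ennreal_ofReal

theorem hilbertKernel_comm (s t : ℝ) : hilbertKernel s t = hilbertKernel t s := by
  rw [hilbertKernel, max_comm, hilbertKernel]

/-- Hilbert's inequality, by Schur's test. -/
theorem exists_hilbert_inequality : ∃ C : ℝ≥0, ∀ a b : ℝ → ℝ≥0∞, Measurable a → Measurable b →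
    ∫⁻ s, ∫⁻ t, hilbertKernel s t * (a s * b t) ≤ C * (l2norm volume a * l2norm volume b) := by
  obtain ⟨C, hC, hle⟩ := exists_lintegral_hilbert_le
  lift C to ℝ≥0 using hC
  refine ⟨C, fun a b ha hb => ?_⟩
  -- The two factors to which the Cauchy–Schwarz inequality is applied.
  let φ : ℝ → ℝ → ℝ≥0∞ := fun s t =>
    hilbertKernel s t ^ (1 / 2 : ℝ) * (japPow (1 / 4) s * japPow (-(1 / 4)) t)
  have hφ : Measurable (Function.uncurry φ) :=
    (measurable_hilbertKernel.pow_const _).mul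
      (((measurable_japPow _).comp measurable_fst).mul ((measurable_japPow _).comp measurable_snd))
  have hφφ : ∀ s t, φ s t * φ t s = hilbertKernel s t := by
    intro s t
    have h1 : ∀ x, japPow (1 / 4) x * japPow (-(1 / 4)) x = 1 := fun x => by
      rw [japPow_mul_japPow]
      simp [japPow]
    calc φ s t * φ t s = (hilbertKernel s t ^ (1 / 2 : ℝ)) ^ 2 *
          ((japPow (1 / 4) s * japPow (-(1 / 4)) s) *
            (japPow (1 / 4) t * japPow (-(1 / 4)) t)) := by
          simp only [φ]
          rw [hilbertKernel_comm t s]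
          ring
      _ = hilbertKernel s t := by rw [h1, h1, rpow_half_sq, mul_one, mul_one]
  have hφ_int : ∀ s, ∫⁻ t, φ s t ^ 2 ≤ C := by
    intro s
    have e : ∀ t, φ s t ^ 2 = japPow (1 / 2) s * ENNReal.ofReal
        ((max (jap s) (jap t))⁻¹ * jap t ^ (-(1 / 2) : ℝ)) := by
      intro t
      simp only [φ]
      rw [mul_pow, mul_pow, rpow_half_sq, japPow_sq, japPow_sq, hilbertKernel,
        ENNReal.ofReal_mul (inv_nonneg.2 ((jap_pos s).le.trans (le_max_left _ _)))]
      norm_num only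
      rw [show ENNReal.ofReal (jap t ^ (-(1 / 2) : ℝ)) = japPow (-(1 / 2)) t from rfl]
      norm_num only
      ring
    simp_rw [e]
    rw [lintegral_const_mul' _ _ (japPow_ne_top _ _)]
    calc japPow (1 / 2) s * ∫⁻ t, ENNReal.ofReal
          ((max (jap s) (jap t))⁻¹ * jap t ^ (-(1 / 2) : ℝ))
        ≤ japPow (1 / 2) s * (japPow (-(1 / 2)) s * C) := mul_le_mul_right (hle _ (jap_pos s)) _
      _ = C := by
          rw [← mul_assoc, japPow_mul_japPow]
          simp [japPow]
  have hnorm : ∀ c : ℝ → ℝ≥0∞, Measurable c →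
      ∫⁻ s, ∫⁻ t, (φ s t * c s) ^ 2 ≤ C * l2norm volume c ^ 2 := by
    intro c hc
    rw [l2norm_sq, ← lintegral_const_mul _ (hc.pow_const 2)]
    refine lintegral_mono fun s => ?_
    have hm : Measurable fun t => φ s t ^ 2 := (hφ.comp measurable_prodMk_left).pow_const 2
    simp_rw [mul_pow]
    rw [lintegral_mul_const _ hm]
    exact mul_le_mul_left (hφ_int s) _
  have m1 : Measurable fun z : ℝ × ℝ => φ z.1 z.2 * a z.1 := hφ.mul (ha.comp measurable_fst)
  have m2 : Measurable fun z : ℝ × ℝ => φ z.2 z.1 * b z.2 :=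
    (hφ.comp measurable_swap).mul (hb.comp measurable_snd)
  have n1 : l2norm volume (fun z : ℝ × ℝ => φ z.1 z.2 * a z.1) ^ 2 ≤ C * l2norm volume a ^ 2 := by
    rw [l2norm_sq, Measure.volume_eq_prod, lintegral_prod _ (m1.pow_const 2).aemeasurable]
    exact hnorm a ha
  have n2 : l2norm volume (fun z : ℝ × ℝ => φ z.2 z.1 * b z.2) ^ 2 ≤ C * l2norm volume b ^ 2 := by
    rw [l2norm_sq, Measure.volume_eq_prod, lintegral_prod_symm _ (m2.pow_const 2).aemeasurable]
    exact hnorm b hb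
  have hcs := lintegral_mul_le_l2norm (μ := (volume : Measure (ℝ × ℝ))) m1.aemeasurable
    m2.aemeasurable
  have hm12 : Measurable fun z : ℝ × ℝ => φ z.1 z.2 * a z.1 * (φ z.2 z.1 * b z.2) := m1.mul m2
  calc ∫⁻ s, ∫⁻ t, hilbertKernel s t * (a s * b t)
      = ∫⁻ z : ℝ × ℝ, φ z.1 z.2 * a z.1 * (φ z.2 z.1 * b z.2) := by
        rw [Measure.volume_eq_prod, lintegral_prod _ hm12.aemeasurable]
        refine lintegral_congr fun s => lintegral_congr fun t => ?_
        rw [← hφφ]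
        ring
    _ ≤ _ := hcs
    _ ≤ C * (l2norm volume a * l2norm volume b) := by
        rw [← ENNReal.pow_le_pow_left_iff (n := 2) (by norm_num), mul_pow, mul_pow, mul_pow]
        calc _ ≤ C * l2norm volume a ^ 2 * (C * l2norm volume b ^ 2) := mul_le_mul' n1 n2
          _ = _ := by ring


/-! ### Energy bounds for weighted convolutions -/

/-- The integral over `τ` of a convolution with a kernel depending on the time frequencies: for
fixed spatial frequencies the time frequencies of the two inputs are independent. -/
theorem lintegral_slice_bil {k : ℝ → ℝ → ℝ≥0∞} {u v : Freq → ℝ≥0∞}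
    (hk : Measurable (Function.uncurry k)) (hu : Measurable u) (hv : Measurable v) (ξ : ℝ) :
    ∫⁻ τ : ℝ, bil (fun q r => k q.1 r.1) u v (τ, ξ) =
      ∫⁻ η : ℝ, ∫⁻ s : ℝ, ∫⁻ t : ℝ, k s t * (u (s, η) * v (t, ξ - η)) := by
  have hκ : Measurable (Function.uncurry fun q r : Freq => k q.1 r.1) :=
    hk.comp ((measurable_fst.comp measurable_fst).prodMk (measurable_fst.comp measurable_snd))
  have hτ : Measurable fun z : ℝ × Freq => (((z.1, ξ), z.2) : Freq × Freq) := by fun_prop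
  have hm : Measurable (Function.uncurry fun (τ : ℝ) (q : Freq) =>
      k q.1 ((τ, ξ) - q).1 * (u q * v ((τ, ξ) - q))) :=
    (measurable_bil_integrand hκ hu hv).comp hτ
  have hm2 : Measurable fun z : Freq × ℝ => k z.1.1 z.2 * (u z.1 * v (z.2, ξ - z.1.2)) := by
    have h1 : Measurable fun z : Freq × ℝ => (z.1.1, z.2) := by fun_prop
    have h2 : Measurable fun z : Freq × ℝ => (z.2, ξ - z.1.2) := by fun_prop
    exact (hk.comp h1).mul ((hu.comp measurable_fst).mul (hv.comp h2))
  calc ∫⁻ τ : ℝ, bil (fun q r => k q.1 r.1) u v (τ, ξ)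
      = ∫⁻ q : Freq, ∫⁻ τ : ℝ, k q.1 ((τ, ξ) - q).1 * (u q * v ((τ, ξ) - q)) :=
        lintegral_lintegral_swap hm.aemeasurable
    _ = ∫⁻ q : Freq, ∫⁻ t : ℝ, k q.1 t * (u q * v (t, ξ - q.2)) := by
        refine lintegral_congr fun q => ?_
        exact lintegral_sub_right_eq_self (fun t => k q.1 t * (u q * v (t, ξ - q.2))) q.1
    _ = _ := lintegral_freq (hm2.lintegral_prod_right').aemeasurable

/-- Since `⟨ξ⟩⁻¹` is square integrable, the energy norm is controlled by the norm of
`L^∞_ξ L¹_τ`. -/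
theorem exists_energyNorm_le_of_slice : ∃ C : ℝ≥0, ∀ (u : Freq → ℝ≥0∞) (M : ℝ≥0∞),
    (∀ ξ : ℝ, ∫⁻ τ : ℝ, u (τ, ξ) ≤ M) → energyNorm u ≤ C * M := by
  have hI : (∫⁻ x, japPow (-2) x) ^ (1 / 2 : ℝ) ≠ ∞ :=
    ENNReal.rpow_ne_top_of_nonneg (by norm_num) (lintegral_japPow_ne_top (by norm_num))
  refine ⟨((∫⁻ x, japPow (-2) x) ^ (1 / 2 : ℝ)).toNNReal, fun u M h => ?_⟩
  rw [ENNReal.coe_toNNReal hI]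
  have hm : Measurable fun ξ : ℝ => ENNReal.ofReal (jap ξ)⁻¹ := measurable_jap.inv.ennreal_ofReal
  calc energyNorm u ≤ l2norm volume fun ξ : ℝ => M * ENNReal.ofReal (jap ξ)⁻¹ := by
        refine l2norm_mono fun ξ => ?_
        dsimp only
        rw [lintegral_const_mul' _ _ ENNReal.ofReal_ne_top, mul_comm]
        exact mul_le_mul_left (h ξ) _
    _ = M * (∫⁻ x, japPow (-2) x) ^ (1 / 2 : ℝ) := by
        rw [l2norm_const_mul _ hm.aemeasurable, l2norm]
        congr 2
        refine lintegral_congr fun ξ => ?_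
        rw [← Real.rpow_neg_one, show ENNReal.ofReal (jap ξ ^ (-1 : ℝ)) = japPow (-1) ξ from rfl,
          japPow_sq]
        norm_num
    _ = _ := mul_comm _ _

/-- The energy norm controls the `L¹` norm with the weight `⟨ξ⟩⁻²`. -/
theorem exists_lintegral_le_energyNorm : ∃ C : ℝ≥0, ∀ u : Freq → ℝ≥0∞, Measurable u →
    ∫⁻ p : Freq, ENNReal.ofReal (jap p.2)⁻¹ * (ENNReal.ofReal (jap p.2)⁻¹ * u p) ≤
      C * energyNorm u := by
  have hI : (∫⁻ x, japPow (-2) x) ^ (1 / 2 : ℝ) ≠ ∞ :=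
    ENNReal.rpow_ne_top_of_nonneg (by norm_num) (lintegral_japPow_ne_top (by norm_num))
  refine ⟨((∫⁻ x, japPow (-2) x) ^ (1 / 2 : ℝ)).toNNReal, fun u hu => ?_⟩
  rw [ENNReal.coe_toNNReal hI]
  have hm : Measurable fun ξ : ℝ => ENNReal.ofReal (jap ξ)⁻¹ := measurable_jap.inv.ennreal_ofReal
  have hu' : Measurable fun p : Freq => ENNReal.ofReal (jap p.2)⁻¹ * u p :=
    measurable_ofReal_jap_inv.mul hu
  have hu'' : Measurable fun p : Freq =>
      ENNReal.ofReal (jap p.2)⁻¹ * (ENNReal.ofReal (jap p.2)⁻¹ * u p) :=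
    measurable_ofReal_jap_inv.mul hu'
  calc ∫⁻ p : Freq, ENNReal.ofReal (jap p.2)⁻¹ * (ENNReal.ofReal (jap p.2)⁻¹ * u p)
      = ∫⁻ ξ : ℝ, ENNReal.ofReal (jap ξ)⁻¹ * ∫⁻ τ : ℝ, ENNReal.ofReal (jap ξ)⁻¹ * u (τ, ξ) := by
        rw [lintegral_freq hu''.aemeasurable]
        exact lintegral_congr fun ξ =>
          lintegral_const_mul' _ _ (ENNReal.ofReal_ne_top (r := (jap ξ)⁻¹))
    _ ≤ l2norm volume (fun ξ : ℝ => ENNReal.ofReal (jap ξ)⁻¹) * energyNorm u :=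
        lintegral_mul_le_l2norm hm.aemeasurable (aemeasurable_lintegral_slice hu'.aemeasurable)
    _ = _ := by
        congr 1
        rw [l2norm]
        congr 1
        refine lintegral_congr fun ξ => ?_
        rw [← Real.rpow_neg_one, show ENNReal.ofReal (jap ξ ^ (-1 : ℝ)) = japPow (-1) ξ from rfl,
          japPow_sq]
        norm_num

theorem lintegral_mul_sub_le_l2norm {a b : ℝ → ℝ≥0∞} (ha : Measurable a) (hb : Measurable b)
    (ξ : ℝ) : ∫⁻ η, a η * b (ξ - η) ≤ l2norm volume a * l2norm volume b := by
  have hm : Measurable fun η => b (ξ - η) := hb.comp (measurable_const.sub measurable_id)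
  refine (lintegral_mul_le_l2norm ha.aemeasurable hm.aemeasurable).trans (le_of_eq ?_)
  congr 1
  rw [l2norm, l2norm, lintegral_sub_left_eq_self (fun η => b η ^ 2)]

/-- The energy of a convolution is controlled by the norms of the factors in `L²_ξ L¹_τ`, by Young's
inequality in `τ` and the Cauchy–Schwarz inequality in `ξ`. -/
theorem exists_energyNorm_bil_one_le : ∃ C : ℝ≥0, ∀ u v : Freq → ℝ≥0∞, Measurable u →
    Measurable v → energyNorm (bil (fun _ _ => 1) u v) ≤ C * (mixedNorm u * mixedNorm v) := by
  obtain ⟨C, hC⟩ := exists_energyNorm_le_of_slice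
  refine ⟨C, fun u v hu hv => hC _ _ fun ξ => ?_⟩
  rw [lintegral_slice_bil (k := fun _ _ => 1) measurable_const hu hv]
  have hslice : ∀ w : Freq → ℝ≥0∞, Measurable w → Measurable fun η : ℝ => ∫⁻ s : ℝ, w (s, η) :=
    fun w hw => hw.lintegral_prod_left'
  refine le_trans (le_of_eq ?_) (lintegral_mul_sub_le_l2norm (hslice u hu) (hslice v hv) ξ)
  refine lintegral_congr fun η => ?_
  have m1 : Measurable fun s => u (s, η) := hu.comp (by fun_prop)
  have m2 : Measurable fun t => v (t, ξ - η) := hv.comp (by fun_prop)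
  simp_rw [one_mul]
  rw [← lintegral_mul_const _ m1]
  exact lintegral_congr fun s => lintegral_const_mul _ m2

/-- The energy estimate for the convolution of two functions in `L²`, by Hilbert's inequality in
the time frequency. -/
theorem exists_energyNorm_bil_hilbert_le : ∃ C : ℝ≥0, ∀ u v : Freq → ℝ≥0∞, Measurable u →
    Measurable v → energyNorm (bil (fun q r => hilbertKernel q.1 r.1) u v) ≤
      C * (l2norm volume u * l2norm volume v) := by
  obtain ⟨C, hC⟩ := exists_energyNorm_le_of_slice
  obtain ⟨C', hC'⟩ := exists_hilbert_inequality
  refine ⟨C * C', fun u v hu hv => ?_⟩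
  rw [ENNReal.coe_mul, mul_assoc]
  refine hC _ _ fun ξ => ?_
  rw [lintegral_slice_bil measurable_hilbertKernel hu hv]
  let n : (Freq → ℝ≥0∞) → ℝ → ℝ≥0∞ := fun w η => l2norm volume fun s : ℝ => w (s, η)
  have hn : ∀ w : Freq → ℝ≥0∞, Measurable w → Measurable (n w) := fun w hw =>
    Measurable.pow_const ((hw.pow_const 2).lintegral_prod_left') _
  have hn_norm : ∀ w : Freq → ℝ≥0∞, Measurable w → l2norm volume (n w) = l2norm volume w := by
    intro w hw
    rw [l2norm, l2norm, lintegral_freq (hw.pow_const 2).aemeasurable]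
    simp_rw [n, l2norm_sq]
  calc ∫⁻ η : ℝ, ∫⁻ s : ℝ, ∫⁻ t : ℝ, hilbertKernel s t * (u (s, η) * v (t, ξ - η))
      ≤ ∫⁻ η : ℝ, C' * (n u η * n v (ξ - η)) :=
        lintegral_mono fun η => hC' (fun s => u (s, η)) (fun t => v (t, ξ - η))
          (hu.comp (by fun_prop)) (hv.comp (by fun_prop))
    _ = C' * ∫⁻ η : ℝ, n u η * n v (ξ - η) := lintegral_const_mul' _ _ ENNReal.coe_ne_top
    _ ≤ C' * (l2norm volume u * l2norm volume v) := by
        rw [← hn_norm u hu, ← hn_norm v hv]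
        exact mul_le_mul_right (lintegral_mul_sub_le_l2norm (hn u hu) (hn v hv) ξ) _


/-! ### The pointwise kernel inequality -/

theorem jap_le_one_add_abs (x : ℝ) : jap x ≤ 1 + |x| := by
  refine abs_le_of_sq_le_sq' ?_ (by positivity) |>.2
  rw [jap_sq]
  nlinarith [sq_abs x, abs_nonneg x]

theorem jap_le_jap {x y : ℝ} (h : |x| ≤ |y|) : jap x ≤ jap y :=
  Real.sqrt_le_sqrt (by linarith [sq_le_sq.2 h])

theorem jap_le_add (x y : ℝ) : jap x ≤ jap (x + y) + jap y := by
  refine abs_le_of_sq_le_sq' ?_ (add_nonneg (jap_pos _).le (jap_pos _).le) |>.2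
  have h1 := jap_sq x
  have h2 := jap_sq y
  have h3 := jap_sq (x + y)
  have h4 : |(x + y) * y| ≤ jap (x + y) * jap y := by
    rw [abs_mul]
    exact mul_le_mul (abs_le_jap _) (abs_le_jap _) (abs_nonneg _) (jap_pos _).le
  nlinarith [neg_abs_le ((x + y) * y)]

theorem weight_pos (p : Freq) : 0 < weight p :=
  pow_pos (one_pos.trans_le (le_max_left _ _)) _

theorem one_le_weight (p : Freq) : 1 ≤ weight p := one_le_pow₀ (le_max_left _ _)

theorem max_one_neg_le_modulation (p : Freq) : max 1 (-p.1) ≤ modulation p := by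
  refine max_le (one_le_modulation p) ?_
  have h := abs_le_jap (p.1 - p.2 ^ 2)
  have h2 := neg_abs_le (p.1 - p.2 ^ 2)
  have : modulation p = jap (p.1 - p.2 ^ 2) := rfl
  nlinarith [sq_nonneg p.2]

theorem max_one_neg_add_le (s t : ℝ) : max 1 (-(s + t)) ≤ 2 * (max 1 (-s) * max 1 (-t)) := by
  have h1 := le_max_left 1 (-s)
  have h2 := le_max_right 1 (-s)
  have h3 := le_max_left 1 (-t)
  have h4 := le_max_right 1 (-t)
  refine max_le ?_ ?_ <;> nlinarith [mul_nonneg (sub_nonneg.2 h1) (sub_nonneg.2 h3)]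

theorem weight_add_le (q r : Freq) : weight (q + r) ≤ 2 ^ 10 * (weight q * weight r) := by
  unfold weight
  rw [← mul_pow, ← mul_pow]
  exact pow_le_pow_left₀ (zero_le_one.trans (le_max_left _ _)) (max_one_neg_add_le q.1 r.1) 10

/-- Cancellation between a large positive and a large negative time frequency is paid for by the
weight of the negative one. -/
theorem weight_add_mul_jap_le {q r : Freq} (h : |r.1| ≤ |q.1|) :
    weight (q + r) * jap q.1 ≤ 2 ^ 10 * (jap (q + r).1 * (weight q * weight r)) := by
  obtain ⟨s, ξ⟩ := q
  obtain ⟨t, η⟩ := r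
  simp only [weight, Prod.mk_add_mk] at h ⊢
  have hJ := one_le_jap (s + t)
  have hJ' := (le_abs_self _).trans (abs_le_jap (s + t))
  rcases le_or_gt 0 s with hs | hs
  · rw [abs_of_nonneg hs] at h
    have hst : 0 ≤ s + t := by linarith [neg_abs_le t]
    rw [max_eq_left (by linarith : -(s + t) ≤ 1), max_eq_left (by linarith : -s ≤ 1)]
    have hb1 := le_max_left 1 (-t)
    have hb2 := le_max_right 1 (-t)
    have hb : max 1 (-t) ≤ max 1 (-t) ^ 10 := le_self_pow₀ hb1 (by norm_num)
    have hjs := jap_le_one_add_abs s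
    rw [abs_of_nonneg hs] at hjs
    have h3 : jap s ≤ 3 * (jap (s + t) * max 1 (-t)) := by
      nlinarith [mul_nonneg (sub_nonneg.2 hJ) (sub_nonneg.2 hb1)]
    have h4 : jap (s + t) * max 1 (-t) ≤ jap (s + t) * max 1 (-t) ^ 10 := by gcongr
    have h5 : 0 ≤ jap (s + t) * max 1 (-t) ^ 10 := by positivity
    linarith
  · rcases le_or_gt t 0 with ht | ht
    · have h1 : jap s ≤ jap (s + t) := jap_le_jap (by
        rw [abs_of_neg hs, abs_of_nonpos (by linarith)]; linarith)
      have h2 := pow_le_pow_left₀ (zero_le_one.trans (le_max_left _ _))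
        (max_one_neg_add_le s t) 10
      rw [mul_pow, mul_pow] at h2
      calc max 1 (-(s + t)) ^ 10 * jap s
          ≤ (2 ^ 10 * (max 1 (-s) ^ 10 * max 1 (-t) ^ 10)) * jap (s + t) :=
            mul_le_mul h2 h1 (jap_pos s).le (by positivity)
        _ = _ := by ring
    · rw [abs_of_pos ht, abs_of_neg hs] at h
      rw [max_eq_left (by linarith : -t ≤ 1)]
      have ha1 := le_max_left 1 (-s)
      have ha2 := le_max_right 1 (-s)
      have hc0 : 0 < max 1 (-(s + t)) := one_pos.trans_le (le_max_left _ _)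
      have hca : max 1 (-(s + t)) ≤ max 1 (-s) := max_le_max_left _ (by linarith)
      have hcJ : max 1 (-(s + t)) ≤ jap (s + t) :=
        max_le hJ ((neg_le_abs _).trans (abs_le_jap _))
      have hjs := jap_le_one_add_abs s
      rw [abs_of_neg hs] at hjs
      have hjs2 : jap s ≤ 2 * max 1 (-s) := by linarith
      calc max 1 (-(s + t)) ^ 10 * jap s
          = max 1 (-(s + t)) ^ 9 * (max 1 (-(s + t)) * jap s) := by ring
        _ ≤ max 1 (-s) ^ 9 * (jap (s + t) * (2 * max 1 (-s))) := by
            have := jap_pos s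
            gcongr
        _ = 2 * (jap (s + t) * max 1 (-s) ^ 10) := by ring
        _ ≤ 2 ^ 10 * (jap (s + t) * (max 1 (-s) ^ 10 * 1 ^ 10)) := by
            have : 0 ≤ jap (s + t) * max 1 (-s) ^ 10 := by positivity
            rw [one_pow, mul_one]
            linarith

theorem weight_add_mul_max_jap_le (q r : Freq) :
    weight (q + r) * max (jap q.1) (jap r.1) ≤
      2 ^ 10 * (jap (q + r).1 * (weight q * weight r)) := by
  rcases le_total |r.1| |q.1| with h | h
  · rw [max_eq_left (jap_le_jap h)]
    exact weight_add_mul_jap_le h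
  · rw [max_eq_right (jap_le_jap h), add_comm q r, mul_comm (weight q)]
    exact weight_add_mul_jap_le h

/-- The kernel of the bilinear estimate, for weighted functions: the weights of the inputs are
divided out, that of the output is multiplied. -/
noncomputable def mainKernel (q r : Freq) : ℝ :=
  weight (q + r) / (weight q * weight r) * (modulation (q + r))⁻¹

/-- The part of the kernel whose output is placed in `X̂^{-1,1/2,1}`. -/
noncomputable def xKernel (q r : Freq) : ℝ :=
  jap (q + r).2 * modulation (q + r) ^ (-(9 / 16) : ℝ) *
    ((jap (q + r).2 ^ (-(3 / 4) : ℝ) * modulation (q + r) ^ (-(9 / 16) : ℝ) +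
      modulation (q + r) ^ (-(7 / 16) : ℝ) * modulation r ^ (-(7 / 16) : ℝ) +
      modulation (q + r) ^ (-(7 / 16) : ℝ) * modulation q ^ (-(7 / 16) : ℝ)) * (rho q * rho r))

/-- A kernel with output in the energy space: the first term by Hilbert's inequality in the time
frequency, the second by the energy norms of the two inputs. -/
noncomputable def energyKernel (q r : Freq) : ℝ :=
  (max (jap q.1) (jap r.1))⁻¹ * (rho q * rho r) + (jap q.2)⁻¹ * (jap r.2)⁻¹

/-- A kernel with output in `L²`: the first summand by bilinear `L²` estimates for the inputs with
the weight `ρ`, the second by Young's inequality. -/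
noncomputable def squareKernel (q r : Freq) : ℝ :=
  (jap (q + r).2 ^ (-(3 / 4) : ℝ) * modulation (q + r) ^ (-(9 / 16) : ℝ) +
      modulation q ^ (-(1 / 2) : ℝ) * modulation r ^ (-(1 / 2) : ℝ)) * (rho q * rho r) +
    (rho q * ((jap r.2)⁻¹ * (jap r.2)⁻¹) + (jap q.2)⁻¹ * (jap q.2)⁻¹ * rho r)

theorem mainKernel_comm (q r : Freq) : mainKernel q r = mainKernel r q := by
  rw [mainKernel, mainKernel, add_comm q r, mul_comm (weight q)]

theorem xKernel_comm (q r : Freq) : xKernel q r = xKernel r q := by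
  rw [xKernel, xKernel, add_comm q r]
  ring

theorem energyKernel_comm (q r : Freq) : energyKernel q r = energyKernel r q := by
  rw [energyKernel, energyKernel, max_comm]
  ring

theorem squareKernel_comm (q r : Freq) : squareKernel q r = squareKernel r q := by
  rw [squareKernel, squareKernel, add_comm q r]
  ring

theorem rho_eq_of_lt {p : Freq} (h : modulation p < jap p.2 ^ 2 / 64) :
    rho p = (jap p.2)⁻¹ * modulation p ^ (1 / 2 : ℝ) := by
  refine min_eq_right ?_
  rw [inv_mul_le_iff₀ (jap_pos _), mul_one, ← Real.sqrt_eq_rpow, Real.sqrt_le_left (jap_pos _).le]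
  nlinarith [jap_pos p.2]

theorem rho_ge_of_le {p : Freq} (h : jap p.2 ^ 2 / 64 ≤ modulation p) : 1 / 8 ≤ rho p := by
  refine le_min (by norm_num) ?_
  rw [le_inv_mul_iff₀ (jap_pos _), ← Real.sqrt_eq_rpow]
  refine Real.le_sqrt_of_sq_le ?_
  linarith

/-- Near the parabola the time frequency is positive and comparable to `⟨ξ⟩²`. -/
theorem le_fst_of_modulation_lt {p : Freq} (h : modulation p < jap p.2 ^ 2 / 64) :
    62 / 64 * jap p.2 ^ 2 ≤ p.1 := by
  have h1 := one_le_modulation p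
  have h2 := abs_le_jap (p.1 - p.2 ^ 2)
  have h3 := neg_abs_le (p.1 - p.2 ^ 2)
  have h4 : modulation p = jap (p.1 - p.2 ^ 2) := rfl
  have h5 := jap_sq p.2
  linarith

theorem weight_eq_one {p : Freq} (h : 0 ≤ p.1) : weight p = 1 := by
  rw [weight, max_eq_left (by linarith), one_pow]

/-- If the second input is close to the parabola, it behaves as a function in `X̂^{-1,1/2}`, and the
second term of `xKernel` simplifies. -/
theorem xKernel_ge_left {q r : Freq} (hr : modulation r < jap r.2 ^ 2 / 64) :
    jap (q + r).2 * (modulation (q + r))⁻¹ * (rho q * (jap r.2)⁻¹) ≤ xKernel q r := by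
  have hx := modulation_pos (q + r)
  have hy := modulation_pos q
  have hz := modulation_pos r
  have hJ := jap_pos (q + r).2
  have hJ2 := jap_pos r.2
  have hρq := rho_pos q
  have hρr := rho_pos r
  have e1 : (modulation (q + r))⁻¹ =
      modulation (q + r) ^ (-(9 / 16) : ℝ) * modulation (q + r) ^ (-(7 / 16) : ℝ) := by
    rw [← Real.rpow_add hx, ← Real.rpow_neg_one]
    norm_num
  have e2 : (jap r.2)⁻¹ ≤ modulation r ^ (-(7 / 16) : ℝ) * rho r := by
    rw [rho_eq_of_lt hr, mul_left_comm, ← Real.rpow_add hz]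
    refine le_mul_of_one_le_right (inv_pos.2 hJ2).le
      (Real.one_le_rpow (one_le_modulation r) (by norm_num))
  rw [e1, xKernel]
  calc jap (q + r).2 * (modulation (q + r) ^ (-(9 / 16) : ℝ) *
        modulation (q + r) ^ (-(7 / 16) : ℝ)) * (rho q * (jap r.2)⁻¹)
      ≤ jap (q + r).2 * (modulation (q + r) ^ (-(9 / 16) : ℝ) *
        modulation (q + r) ^ (-(7 / 16) : ℝ)) *
          (rho q * (modulation r ^ (-(7 / 16) : ℝ) * rho r)) := by gcongr
    _ = jap (q + r).2 * modulation (q + r) ^ (-(9 / 16) : ℝ) *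
        ((modulation (q + r) ^ (-(7 / 16) : ℝ) * modulation r ^ (-(7 / 16) : ℝ)) *
          (rho q * rho r)) := by ring
    _ ≤ _ := by
        have h1 : 0 ≤ jap (q + r).2 ^ (-(3 / 4) : ℝ) * modulation (q + r) ^ (-(9 / 16) : ℝ) := by
          positivity
        have h2 : 0 ≤ modulation (q + r) ^ (-(7 / 16) : ℝ) * modulation q ^ (-(7 / 16) : ℝ) := by
          positivity
        gcongr
        linarith

/-- Both inputs far from the parabola, so that they lie in `L²`. The output is placed in
`X̂^{-1,1/2,1}` if its modulation is at most `⟨ξ⟩²`. Otherwise it lies in `L²` since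
`⟨ξ⟩^{-3/4} ⟨τ - ξ²⟩^{-9/16}` is square integrable, and its energy is estimated with Hilbert's
inequality, where the weight penalizes the cancellation of two large time frequencies. -/
theorem kernel_bound_far_far {q r : Freq} (hq : jap q.2 ^ 2 / 64 ≤ modulation q)
    (hr : jap r.2 ^ 2 / 64 ≤ modulation r) :
    mainKernel q r ≤ 2 ^ 17 * xKernel q r ∨
      (mainKernel q r ≤ 2 ^ 17 * energyKernel q r ∧
        mainKernel q r ≤ 2 ^ 17 * squareKernel q r) := by
  have hx := modulation_pos (q + r)
  have hy := modulation_pos q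
  have hz := modulation_pos r
  have hJ := jap_pos (q + r).2
  have hJ1 := jap_pos q.2
  have hJ2 := jap_pos r.2
  have hρ : 1 / 64 ≤ rho q * rho r := by
    calc (1 / 64 : ℝ) = 1 / 8 * (1 / 8) := by norm_num
      _ ≤ rho q * rho r := mul_le_mul (rho_ge_of_le hq) (rho_ge_of_le hr) (by norm_num)
          (rho_pos q).le
  have hρq := rho_pos q
  have hρr := rho_pos r
  have hw := mul_pos (weight_pos q) (weight_pos r)
  have hk : mainKernel q r ≤ 2 ^ 10 * (modulation (q + r))⁻¹ := by
    have : weight (q + r) / (weight q * weight r) ≤ 2 ^ 10 :=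
      (div_le_iff₀ hw).2 (weight_add_le q r)
    rw [mainKernel]
    gcongr
  rcases le_total (modulation (q + r)) (jap (q + r).2 ^ 2) with h | h
  · left
    have e1 : (modulation (q + r))⁻¹ ≤ jap (q + r).2 * modulation (q + r) ^ (-(9 / 16) : ℝ) *
        (jap (q + r).2 ^ (-(3 / 4) : ℝ) * modulation (q + r) ^ (-(9 / 16) : ℝ)) := by
      have f1 : modulation (q + r) ^ (1 / 8 : ℝ) ≤ jap (q + r).2 ^ (1 / 4 : ℝ) := by
        calc modulation (q + r) ^ (1 / 8 : ℝ) ≤ (jap (q + r).2 ^ 2) ^ (1 / 8 : ℝ) :=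
              Real.rpow_le_rpow hx.le h (by norm_num)
          _ = _ := by rw [← Real.rpow_natCast, ← Real.rpow_mul hJ.le]; norm_num
      have f2 : (modulation (q + r))⁻¹ = modulation (q + r) ^ (1 / 8 : ℝ) *
          (modulation (q + r) ^ (-(9 / 16) : ℝ) * modulation (q + r) ^ (-(9 / 16) : ℝ)) := by
        rw [← Real.rpow_add hx, ← Real.rpow_add hx, ← Real.rpow_neg_one]
        norm_num
      have f3 : jap (q + r).2 ^ (1 / 4 : ℝ) = jap (q + r).2 * jap (q + r).2 ^ (-(3 / 4) : ℝ) := by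
        nth_rewrite 2 [← Real.rpow_one (jap (q + r).2)]
        rw [← Real.rpow_add hJ]
        norm_num
      rw [f2]
      calc _ ≤ jap (q + r).2 ^ (1 / 4 : ℝ) *
            (modulation (q + r) ^ (-(9 / 16) : ℝ) * modulation (q + r) ^ (-(9 / 16) : ℝ)) := by
            gcongr
        _ = _ := by rw [f3]; ring
    have e2 : (modulation (q + r))⁻¹ * (1 / 64) ≤ xKernel q r := by
      calc (modulation (q + r))⁻¹ * (1 / 64)
          ≤ jap (q + r).2 * modulation (q + r) ^ (-(9 / 16) : ℝ) *
            (jap (q + r).2 ^ (-(3 / 4) : ℝ) * modulation (q + r) ^ (-(9 / 16) : ℝ)) *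
              (rho q * rho r) := by gcongr
        _ = jap (q + r).2 * modulation (q + r) ^ (-(9 / 16) : ℝ) *
            ((jap (q + r).2 ^ (-(3 / 4) : ℝ) * modulation (q + r) ^ (-(9 / 16) : ℝ)) *
              (rho q * rho r)) := by ring
        _ ≤ _ := by
            have h1 : 0 ≤ modulation (q + r) ^ (-(7 / 16) : ℝ) *
              modulation r ^ (-(7 / 16) : ℝ) := by positivity
            have h2 : 0 ≤ modulation (q + r) ^ (-(7 / 16) : ℝ) *
              modulation q ^ (-(7 / 16) : ℝ) := by positivity
            rw [xKernel]
            gcongr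
            linarith
    have := inv_pos.2 hx
    linarith
  · right
    constructor
    · have hM : 0 < max (jap q.1) (jap r.1) := (jap_pos _).trans_le (le_max_left _ _)
      have hτ : jap (q + r).1 ≤ 2 * modulation (q + r) := by
        have h1 := jap_le_one_add_abs (q + r).1
        have h2 := abs_le_jap ((q + r).1 - (q + r).2 ^ 2)
        have h3 : modulation (q + r) = jap ((q + r).1 - (q + r).2 ^ 2) := rfl
        have h4 := jap_sq (q + r).2
        have h5 : |(q + r).1| ≤ |(q + r).1 - (q + r).2 ^ 2| + (q + r).2 ^ 2 := by
          have := abs_add_le ((q + r).1 - (q + r).2 ^ 2) ((q + r).2 ^ 2)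
          rwa [sub_add_cancel, abs_of_nonneg (sq_nonneg (q + r).2)] at this
        linarith
      have h1 : mainKernel q r ≤ 2 ^ 11 * (max (jap q.1) (jap r.1))⁻¹ := by
        rw [mainKernel, ← div_eq_mul_inv, ← div_eq_mul_inv, div_div, div_le_div_iff₀
          (mul_pos hw hx) hM]
        calc weight (q + r) * max (jap q.1) (jap r.1)
            ≤ 2 ^ 10 * (jap (q + r).1 * (weight q * weight r)) := weight_add_mul_max_jap_le q r
          _ ≤ 2 ^ 10 * (2 * modulation (q + r) * (weight q * weight r)) := by gcongr
          _ = _ := by ring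
      have h2 : (max (jap q.1) (jap r.1))⁻¹ * (1 / 64) ≤ energyKernel q r := by
        calc (max (jap q.1) (jap r.1))⁻¹ * (1 / 64)
            ≤ (max (jap q.1) (jap r.1))⁻¹ * (rho q * rho r) := by gcongr
          _ ≤ _ := le_add_of_nonneg_right (by positivity)
      linarith
    · have e1 : (modulation (q + r))⁻¹ ≤
          jap (q + r).2 ^ (-(3 / 4) : ℝ) * modulation (q + r) ^ (-(9 / 16) : ℝ) := by
        have f2 : (modulation (q + r))⁻¹ = modulation (q + r) ^ (-(7 / 16) : ℝ) *
            modulation (q + r) ^ (-(9 / 16) : ℝ) := by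
          rw [← Real.rpow_add hx, ← Real.rpow_neg_one]
          norm_num
        have f1 : modulation (q + r) ^ (-(7 / 16) : ℝ) ≤ jap (q + r).2 ^ (-(3 / 4) : ℝ) := by
          calc modulation (q + r) ^ (-(7 / 16) : ℝ) ≤ (jap (q + r).2 ^ 2) ^ (-(7 / 16) : ℝ) :=
                Real.rpow_le_rpow_of_nonpos (by positivity) h (by norm_num)
            _ = jap (q + r).2 ^ (-(7 / 8) : ℝ) := by
                rw [← Real.rpow_natCast, ← Real.rpow_mul hJ.le]; norm_num
            _ ≤ _ := Real.rpow_le_rpow_of_exponent_le (one_le_jap _) (by norm_num)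
        rw [f2]
        gcongr
      have e2 : (modulation (q + r))⁻¹ * (1 / 64) ≤ squareKernel q r := by
        calc (modulation (q + r))⁻¹ * (1 / 64)
            ≤ (jap (q + r).2 ^ (-(3 / 4) : ℝ) * modulation (q + r) ^ (-(9 / 16) : ℝ) +
              modulation q ^ (-(1 / 2) : ℝ) * modulation r ^ (-(1 / 2) : ℝ)) *
                (rho q * rho r) := by
              have h1 : 0 ≤ modulation q ^ (-(1 / 2) : ℝ) * modulation r ^ (-(1 / 2) : ℝ) := by
                positivity
              gcongr
              linarith
          _ ≤ _ := le_add_of_nonneg_right (by positivity)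
      have := inv_pos.2 hx
      linarith

/-- One input far from the parabola and one close to it. If the output frequency is much smaller
than that of the second input, then either the output modulation is large, or the first input has
a large negative time frequency and its weight gives the required decay. -/
theorem kernel_bound_far_near {q r : Freq} (hq : jap q.2 ^ 2 / 64 ≤ modulation q)
    (hr : modulation r < jap r.2 ^ 2 / 64) :
    mainKernel q r ≤ 2 ^ 17 * xKernel q r ∨
      (mainKernel q r ≤ 2 ^ 17 * energyKernel q r ∧
        mainKernel q r ≤ 2 ^ 17 * squareKernel q r) := by
  have hx := modulation_pos (q + r)
  have hy := modulation_pos q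
  have hz := modulation_pos r
  have hJ := jap_pos (q + r).2
  have hJ1 := jap_pos q.2
  have hJ2 := jap_pos r.2
  have hρq := rho_pos q
  have hρr := rho_pos r
  have hρ := rho_ge_of_le hq
  have hτ := le_fst_of_modulation_lt hr
  have hsqpos : 0 < jap r.2 ^ 2 := by positivity
  have hwr : weight r = 1 := weight_eq_one (by linarith)
  have hm0 : 0 < max 1 (-q.1) := one_pos.trans_le (le_max_left _ _)
  have hm1 : 0 < max 1 (-(q + r).1) := one_pos.trans_le (le_max_left _ _)
  have hm : max 1 (-(q + r).1) ≤ max 1 (-q.1) :=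
    max_le_max_left _ (by simp only [Prod.fst_add]; linarith)
  have hratio : weight (q + r) / (weight q * weight r) =
      (max 1 (-(q + r).1) / max 1 (-q.1)) ^ 10 := by
    rw [hwr, mul_one, weight, weight, div_pow]
  have hratio1 : max 1 (-(q + r).1) / max 1 (-q.1) ≤ 1 := (div_le_one hm0).2 hm
  have hratio0 : 0 ≤ max 1 (-(q + r).1) / max 1 (-q.1) := by positivity
  have hk : mainKernel q r ≤ (modulation (q + r))⁻¹ := by
    rw [mainKernel, hratio]
    exact mul_le_of_le_one_left (inv_pos.2 hx).le (pow_le_one₀ hratio0 hratio1)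
  rcases le_or_gt (jap r.2) (4 * jap (q + r).2) with h | h
  · left
    have h1 : (modulation (q + r))⁻¹ * (1 / 32) ≤ xKernel q r := by
      calc (modulation (q + r))⁻¹ * (1 / 32)
          = (modulation (q + r))⁻¹ * (1 / 8) * (1 / 4) := by ring
        _ ≤ (modulation (q + r))⁻¹ * rho q * (jap (q + r).2 * (jap r.2)⁻¹) := by
            have : 1 / 4 ≤ jap (q + r).2 * (jap r.2)⁻¹ := by
              rw [le_mul_inv_iff₀ hJ2]
              linarith
            gcongr
        _ = jap (q + r).2 * (modulation (q + r))⁻¹ * (rho q * (jap r.2)⁻¹) := by ring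
        _ ≤ _ := xKernel_ge_left hr
    have := inv_pos.2 hx
    linarith
  · right
    have hJ12 : jap q.2 ≤ 2 * jap r.2 := by
      have := jap_le_add q.2 r.2
      rw [Prod.snd_add] at h
      linarith
    have hk2 : mainKernel q r ≤ 4 * ((jap r.2)⁻¹ * (jap r.2)⁻¹) := by
      have e : (jap r.2)⁻¹ * (jap r.2)⁻¹ = (jap r.2 ^ 2)⁻¹ := by rw [sq, mul_inv]
      rw [e]
      rcases le_or_gt (jap r.2 ^ 2) (4 * modulation (q + r)) with h2 | h2
      · refine hk.trans ?_
        rw [← div_eq_mul_inv, le_div_iff₀ hsqpos, inv_mul_le_iff₀ hx]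
        linarith
      · have hq1 : jap r.2 ^ 2 / 2 ≤ -q.1 := by
          have h3 := abs_le_jap ((q + r).1 - (q + r).2 ^ 2)
          have h4 : modulation (q + r) = jap ((q + r).1 - (q + r).2 ^ 2) := rfl
          have h5 := le_abs_self ((q + r).1 - (q + r).2 ^ 2)
          have h6 := jap_sq (q + r).2
          have h7 : jap (q + r).2 ^ 2 ≤ jap r.2 ^ 2 / 16 := by nlinarith
          have h8 : (q + r).1 = q.1 + r.1 := rfl
          linarith
        have hq2 : jap r.2 ^ 2 / 2 ≤ max 1 (-q.1) := hq1.trans (le_max_right _ _)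
        calc mainKernel q r
            ≤ max 1 (-(q + r).1) / max 1 (-q.1) * (modulation (q + r))⁻¹ := by
              rw [mainKernel, hratio]
              gcongr
              exact pow_le_of_le_one hratio0 hratio1 (by norm_num)
          _ ≤ modulation (q + r) / (jap r.2 ^ 2 / 2) * (modulation (q + r))⁻¹ := by
              gcongr
              exact max_one_neg_le_modulation (q + r)
          _ = 2 * (jap r.2 ^ 2)⁻¹ := by
              field_simp
          _ ≤ 4 * (jap r.2 ^ 2)⁻¹ := by
              have := inv_pos.2 hsqpos
              linarith
    have hpos : 0 < (jap r.2)⁻¹ * (jap r.2)⁻¹ := by positivity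
    constructor
    · have h1 : (jap r.2)⁻¹ * (jap r.2)⁻¹ * (1 / 2) ≤ energyKernel q r := by
        calc (jap r.2)⁻¹ * (jap r.2)⁻¹ * (1 / 2) = (2 * jap r.2)⁻¹ * (jap r.2)⁻¹ := by
              rw [mul_inv]; ring
          _ ≤ (jap q.2)⁻¹ * (jap r.2)⁻¹ := by gcongr
          _ ≤ _ := by
              have hM : 0 < max (jap q.1) (jap r.1) := (jap_pos _).trans_le (le_max_left _ _)
              exact le_add_of_nonneg_left (by positivity)
      linarith
    · have h1 : 1 / 8 * ((jap r.2)⁻¹ * (jap r.2)⁻¹) ≤ squareKernel q r := by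
        calc 1 / 8 * ((jap r.2)⁻¹ * (jap r.2)⁻¹) ≤ rho q * ((jap r.2)⁻¹ * (jap r.2)⁻¹) := by
              gcongr
          _ ≤ rho q * ((jap r.2)⁻¹ * (jap r.2)⁻¹) + (jap q.2)⁻¹ * (jap q.2)⁻¹ * rho r :=
              le_add_of_nonneg_right (by positivity)
          _ ≤ _ := le_add_of_nonneg_left (by positivity)
      linarith

/-- Both inputs close to the parabola, a small output modulation, and the frequency of the first
input at least that of the second: by the resonance identity the first modulation is at least the
product of the frequencies. -/
theorem kernel_bound_resonant {q r : Freq} (hq : modulation q < jap q.2 ^ 2 / 64)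
    (hr : modulation r < jap r.2 ^ 2 / 64) (hx2 : modulation (q + r) < jap q.2 * jap r.2 / 2)
    (hle : jap r.2 ≤ jap q.2) : (modulation (q + r))⁻¹ ≤ 2 * xKernel q r := by
  have hx := modulation_pos (q + r)
  have hJ := jap_pos (q + r).2
  have hJ1 := jap_pos q.2
  have hJ2 := jap_pos r.2
  have hy1 := one_le_modulation q
  have hz1 := one_le_modulation r
  have hs1 := jap_sq q.2
  have hs2 := jap_sq r.2
  have hprod : 63 / 64 * (jap q.2 * jap r.2) ≤ |q.2 * r.2| := by
    refine abs_le_of_sq_le_sq' ?_ (abs_nonneg _) |>.2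
    rw [sq_abs, mul_pow, mul_pow, mul_pow]
    have h1 : 63 / 64 * jap q.2 ^ 2 ≤ q.2 ^ 2 := by linarith
    have h2 : 63 / 64 * jap r.2 ^ 2 ≤ r.2 ^ 2 := by linarith
    calc (63 / 64) ^ 2 * (jap q.2 ^ 2 * jap r.2 ^ 2)
        = (63 / 64 * jap q.2 ^ 2) * (63 / 64 * jap r.2 ^ 2) := by ring
      _ ≤ q.2 ^ 2 * r.2 ^ 2 := by gcongr
  have hres : jap q.2 * jap r.2 ≤ modulation q := by
    have a1 := abs_le_jap (q.1 - q.2 ^ 2)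
    have a2 : |(q + r).1 - (q + r).2 ^ 2| ≤ modulation (q + r) := abs_le_jap _
    have a3 : |r.1 - r.2 ^ 2| ≤ modulation r := abs_le_jap _
    have hid : 2 * (q.2 * r.2) =
        (q.1 - q.2 ^ 2) + (r.1 - r.2 ^ 2) - ((q + r).1 - (q + r).2 ^ 2) := by
      simp only [Prod.fst_add, Prod.snd_add]
      ring
    have a4 : 2 * |q.2 * r.2| ≤
        |q.1 - q.2 ^ 2| + |r.1 - r.2 ^ 2| + |(q + r).1 - (q + r).2 ^ 2| := by
      have h2 : |2 * (q.2 * r.2)| = 2 * |q.2 * r.2| := by rw [abs_mul, abs_two]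
      rw [← h2, hid]
      exact (abs_sub _ _).trans (add_le_add (abs_add_le _ _) le_rfl)
    have a5 : modulation r ≤ jap q.2 * jap r.2 / 64 := by nlinarith
    have a6 : modulation q = jap (q.1 - q.2 ^ 2) := rfl
    nlinarith
  have hsmall : 64 * jap r.2 ≤ jap q.2 := by
    have : jap q.2 * jap r.2 < jap q.2 * (jap q.2 / 64) := by nlinarith
    have := lt_of_mul_lt_mul_left this hJ1.le
    linarith
  have hJge : jap q.2 ≤ 2 * jap (q + r).2 := by
    have := jap_le_add q.2 r.2
    rw [Prod.snd_add]
    linarith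
  have hρ : (jap q.2)⁻¹ * jap r.2 ≤ rho q := by
    rw [rho_eq_of_lt hq, ← Real.sqrt_eq_rpow]
    refine mul_le_mul_of_nonneg_left (Real.le_sqrt_of_sq_le ?_) (inv_pos.2 hJ1).le
    nlinarith
  have h1 := xKernel_ge_left (q := q) hr
  have h2 : (modulation (q + r))⁻¹ * (1 / 2) ≤
      jap (q + r).2 * (modulation (q + r))⁻¹ * (rho q * (jap r.2)⁻¹) := by
    calc (modulation (q + r))⁻¹ * (1 / 2)
        ≤ (modulation (q + r))⁻¹ * (jap (q + r).2 * (jap q.2)⁻¹) := by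
          have : 1 / 2 ≤ jap (q + r).2 * (jap q.2)⁻¹ := by
            rw [le_mul_inv_iff₀ hJ1]
            linarith
          gcongr
      _ = jap (q + r).2 * (modulation (q + r))⁻¹ *
            ((jap q.2)⁻¹ * jap r.2 * (jap r.2)⁻¹) := by
          field_simp
      _ ≤ _ := by gcongr
  linarith

/-- Both inputs close to the parabola. Their time frequencies are positive, so that the weights are
all `1`. If the output modulation is at least comparable to the product of the brackets of the
spatial frequencies, the output is placed in `Y`; otherwise the resonance identity shows that one
spatial frequency is much larger than the other. -/
theorem kernel_bound_near_near {q r : Freq} (hq : modulation q < jap q.2 ^ 2 / 64)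
    (hr : modulation r < jap r.2 ^ 2 / 64) :
    mainKernel q r ≤ 2 ^ 17 * xKernel q r ∨
      (mainKernel q r ≤ 2 ^ 17 * energyKernel q r ∧
        mainKernel q r ≤ 2 ^ 17 * squareKernel q r) := by
  have hx := modulation_pos (q + r)
  have hy := modulation_pos q
  have hz := modulation_pos r
  have hJ := jap_pos (q + r).2
  have hJ1 := jap_pos q.2
  have hJ2 := jap_pos r.2
  have hρq := rho_pos q
  have hρr := rho_pos r
  have hτq : 0 ≤ q.1 := (by positivity : (0 : ℝ) ≤ 62 / 64 * jap q.2 ^ 2).trans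
    (le_fst_of_modulation_lt hq)
  have hτr : 0 ≤ r.1 := (by positivity : (0 : ℝ) ≤ 62 / 64 * jap r.2 ^ 2).trans
    (le_fst_of_modulation_lt hr)
  have hk : mainKernel q r = (modulation (q + r))⁻¹ := by
    rw [mainKernel, weight_eq_one hτq, weight_eq_one hτr, weight_eq_one (add_nonneg hτq hτr)]
    norm_num
  rcases le_or_gt (jap q.2 * jap r.2 / 2) (modulation (q + r)) with h | h
  · right
    have hk2 : mainKernel q r ≤ 2 * ((jap q.2)⁻¹ * (jap r.2)⁻¹) := by
      rw [hk, ← mul_inv, ← div_eq_mul_inv, le_div_iff₀ (mul_pos hJ1 hJ2), inv_mul_le_iff₀ hx]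
      linarith
    have hpos : 0 < (jap q.2)⁻¹ * (jap r.2)⁻¹ := by positivity
    constructor
    · have h1 : (jap q.2)⁻¹ * (jap r.2)⁻¹ ≤ energyKernel q r := by
        have hM : 0 < max (jap q.1) (jap r.1) := (jap_pos _).trans_le (le_max_left _ _)
        exact le_add_of_nonneg_left (by positivity)
      linarith
    · have h1 : (jap q.2)⁻¹ * (jap r.2)⁻¹ ≤ squareKernel q r := by
        have e1 : modulation q ^ (-(1 / 2) : ℝ) * rho q = (jap q.2)⁻¹ := by
          rw [rho_eq_of_lt hq, mul_left_comm, ← Real.rpow_add hy]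
          norm_num
        have e2 : modulation r ^ (-(1 / 2) : ℝ) * rho r = (jap r.2)⁻¹ := by
          rw [rho_eq_of_lt hr, mul_left_comm, ← Real.rpow_add hz]
          norm_num
        calc (jap q.2)⁻¹ * (jap r.2)⁻¹
            = modulation q ^ (-(1 / 2) : ℝ) * modulation r ^ (-(1 / 2) : ℝ) *
                (rho q * rho r) := by rw [← e1, ← e2]; ring
          _ ≤ (jap (q + r).2 ^ (-(3 / 4) : ℝ) * modulation (q + r) ^ (-(9 / 16) : ℝ) +
              modulation q ^ (-(1 / 2) : ℝ) * modulation r ^ (-(1 / 2) : ℝ)) *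
                (rho q * rho r) := by
              gcongr
              exact le_add_of_nonneg_left (by positivity)
          _ ≤ _ := le_add_of_nonneg_right (by positivity)
      linarith
  · left
    have hpos := inv_pos.2 hx
    rw [hk]
    rcases le_total (jap r.2) (jap q.2) with hle | hle
    · linarith [kernel_bound_resonant hq hr h hle]
    · have h1 := kernel_bound_resonant hr hq (by rw [add_comm, mul_comm]; exact h) hle
      rw [add_comm r q, xKernel_comm] at h1
      linarith

/-- The kernel of the bilinear estimate is dominated by a kernel with output in `X̂^{-1,1/2,1}` or
by a kernel with output in `Y`, that is, with both energy and `L²` estimates. -/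
theorem kernel_bound (q r : Freq) :
    mainKernel q r ≤ 2 ^ 17 * xKernel q r ∨
      (mainKernel q r ≤ 2 ^ 17 * energyKernel q r ∧
        mainKernel q r ≤ 2 ^ 17 * squareKernel q r) := by
  rcases le_or_gt (jap q.2 ^ 2 / 64) (modulation q) with hq | hq
  · rcases le_or_gt (jap r.2 ^ 2 / 64) (modulation r) with hr | hr
    · exact kernel_bound_far_far hq hr
    · exact kernel_bound_far_near hq hr
  · rcases le_or_gt (jap r.2 ^ 2 / 64) (modulation r) with hr | hr
    · rw [mainKernel_comm, xKernel_comm, energyKernel_comm, squareKernel_comm]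
      exact kernel_bound_far_near hr hq
    · exact kernel_bound_near_near hq hr


/-! ### The bilinear estimate -/

attribute [fun_prop] measurable_jap measurable_modulation measurable_rho

theorem measurable_weight : Measurable weight :=
  (measurable_const.max measurable_fst.neg).pow_const 10

theorem measurable_xKernel : Measurable (Function.uncurry xKernel) := by
  unfold xKernel Function.uncurry
  fun_prop

theorem measurable_energyKernel : Measurable (Function.uncurry energyKernel) := by
  unfold energyKernel Function.uncurry
  fun_prop

theorem measurable_squareKernel : Measurable (Function.uncurry squareKernel) := by
  unfold squareKernel Function.uncurry
  fun_prop

theorem bil_mul_right (κ : Freq → Freq → ℝ≥0∞) (a b u v : Freq → ℝ≥0∞) (p : Freq) :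
    bil (fun q r => κ q r * (a q * b r)) u v p =
      bil κ (fun q => a q * u q) (fun r => b r * v r) p := by
  refine lintegral_congr fun q => ?_
  dsimp only
  ring

theorem bil_mul_sum {a : Freq → ℝ≥0∞} (ha : ∀ p, a p ≠ ∞) (κ : Freq → Freq → ℝ≥0∞)
    (u v : Freq → ℝ≥0∞) (p : Freq) :
    bil (fun q r => a (q + r) * κ q r) u v p = a p * bil κ u v p := by
  unfold bil
  rw [← lintegral_const_mul' _ _ (ha p)]
  refine lintegral_congr fun q => ?_
  dsimp only
  rw [add_sub_cancel, mul_assoc]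

theorem modPow_eq (a : ℝ) (p : Freq) : modPow a p = ENNReal.ofReal (modulation p ^ a) := rfl

theorem xiPow_eq (a : ℝ) (p : Freq) : xiPow a p = ENNReal.ofReal (jap p.2 ^ a) := rfl

/-- The function `u` with the weight `ρ`, in `L²` for `u ∈ Z`. -/
noncomputable def rhoMul (u : Freq → ℝ≥0∞) (p : Freq) : ℝ≥0∞ := ENNReal.ofReal (rho p) * u p

/-- The function `u` with the weight `⟨ξ⟩⁻¹`, in `L²_ξ L¹_τ` for `u ∈ Z`. -/
noncomputable def japMul (u : Freq → ℝ≥0∞) (p : Freq) : ℝ≥0∞ := ENNReal.ofReal (jap p.2)⁻¹ * u p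

theorem measurable_rhoMul {u : Freq → ℝ≥0∞} (hu : Measurable u) : Measurable (rhoMul u) :=
  measurable_rho.ennreal_ofReal.mul hu

theorem measurable_japMul {u : Freq → ℝ≥0∞} (hu : Measurable u) : Measurable (japMul u) :=
  measurable_ofReal_jap_inv.mul hu

theorem bil_mul_rho (κ : Freq → Freq → ℝ≥0∞) (u v : Freq → ℝ≥0∞) (p : Freq) :
    bil (fun q r => κ q r * (ENNReal.ofReal (rho q) * ENNReal.ofReal (rho r))) u v p =
      bil κ (rhoMul u) (rhoMul v) p :=
  bil_mul_right κ _ _ u v p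

theorem measurable_mul_rho {κ : Freq → Freq → ℝ≥0∞} (hκ : Measurable (Function.uncurry κ)) :
    Measurable (Function.uncurry fun q r =>
      κ q r * (ENNReal.ofReal (rho q) * ENNReal.ofReal (rho r))) :=
  hκ.mul ((measurable_rho.ennreal_ofReal.comp measurable_fst).mul
    (measurable_rho.ennreal_ofReal.comp measurable_snd))

/-- The kernel of `xKernel`, between `L²` spaces. -/
noncomputable def xCore (q r : Freq) : ℝ≥0∞ :=
  xiPow (-(3 / 4)) (q + r) * modPow (-(9 / 16)) (q + r) +
    modPow (-(7 / 16)) (q + r) * modPow (-(7 / 16)) r +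
    modPow (-(7 / 16)) (r + q) * modPow (-(7 / 16)) q

theorem measurable_xiPow_modPow_sum : Measurable (Function.uncurry fun q r : Freq =>
    xiPow (-(3 / 4)) (q + r) * modPow (-(9 / 16)) (q + r)) :=
  ((measurable_xiPow _).comp measurable_add_freq).mul
    ((measurable_modPow _).comp measurable_add_freq)

theorem l2Bounded_xCore : L2Bounded xCore := by
  have hm : Measurable (Function.uncurry fun q r : Freq =>
      modPow (-(7 / 16)) (q + r) * modPow (-(7 / 16)) r) :=
    ((measurable_modPow _).comp measurable_add_freq).mul
      ((measurable_modPow _).comp measurable_snd)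
  have hm' : Measurable (Function.uncurry fun q r : Freq =>
      modPow (-(7 / 16)) (r + q) * modPow (-(7 / 16)) q) :=
    ((measurable_modPow _).comp (measurable_snd.add measurable_fst)).mul
      ((measurable_modPow _).comp measurable_fst)
  have hm'' : Measurable (Function.uncurry fun q r : Freq =>
      xiPow (-(3 / 4)) (q + r) * modPow (-(9 / 16)) (q + r) +
        modPow (-(7 / 16)) (q + r) * modPow (-(7 / 16)) r) :=
    measurable_xiPow_modPow_sum.add hm
  have h : L2Bounded fun q r => modPow (-(7 / 16)) (r + q) * modPow (-(7 / 16)) q :=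
    l2Bounded_modPow_sum_mul_modPow.swap
  have h' := l2Bounded_xiPow_modPow_sum.add l2Bounded_modPow_sum_mul_modPow
    measurable_xiPow_modPow_sum hm
  exact h'.add h hm'' hm'

theorem ofReal_xKernel (q r : Freq) : ENNReal.ofReal (xKernel q r) =
    ENNReal.ofReal (jap (q + r).2 * modulation (q + r) ^ (-(9 / 16) : ℝ)) *
      (xCore q r * (ENNReal.ofReal (rho q) * ENNReal.ofReal (rho r))) := by
  have hρ := rho_pos q
  have hρ' := rho_pos r
  have hj := jap_pos (q + r).2
  have hx := modulation_pos (q + r)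
  have hy := modulation_pos q
  have hz := modulation_pos r
  rw [xCore, add_comm r q, modPow_eq, modPow_eq, modPow_eq, modPow_eq, xiPow_eq, xKernel]
  generalize jap (q + r).2 = J at *
  generalize modulation (q + r) = a at *
  generalize modulation q = b at *
  generalize modulation r = c at *
  rw [← ENNReal.ofReal_mul (by positivity),
    ← ENNReal.ofReal_mul (by positivity),
    ← ENNReal.ofReal_mul (by positivity), ← ENNReal.ofReal_mul (by positivity),
    ← ENNReal.ofReal_add (by positivity) (by positivity),
    ← ENNReal.ofReal_add (by positivity) (by positivity),
    ← ENNReal.ofReal_mul (by positivity), ← ENNReal.ofReal_mul (by positivity)]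

/-- The factor in front of `xKernel` cancels against the weight of `X̂^{-1,9/16}`. -/
theorem xWeight_mul_ofReal (p : Freq) :
    xWeight (9 / 16) p * ENNReal.ofReal (jap p.2 * modulation p ^ (-(9 / 16) : ℝ)) = 1 := by
  have hj := jap_pos p.2
  have hy := modulation_pos p
  rw [xWeight, ← ENNReal.ofReal_mul (by positivity), mul_mul_mul_comm, inv_mul_cancel₀ hj.ne',
    ← Real.rpow_add hy]
  norm_num

theorem exists_zNorm_bil_xKernel_le : ∃ C : ℝ≥0, ∀ u v : Freq → ℝ≥0∞, Measurable u →
    Measurable v → zNorm (bil (fun q r => ENNReal.ofReal (xKernel q r)) u v) ≤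
      C * (l2norm volume (rhoMul u) * l2norm volume (rhoMul v)) := by
  obtain ⟨C, hC⟩ := exists_besovNorm_le_l2norm_xWeight
  obtain ⟨C', hC'⟩ := l2Bounded_xCore
  refine ⟨C * C', fun u v hu hv => ?_⟩
  have hX : Measurable (Function.uncurry fun q r => ENNReal.ofReal (xKernel q r)) :=
    measurable_xKernel.ennreal_ofReal
  have hm := measurable_bil hX hu hv
  refine (zNorm_le_besovNorm hm.aemeasurable).trans ((hC _ hm.aemeasurable).trans ?_)
  rw [ENNReal.coe_mul, mul_assoc]
  refine mul_le_mul_right (le_trans (le_of_eq ?_)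
    (hC' _ _ (measurable_rhoMul hu) (measurable_rhoMul hv))) _
  congr 1
  funext p
  simp_rw [ofReal_xKernel]
  rw [bil_mul_sum (a := fun p => ENNReal.ofReal (jap p.2 * modulation p ^ (-(9 / 16) : ℝ)))
    (fun _ => ENNReal.ofReal_ne_top), bil_mul_rho, ← mul_assoc, xWeight_mul_ofReal, one_mul]

theorem ofReal_energyKernel (q r : Freq) : ENNReal.ofReal (energyKernel q r) =
    hilbertKernel q.1 r.1 * (ENNReal.ofReal (rho q) * ENNReal.ofReal (rho r)) +
      1 * (ENNReal.ofReal (jap q.2)⁻¹ * ENNReal.ofReal (jap r.2)⁻¹) := by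
  have hρ := rho_pos q
  have hρ' := rho_pos r
  have hj := jap_pos q.2
  have hj' := jap_pos r.2
  have hM : 0 < max (jap q.1) (jap r.1) := (jap_pos _).trans_le (le_max_left _ _)
  rw [energyKernel, hilbertKernel, one_mul]
  generalize max (jap q.1) (jap r.1) = M at *
  rw [ENNReal.ofReal_add (by positivity) (by positivity), ENNReal.ofReal_mul (by positivity),
    ENNReal.ofReal_mul (by positivity), ENNReal.ofReal_mul (by positivity)]

theorem exists_energyNorm_bil_energyKernel_le : ∃ C : ℝ≥0, ∀ u v : Freq → ℝ≥0∞, Measurable u →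
    Measurable v → energyNorm (bil (fun q r => ENNReal.ofReal (energyKernel q r)) u v) ≤
      C * (l2norm volume (rhoMul u) * l2norm volume (rhoMul v)) +
        C * (energyNorm u * energyNorm v) := by
  obtain ⟨C, hC⟩ := exists_energyNorm_bil_hilbert_le
  obtain ⟨C', hC'⟩ := exists_energyNorm_bil_one_le
  refine ⟨max C C', fun u v hu hv => ?_⟩
  have hk : Measurable (Function.uncurry fun q r : Freq => hilbertKernel q.1 r.1) :=
    measurable_hilbertKernel.comp
      ((measurable_fst.comp measurable_fst).prodMk (measurable_fst.comp measurable_snd))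
  have hone : Measurable (Function.uncurry fun _ _ : Freq => (1 : ℝ≥0∞)) := measurable_const
  have hU := measurable_rhoMul hu
  have hV := measurable_rhoMul hv
  have hu' := measurable_japMul hu
  have hv' := measurable_japMul hv
  have heq : bil (fun q r => ENNReal.ofReal (energyKernel q r)) u v = fun p =>
      bil (fun q r => hilbertKernel q.1 r.1) (rhoMul u) (rhoMul v) p +
        bil (fun _ _ => 1) (japMul u) (japMul v) p := by
    funext p
    simp_rw [ofReal_energyKernel]
    rw [bil_add_left (measurable_mul_rho hk) hu hv, bil_mul_rho]
    congr 1
    exact bil_mul_right (fun _ _ => 1) _ _ u v p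
  rw [heq]
  refine (IsFunctionNorm.energyNorm.add_le (measurable_bil hk hU hV).aemeasurable
    (measurable_bil hone hu' hv').aemeasurable).trans (add_le_add ?_ ?_)
  · refine (hC _ _ hU hV).trans (mul_le_mul_left ?_ _)
    exact_mod_cast le_max_left _ _
  · refine (hC' _ _ hu' hv').trans (mul_le_mul_left ?_ _)
    exact_mod_cast le_max_right _ _

/-- The main part of `squareKernel`, between `L²` spaces. -/
noncomputable def squareCore (q r : Freq) : ℝ≥0∞ :=
  xiPow (-(3 / 4)) (q + r) * modPow (-(9 / 16)) (q + r) +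
    modPow (-(1 / 2)) q * modPow (-(1 / 2)) r

theorem measurable_modPow_mul_modPow : Measurable (Function.uncurry fun q r : Freq =>
    modPow (-(1 / 2)) q * modPow (-(1 / 2)) r) :=
  ((measurable_modPow _).comp measurable_fst).mul ((measurable_modPow _).comp measurable_snd)

theorem measurable_squareCore : Measurable (Function.uncurry squareCore) :=
  measurable_xiPow_modPow_sum.add measurable_modPow_mul_modPow

theorem l2Bounded_squareCore : L2Bounded squareCore :=
  l2Bounded_xiPow_modPow_sum.add l2Bounded_modPow_mul_modPow measurable_xiPow_modPow_sum
    measurable_modPow_mul_modPow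

theorem ofReal_squareKernel (q r : Freq) : ENNReal.ofReal (squareKernel q r) =
    squareCore q r * (ENNReal.ofReal (rho q) * ENNReal.ofReal (rho r)) +
      (1 * (ENNReal.ofReal (rho q) *
          (ENNReal.ofReal (jap r.2)⁻¹ * ENNReal.ofReal (jap r.2)⁻¹)) +
        1 * (ENNReal.ofReal (jap q.2)⁻¹ * ENNReal.ofReal (jap q.2)⁻¹ *
          ENNReal.ofReal (rho r))) := by
  have hρ := rho_pos q
  have hρ' := rho_pos r
  have hj := jap_pos q.2
  have hj' := jap_pos r.2
  have hjs := jap_pos (q + r).2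
  have hx := modulation_pos (q + r)
  have hy := modulation_pos q
  have hz := modulation_pos r
  rw [squareCore, one_mul, one_mul, modPow_eq, modPow_eq, modPow_eq, xiPow_eq, squareKernel]
  generalize jap (q + r).2 = J at *
  generalize jap q.2 = J₁ at *
  generalize jap r.2 = J₂ at *
  generalize modulation (q + r) = a at *
  generalize modulation q = b at *
  generalize modulation r = c at *
  rw [← ENNReal.ofReal_mul (by positivity), ← ENNReal.ofReal_mul (by positivity),
    ← ENNReal.ofReal_mul (by positivity), ← ENNReal.ofReal_mul (by positivity),
    ← ENNReal.ofReal_mul (by positivity), ← ENNReal.ofReal_mul (by positivity),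
    ← ENNReal.ofReal_mul (by positivity),
    ← ENNReal.ofReal_add (by positivity) (by positivity),
    ← ENNReal.ofReal_mul (by positivity),
    ← ENNReal.ofReal_add (by positivity) (by positivity),
    ← ENNReal.ofReal_add (by positivity) (by positivity)]

theorem exists_l2norm_bil_squareKernel_le : ∃ C : ℝ≥0, ∀ u v : Freq → ℝ≥0∞, Measurable u →
    Measurable v → l2norm volume (bil (fun q r => ENNReal.ofReal (squareKernel q r)) u v) ≤
      C * (l2norm volume (rhoMul u) * l2norm volume (rhoMul v)) +
        C * (l2norm volume (rhoMul u) * energyNorm v +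
          energyNorm u * l2norm volume (rhoMul v)) := by
  obtain ⟨C, hC⟩ := l2Bounded_squareCore
  obtain ⟨C', hC'⟩ := exists_lintegral_le_energyNorm
  refine ⟨max C C', fun u v hu hv => ?_⟩
  have hU := measurable_rhoMul hu
  have hV := measurable_rhoMul hv
  have hu2 := measurable_japMul (measurable_japMul hu)
  have hv2 := measurable_japMul (measurable_japMul hv)
  have hone : Measurable (Function.uncurry fun _ _ : Freq => (1 : ℝ≥0∞)) := measurable_const
  have hmY : Measurable (Function.uncurry fun q r : Freq => 1 * (ENNReal.ofReal (rho q) *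
      (ENNReal.ofReal (jap r.2)⁻¹ * ENNReal.ofReal (jap r.2)⁻¹))) :=
    hone.mul ((measurable_rho.ennreal_ofReal.comp measurable_fst).mul
      ((measurable_ofReal_jap_inv.mul measurable_ofReal_jap_inv).comp measurable_snd))
  have hsq : ∀ w : Freq → ℝ≥0∞, japMul (japMul w) = fun p =>
      ENNReal.ofReal (jap p.2)⁻¹ * ENNReal.ofReal (jap p.2)⁻¹ * w p :=
    fun w => funext fun p => (mul_assoc _ _ _).symm
  have heq : bil (fun q r => ENNReal.ofReal (squareKernel q r)) u v = fun p =>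
      bil squareCore (rhoMul u) (rhoMul v) p +
        (bil (fun _ _ => 1) (rhoMul u) (japMul (japMul v)) p +
          bil (fun _ _ => 1) (japMul (japMul u)) (rhoMul v) p) := by
    funext p
    simp_rw [ofReal_squareKernel]
    rw [bil_add_left (measurable_mul_rho measurable_squareCore) hu hv, bil_mul_rho,
      bil_add_left hmY hu hv, hsq, hsq]
    congr 2
    · exact bil_mul_right (fun _ _ => 1) _
        (fun r => ENNReal.ofReal (jap r.2)⁻¹ * ENNReal.ofReal (jap r.2)⁻¹) u v p
    · exact bil_mul_right (fun _ _ => 1)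
        (fun r => ENNReal.ofReal (jap r.2)⁻¹ * ENNReal.ofReal (jap r.2)⁻¹) _ u v p
  rw [heq]
  refine (l2norm_add_le (measurable_bil measurable_squareCore hU hV).aemeasurable
    ((measurable_bil hone hU hv2).add (measurable_bil hone hu2 hV)).aemeasurable).trans
    (add_le_add ?_ ?_)
  · refine (hC _ _ hU hV).trans (mul_le_mul_left ?_ _)
    exact_mod_cast le_max_left _ _
  · have hY : ∀ a b : Freq → ℝ≥0∞, Measurable a → Measurable b →
        l2norm volume (bil (fun _ _ => 1) a (japMul (japMul b))) ≤
          (max C C' : ℝ≥0) * (l2norm volume a * energyNorm b) := by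
      intro a b ha hb
      calc l2norm volume (bil (fun _ _ => 1) a (japMul (japMul b)))
          ≤ l2norm volume a * ∫⁻ p, japMul (japMul b) p :=
            l2norm_bil_one_le ha (measurable_japMul (measurable_japMul hb))
        _ ≤ l2norm volume a * (C' * energyNorm b) := mul_le_mul_right (hC' b hb) _
        _ ≤ l2norm volume a * ((max C C' : ℝ≥0) * energyNorm b) := by
            gcongr
            exact le_max_right _ _
        _ = _ := mul_left_comm _ _ _
    rw [mul_add]
    refine (l2norm_add_le (measurable_bil hone hU hv2).aemeasurable
      (measurable_bil hone hu2 hV).aemeasurable).trans (add_le_add (hY _ _ hU hv) ?_)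
    have hcomm : bil (fun _ _ => 1) (japMul (japMul u)) (rhoMul v) =
        bil (fun _ _ => 1) (rhoMul v) (japMul (japMul u)) := funext fun p => bil_comm p
    rw [hcomm, mul_comm (energyNorm u)]
    exact hY _ _ hV hu

/-- The bilinear estimate, for the moduli of the weighted functions. -/
theorem exists_zNorm_bil_mainKernel_le : ∃ C : ℝ≥0, ∀ u v : Freq → ℝ≥0∞, Measurable u →
    Measurable v → zNorm (bil (fun q r => ENNReal.ofReal (mainKernel q r)) u v) ≤
      C * (zNorm u * zNorm v) := by
  obtain ⟨A, hA⟩ := exists_zNorm_bil_xKernel_le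
  obtain ⟨B, hB⟩ := exists_energyNorm_bil_energyKernel_le
  obtain ⟨D, hD⟩ := exists_l2norm_bil_squareKernel_le
  refine ⟨2 ^ 17 * (4 * A + (8 * B + 12 * D)), fun u v hu hv => ?_⟩
  let κ : Freq → Freq → ℝ≥0∞ := fun q r =>
    min (ENNReal.ofReal (energyKernel q r)) (ENNReal.ofReal (squareKernel q r))
  have hκ : Measurable (Function.uncurry κ) :=
    measurable_energyKernel.ennreal_ofReal.min measurable_squareKernel.ennreal_ofReal
  have hX : Measurable (Function.uncurry fun q r => ENNReal.ofReal (xKernel q r)) :=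
    measurable_xKernel.ennreal_ofReal
  have hle : ∀ q r, ENNReal.ofReal (mainKernel q r) ≤
      (2 ^ 17 : ℝ≥0) * (ENNReal.ofReal (xKernel q r) + κ q r) := by
    have hscale : ∀ a b : ℝ, a ≤ 2 ^ 17 * b →
        ENNReal.ofReal a ≤ (2 ^ 17 : ℝ≥0) * ENNReal.ofReal b := by
      intro a b h
      refine (ENNReal.ofReal_le_ofReal h).trans (le_of_eq ?_)
      rw [ENNReal.ofReal_mul (by norm_num), ENNReal.ofReal_pow (by norm_num)]
      simp
    intro q r
    rw [mul_add]
    rcases kernel_bound q r with h | ⟨h, h'⟩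
    · exact le_add_right (hscale _ _ h)
    · refine le_add_left ?_
      rcases min_choice (ENNReal.ofReal (energyKernel q r))
        (ENNReal.ofReal (squareKernel q r)) with hm | hm
      · exact (hscale _ _ h).trans_eq (by simp only [κ, hm])
      · exact (hscale _ _ h').trans_eq (by simp only [κ, hm])
  have mX := measurable_bil hX hu hv
  have mY := measurable_bil hκ hu hv
  have hUz : l2norm volume (rhoMul u) ≤ 2 * zNorm u := l2norm_rho_le_zNorm
  have hVz : l2norm volume (rhoMul v) ≤ 2 * zNorm v := l2norm_rho_le_zNorm
  have hue := energyNorm_le_zNorm u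
  have hve := energyNorm_le_zNorm v
  have h4 : (2 * zNorm u) * (2 * zNorm v) = 4 * (zNorm u * zNorm v) := by ring
  have hXz : zNorm (bil (fun q r => ENNReal.ofReal (xKernel q r)) u v) ≤
      A * (4 * (zNorm u * zNorm v)) := by
    rw [← h4]
    exact (hA u v hu hv).trans (by gcongr)
  have hEz : energyNorm (bil κ u v) ≤
      B * (4 * (zNorm u * zNorm v)) + B * (4 * (zNorm u * zNorm v)) := by
    rw [← h4]
    exact (IsFunctionNorm.energyNorm.mono _ _
      (ae_of_all _ (bil_mono fun q r => min_le_left _ _))).trans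
      ((hB u v hu hv).trans (by gcongr))
  have hSz : l2norm volume (bil κ u v) ≤ D * (4 * (zNorm u * zNorm v)) +
      D * (4 * (zNorm u * zNorm v) + 4 * (zNorm u * zNorm v)) := by
    rw [← h4]
    exact (l2norm_mono (bil_mono fun q r => min_le_right _ _)).trans
      ((hD u v hu hv).trans (by gcongr))
  calc zNorm (bil (fun q r => ENNReal.ofReal (mainKernel q r)) u v)
      ≤ zNorm (fun p => (2 ^ 17 : ℝ≥0) *
          (bil (fun q r => ENNReal.ofReal (xKernel q r)) u v p + bil κ u v p)) :=
        IsFunctionNorm.zNorm.mono _ _ (ae_of_all _ fun p => (bil_mono hle p).trans_eq (by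
          rw [bil_const_mul ENNReal.coe_ne_top, bil_add_left hX hu hv]))
    _ = (2 ^ 17 : ℝ≥0) * zNorm (fun p =>
          bil (fun q r => ENNReal.ofReal (xKernel q r)) u v p + bil κ u v p) :=
        IsFunctionNorm.zNorm.const_mul _ _ (mX.add mY).aemeasurable
    _ ≤ (2 ^ 17 : ℝ≥0) * (zNorm (bil (fun q r => ENNReal.ofReal (xKernel q r)) u v) +
          (energyNorm (bil κ u v) + l2norm volume (bil κ u v))) := by
        refine mul_le_mul_right ((IsFunctionNorm.zNorm.add_le mX.aemeasurable
          mY.aemeasurable).trans ?_) _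
        exact add_le_add le_rfl (zNorm_le_energyNorm_add mY.aemeasurable)
    _ ≤ (2 ^ 17 : ℝ≥0) * (A * (4 * (zNorm u * zNorm v)) +
          ((B * (4 * (zNorm u * zNorm v)) + B * (4 * (zNorm u * zNorm v))) +
          (D * (4 * (zNorm u * zNorm v)) +
            D * (4 * (zNorm u * zNorm v) + 4 * (zNorm u * zNorm v))))) := by
        gcongr
    _ = _ := by
        push_cast
        ring


/-! ### Reasonable functions -/

namespace IsReasonable

variable {f g : Freq → ℂ}

theorem aestronglyMeasurable (hf : IsReasonable f) : AEStronglyMeasurable f volume := hf.1.1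

theorem memLp (hf : IsReasonable f) (p : ℝ≥0∞) : MemLp f p volume :=
  hf.1.mono_exponent_of_measure_support_ne_top (fun _ => image_eq_zero_of_notMem_tsupport)
    hf.2.measure_lt_top.ne le_top

theorem integrable (hf : IsReasonable f) : Integrable f volume :=
  memLp_one_iff_integrable.1 (hf.memLp 1)

theorem l2norm_mul_ne_top (hf : IsReasonable f) {w : Freq → ℝ} (hw : Continuous w) :
    l2norm volume (fun p => ENNReal.ofReal (w p) * ‖f p‖ₑ) ≠ ∞ := by
  obtain ⟨B, hB⟩ := (IsCompact.bddAbove_image hf.2 hw.continuousOn)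
  have h2 := (hf.memLp 2).2.ne
  rw [eLpNorm_two_eq] at h2
  refine ne_top_of_le_ne_top (ENNReal.mul_ne_top (ENNReal.ofReal_ne_top (r := B)) h2) ?_
  rw [← l2norm_const_mul _ hf.aestronglyMeasurable.enorm]
  refine l2norm_mono fun p => ?_
  by_cases hp : p ∈ tsupport f
  · gcongr
    exact hB (mem_image_of_mem _ hp)
  · simp [image_eq_zero_of_notMem_tsupport hp]

theorem aestronglyMeasurable_conv (hf : IsReasonable f) (hg : IsReasonable g) :
    AEStronglyMeasurable (conv f g) volume :=
  (hf.integrable.integrable_convolution (ContinuousLinearMap.mul ℂ ℂ) hg.integrable).1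

end IsReasonable

/-! ### The norm of the main space -/

/-- The norm of the main space, as a function of the modulus: a multiple of the norm of `Z`, with
the weight `w`. -/
noncomputable def mainNorm (c : ℝ≥0) (u : Freq → ℝ≥0∞) : ℝ≥0∞ :=
  c * zNorm (fun p => ENNReal.ofReal (weight p) * u p)

theorem IsFunctionNorm.mainNorm (c : ℝ≥0) : IsFunctionNorm volume (mainNorm c) :=
  (IsFunctionNorm.zNorm.comp_mul measurable_weight.ennreal_ofReal.aemeasurable
    fun _ => ENNReal.ofReal_ne_top).smul c

theorem mainNorm_eq_zero {c : ℝ≥0} (hc : 0 < c) {u : Freq → ℝ≥0∞} (hu : AEMeasurable u volume)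
    (h : mainNorm c u = 0) : u =ᵐ[volume] 0 := by
  have hz := (mul_eq_zero.1 h).resolve_left (by exact_mod_cast hc.ne')
  filter_upwards [zNorm_eq_zero (measurable_weight.ennreal_ofReal.aemeasurable.mul hu) hz]
    with p hp
  exact (mul_eq_zero.1 hp).resolve_left (ENNReal.ofReal_pos.2 (weight_pos p)).ne'

theorem enorm_weight_smul (f : Freq → ℂ) (p : Freq) :
    ‖weight p • f p‖ₑ = ENNReal.ofReal (weight p) * ‖f p‖ₑ := by
  rw [enorm_smul, Real.enorm_eq_ofReal (weight_pos p).le]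

theorem mainNorm_enorm (c : ℝ≥0) {f : Freq → ℂ} (hf : AEStronglyMeasurable f volume) :
    mainNorm c (fun p => ‖f p‖ₑ) = c * normZ (fun p => weight p • f p) := by
  have hwf : AEStronglyMeasurable (fun p => weight p • f p) volume :=
    measurable_weight.aestronglyMeasurable.smul hf
  rw [normZ_eq hwf]
  simp_rw [enorm_weight_smul]
  rfl

theorem energyNorm_le_mainNorm {c : ℝ≥0} (hc : 0 < c) (u : Freq → ℝ≥0∞) :
    energyNorm u ≤ (2 / c : ℝ≥0) * mainNorm c u := by
  calc energyNorm u ≤ energyNorm (fun p => ENNReal.ofReal (weight p) * u p) := by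
        refine IsFunctionNorm.energyNorm.mono _ _ (ae_of_all _ fun p => ?_)
        refine le_mul_of_one_le_left zero_le ?_
        rw [ENNReal.one_le_ofReal]
        exact one_le_weight p
    _ ≤ 2 * zNorm (fun p => ENNReal.ofReal (weight p) * u p) := energyNorm_le_zNorm _
    _ = _ := by
        rw [mainNorm, ← mul_assoc, ← ENNReal.coe_mul, div_mul_cancel₀ _ hc.ne']
        rfl

theorem weight_le_modulation_pow (p : Freq) : weight p ≤ modulation p ^ (10 : ℝ) := by
  rw [weight, show (10 : ℝ) = (10 : ℕ) by norm_num, Real.rpow_natCast]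
  exact pow_le_pow_left₀ (zero_le_one.trans (le_max_left _ _)) (max_one_neg_le_modulation p) 10

/-- Since `w ≤ ⟨τ - ξ²⟩^{10}`, the space `X̂^{-1,100}` embeds into the main space. -/
theorem exists_mainNorm_le (c : ℝ≥0) : ∃ C : ℝ≥0, ∀ u : Freq → ℝ≥0∞, AEMeasurable u volume →
    mainNorm c u ≤ C *
      l2norm volume (fun p =>
        ENNReal.ofReal (jap p.2 ^ (-1 : ℝ) * modulation p ^ (100 : ℝ)) * u p) := by
  obtain ⟨C, hC⟩ := exists_besovNorm_le_l2norm_xWeight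
  refine ⟨c * C, fun u hu => ?_⟩
  have hm := measurable_weight.ennreal_ofReal.aemeasurable.mul hu
  rw [mainNorm, ENNReal.coe_mul, mul_assoc]
  refine mul_le_mul_right ((zNorm_le_besovNorm hm).trans ((hC _ hm).trans ?_)) _
  refine mul_le_mul_right (l2norm_mono fun p => ?_) _
  have hj := jap_pos p.2
  have hy := modulation_pos p
  rw [xWeight, Pi.mul_apply, ← mul_assoc, ← ENNReal.ofReal_mul (by positivity), Real.rpow_neg_one]
  refine mul_le_mul_left (ENNReal.ofReal_le_ofReal ?_) _
  rw [mul_assoc]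
  refine mul_le_mul_of_nonneg_left ?_ (inv_pos.2 hj).le
  calc modulation p ^ (9 / 16 : ℝ) * weight p
      ≤ modulation p ^ (9 / 16 : ℝ) * modulation p ^ (10 : ℝ) := by
        gcongr
        exact weight_le_modulation_pow p
    _ = modulation p ^ (9 / 16 + 10 : ℝ) := (Real.rpow_add hy _ _).symm
    _ ≤ modulation p ^ (100 : ℝ) :=
        Real.rpow_le_rpow_of_exponent_le (one_le_modulation p) (by norm_num)

theorem normXhat_eq (s b : ℝ) (f : Freq → ℂ) : normXhat s b f =
    l2norm volume (fun p => ENNReal.ofReal (jap p.2 ^ s * modulation p ^ b) * ‖f p‖ₑ) := by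
  rw [normXhat, eLpNorm_two_eq]
  congr 1
  funext p
  have hj := jap_pos p.2
  have hy := modulation_pos p
  rw [enorm_smul, Real.enorm_eq_ofReal (by positivity)]

theorem IsReasonable.mainNorm_ne_top {f : Freq → ℂ} (hf : IsReasonable f) (c : ℝ≥0) :
    mainNorm c (fun p => ‖f p‖ₑ) ≠ ∞ := by
  obtain ⟨C, hC⟩ := exists_mainNorm_le c
  refine ne_top_of_le_ne_top (ENNReal.mul_ne_top ENNReal.coe_ne_top (hf.l2norm_mul_ne_top ?_))
    (hC _ hf.aestronglyMeasurable.enorm)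
  exact ((continuous_jap.comp continuous_snd).rpow_const fun p => Or.inl (jap_pos _).ne').mul
    (continuous_modulation.rpow_const fun p => Or.inl (modulation_pos p).ne')

/-- Up to the weights, the modulus of the left-hand side of the bilinear estimate is a convolution
with the kernel `mainKernel`. -/
theorem weight_mul_enorm_conv_le {f g : Freq → ℂ} {u v : Freq → ℝ≥0∞}
    (hf : (fun p => ‖f p‖ₑ) =ᵐ[volume] u) (hg : (fun p => ‖g p‖ₑ) =ᵐ[volume] v) (p : Freq) :
    ENNReal.ofReal (weight p) * ‖(modulation p)⁻¹ • conv f g p‖ₑ ≤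
      bil (fun q r => ENNReal.ofReal (mainKernel q r)) (fun q => ENNReal.ofReal (weight q) * u q)
        (fun r => ENNReal.ofReal (weight r) * v r) p := by
  have hw := weight_pos p
  have hy := modulation_pos p
  have hgp : (fun q => ‖g (p - q)‖ₑ) =ᵐ[volume] fun q => v (p - q) :=
    (quasiMeasurePreserving_sub_left_of_right_invariant volume p).ae_eq_comp hg
  calc ENNReal.ofReal (weight p) * ‖(modulation p)⁻¹ • conv f g p‖ₑ
      = ENNReal.ofReal (weight p * (modulation p)⁻¹) * ‖conv f g p‖ₑ := by
        rw [enorm_smul, Real.enorm_eq_ofReal (by positivity), ← mul_assoc,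
          ENNReal.ofReal_mul (by positivity)]
    _ ≤ ENNReal.ofReal (weight p * (modulation p)⁻¹) * ∫⁻ q, ‖f q‖ₑ * ‖g (p - q)‖ₑ := by
        refine mul_le_mul_right ((enorm_integral_le_lintegral_enorm _).trans_eq ?_) _
        exact lintegral_congr fun q => enorm_mul _ _
    _ = ENNReal.ofReal (weight p * (modulation p)⁻¹) * ∫⁻ q, u q * v (p - q) := by
        congr 1
        refine lintegral_congr_ae ?_
        filter_upwards [hf, hgp] with q h1 h2
        rw [h1, h2]
    _ = _ := by
        rw [← lintegral_const_mul' _ _ ENNReal.ofReal_ne_top]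
        refine lintegral_congr fun q => ?_
        dsimp only
        have h1 := weight_pos q
        have h2 := weight_pos (p - q)
        have hk : weight p * (modulation p)⁻¹ =
            mainKernel q (p - q) * (weight q * weight (p - q)) := by
          rw [mainKernel, add_sub_cancel]
          field_simp
        have hk0 : 0 ≤ mainKernel q (p - q) := by
          rw [mainKernel, add_sub_cancel]
          positivity
        rw [hk, ENNReal.ofReal_mul hk0, ENNReal.ofReal_mul h1.le]
        ring

/-- The bilinear estimate with constant `1`, for a large multiple of the norm of `Z`. -/
theorem exists_mainNorm_conv_le : ∃ c : ℝ≥0, 0 < c ∧ ∀ f g : Freq → ℂ, IsReasonable f →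
    IsReasonable g → mainNorm c (fun p => ‖(modulation p)⁻¹ • conv f g p‖ₑ) ≤
      mainNorm c (fun p => ‖f p‖ₑ) * mainNorm c (fun p => ‖g p‖ₑ) := by
  obtain ⟨C, hC⟩ := exists_zNorm_bil_mainKernel_le
  refine ⟨max C 1, lt_max_of_lt_right one_pos, fun f g hf hg => ?_⟩
  have hfm := hf.aestronglyMeasurable.enorm
  have hgm := hg.aestronglyMeasurable.enorm
  have hN := IsFunctionNorm.mainNorm (max C 1)
  have hW := measurable_weight.ennreal_ofReal
  rw [hN.congr_ae hfm.ae_eq_mk, hN.congr_ae hgm.ae_eq_mk]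
  set u := hfm.mk
  set v := hgm.mk
  have hu : Measurable u := hfm.measurable_mk
  have hv : Measurable v := hgm.measurable_mk
  calc mainNorm (max C 1) (fun p => ‖(modulation p)⁻¹ • conv f g p‖ₑ)
      ≤ (max C 1 : ℝ≥0) * (C * (zNorm (fun q => ENNReal.ofReal (weight q) * u q) *
          zNorm (fun r => ENNReal.ofReal (weight r) * v r))) := by
        refine mul_le_mul_right ((IsFunctionNorm.zNorm.mono _ _ (ae_of_all _ fun p =>
          weight_mul_enorm_conv_le hfm.ae_eq_mk hgm.ae_eq_mk p)).trans ?_) _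
        exact hC _ _ (hW.mul hu) (hW.mul hv)
    _ ≤ (max C 1 : ℝ≥0) * ((max C 1 : ℝ≥0) * (zNorm (fun q => ENNReal.ofReal (weight q) * u q) *
          zNorm (fun r => ENNReal.ofReal (weight r) * v r))) := by
        gcongr
        exact le_max_left _ _
    _ = _ := by
        rw [mainNorm, mainNorm]
        ring

/-! ### The main space -/

section Space

variable {W : Type} [NormedAddCommGroup W] [NormedSpace ℂ W] {ι : W →ₗ[ℂ] (Freq →ₘ[volume] ℂ)}
  {N : (Freq → ℝ≥0∞) → ℝ≥0∞}

theorem exists_of_norm_ne_top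
    (hmem : ∀ f : Freq →ₘ[volume] ℂ, N (fun p => ‖f p‖ₑ) ≠ ∞ → ∃ x, ι x = f)
    (hN : IsFunctionNorm volume N) {f : Freq → ℂ} (hf : AEStronglyMeasurable f volume)
    (h : N (fun p => ‖f p‖ₑ) ≠ ∞) : ∃ x : W, (ι x : Freq → ℂ) =ᵐ[volume] f := by
  have hmk := AEEqFun.coeFn_mk f hf
  obtain ⟨x, hx⟩ := hmem (AEEqFun.mk f hf) (by
    rwa [hN.congr_ae (v := fun p => ‖f p‖ₑ) (hmk.mono fun p hp => by rw [hp])])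
  exact ⟨x, by rw [hx]; exact hmk⟩

/-- In a space whose norm is a function norm of the modulus, and which contains all functions of
finite norm, the extended norm is this function norm. -/
theorem extNorm_eq
    (hmem : ∀ f : Freq →ₘ[volume] ℂ, N (fun p => ‖f p‖ₑ) ≠ ∞ → ∃ x, ι x = f)
    (hnorm : ∀ x, ‖x‖ₑ = N (fun p => ‖ι x p‖ₑ)) (hN : IsFunctionNorm volume N) {f : Freq → ℂ}
    (hf : AEStronglyMeasurable f volume) : extNorm ι f = N (fun p => ‖f p‖ₑ) := by
  have hval : ∀ x : W, (ι x : Freq → ℂ) =ᵐ[volume] f → ‖x‖ₑ = N (fun p => ‖f p‖ₑ) := fun x hx => by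
    rw [hnorm]
    exact hN.congr_ae (hx.mono fun p hp => by simp only [hp])
  refine le_antisymm ?_ (le_iInf₂ fun x hx => (hval x hx).ge)
  by_cases h : N (fun p => ‖f p‖ₑ) = ∞
  · rw [h]
    exact le_top
  · obtain ⟨x, hx⟩ := exists_of_norm_ne_top hmem hN hf h
    exact (iInf₂_le x hx).trans (hval x hx).le

/-- The truncation of a function to the set where its argument and its values are at most `n` in
norm. -/
noncomputable def truncation (f : Freq → ℂ) (n : ℕ) : Freq → ℂ :=
  (Metric.closedBall 0 (n : ℝ) ∩ {p | ‖f p‖ ≤ n}).indicator f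

theorem isReasonable_truncation {f : Freq → ℂ} (hf : StronglyMeasurable f) (n : ℕ) :
    IsReasonable (truncation f n) := by
  have hs : MeasurableSet (Metric.closedBall (0 : Freq) (n : ℝ) ∩ {p | ‖f p‖ ≤ n}) :=
    Metric.isClosed_closedBall.measurableSet.inter
      (measurableSet_le hf.norm.measurable measurable_const)
  refine ⟨memLp_top_of_bound (hf.indicator hs).aestronglyMeasurable n (ae_of_all _ fun p => ?_), ?_⟩
  · by_cases hp : p ∈ Metric.closedBall (0 : Freq) (n : ℝ) ∩ {p | ‖f p‖ ≤ n}
    · rw [truncation, indicator_of_mem hp]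
      exact hp.2
    · rw [truncation, indicator_of_notMem hp, norm_zero]
      exact Nat.cast_nonneg n
  · exact HasCompactSupport.of_support_subset_isCompact (isCompact_closedBall (0 : Freq) (n : ℝ))
      (support_indicator_subset.trans inter_subset_left)

theorem tendsto_enorm_sub_truncation (f : Freq → ℂ) (p : Freq) :
    Tendsto (fun n => ‖truncation f n p - f p‖ₑ) atTop (𝓝 0) := by
  obtain ⟨m, hm⟩ := exists_nat_ge (max ‖p‖ ‖f p‖)
  refine tendsto_const_nhds.congr' ?_
  filter_upwards [eventually_ge_atTop m] with n hn
  have hmn : max ‖p‖ ‖f p‖ ≤ n := hm.trans (by exact_mod_cast hn)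
  have hp : p ∈ Metric.closedBall (0 : Freq) (n : ℝ) ∩ {p | ‖f p‖ ≤ n} :=
    ⟨mem_closedBall_zero_iff.2 ((le_max_left _ _).trans hmn), (le_max_right _ _).trans hmn⟩
  rw [truncation, indicator_of_mem hp, sub_self, enorm_zero]

theorem enorm_sub_truncation_le (f : Freq → ℂ) (n : ℕ) (p : Freq) :
    ‖truncation f n p - f p‖ₑ ≤ ‖f p‖ₑ := by
  by_cases hp : p ∈ Metric.closedBall (0 : Freq) (n : ℝ) ∩ {p | ‖f p‖ ≤ n}
  · simp [truncation, indicator_of_mem hp]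
  · simp [truncation, indicator_of_notMem hp]

theorem dense_reasonable
    (hmem : ∀ f : Freq →ₘ[volume] ℂ, N (fun p => ‖f p‖ₑ) ≠ ∞ → ∃ x, ι x = f)
    (hnorm : ∀ x, ‖x‖ₑ = N (fun p => ‖ι x p‖ₑ)) (hN : IsFunctionNorm volume N)
    (hfin : ∀ f : Freq → ℂ, IsReasonable f → N (fun p => ‖f p‖ₑ) ≠ ∞) :
    Dense {x : W | ∃ f : Freq → ℂ, IsReasonable f ∧ (ι x : Freq → ℂ) =ᵐ[volume] f} := by
  intro x
  let f : Freq → ℂ := (ι x : Freq →ₘ[volume] ℂ)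
  have hf : StronglyMeasurable f := AEEqFun.stronglyMeasurable _
  have hr := isReasonable_truncation hf
  choose y hy using fun n =>
    exists_of_norm_ne_top hmem hN (hr n).aestronglyMeasurable (hfin _ (hr n))
  refine mem_closure_of_tendsto (f := y) (b := atTop) ?_
    (Eventually.of_forall fun n => ⟨_, hr n, hy n⟩)
  rw [tendsto_iff_enorm_sub_tendsto_zero]
  have hlim := hN.tendsto_zero (fun n p => ‖truncation f n p - f p‖ₑ) (fun p => ‖f p‖ₑ)
    (fun n => ((hr n).aestronglyMeasurable.sub hf.aestronglyMeasurable).enorm)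
    hf.aestronglyMeasurable.enorm (fun n => ae_of_all _ (enorm_sub_truncation_le f n))
    (by rw [← hnorm x]; exact enorm_ne_top)
    (ae_of_all _ (tendsto_enorm_sub_truncation f))
  refine hlim.congr fun n => ?_
  rw [hnorm, map_sub]
  refine hN.congr_ae ?_
  filter_upwards [hy n, AEEqFun.coeFn_sub (ι (y n)) (ι x)] with p h1 h2
  rw [h2, Pi.sub_apply, h1]

end Space

end FrequencySpace

open FrequencySpace

theorem mainTheorem4 :
    ∃ (W : Type) (_ : NormedAddCommGroup W) (_ : NormedSpace ℂ W) (_ : CompleteSpace W)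
      (ι : W →ₗ[ℂ] (FrequencySpace.Freq →ₘ[volume] ℂ)),
      -- `W` is a space of functions modulo almost everywhere equality
      Function.Injective ι ∧
      -- which contains the reasonable functions, as a dense subspace
      (∀ f : FrequencySpace.Freq → ℂ, FrequencySpace.IsReasonable f →
        ∃ x : W, (ι x : FrequencySpace.Freq → ℂ) =ᵐ[volume] f) ∧
      Dense {x : W | ∃ f : FrequencySpace.Freq → ℂ, FrequencySpace.IsReasonable f ∧
        (ι x : FrequencySpace.Freq → ℂ) =ᵐ[volume] f} ∧
      -- its norm is a multiple of the weighted norm of the sum space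
      (∃ c : ℝ≥0, 0 < c ∧ ∀ f : FrequencySpace.Freq → ℂ, AEStronglyMeasurable f volume →
        FrequencySpace.extNorm ι f =
          c * FrequencySpace.normZ (fun p => FrequencySpace.weight p • f p)) ∧
      -- monotonicity
      (∀ f g : FrequencySpace.Freq → ℂ, AEStronglyMeasurable f volume →
        AEStronglyMeasurable g volume → (∀ᵐ p ∂volume, ‖f p‖ ≤ ‖g p‖) →
        FrequencySpace.extNorm ι f ≤ FrequencySpace.extNorm ι g) ∧
      (∀ f : FrequencySpace.Freq → ℂ, AEStronglyMeasurable f volume →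
        FrequencySpace.extNorm ι f = FrequencySpace.extNorm ι (fun p => ((‖f p‖ : ℝ) : ℂ))) ∧
      -- energy estimate
      (∃ C : ℝ≥0, ∀ f : FrequencySpace.Freq → ℂ, FrequencySpace.IsReasonable f →
        FrequencySpace.normEnergy f ≤ C * FrequencySpace.extNorm ι f) ∧
      -- homogeneous solution estimate
      (∃ C : ℝ≥0, ∀ f : FrequencySpace.Freq → ℂ, FrequencySpace.IsReasonable f →
        FrequencySpace.extNorm ι f ≤ C * FrequencySpace.normXhat (-1) 100 f) ∧
      -- bilinear estimate
      (∀ f g : FrequencySpace.Freq → ℂ, FrequencySpace.IsReasonable f →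
        FrequencySpace.IsReasonable g →
        FrequencySpace.extNorm ι
            (fun p => (FrequencySpace.modulation p)⁻¹ • FrequencySpace.conv f g p) ≤
          FrequencySpace.extNorm ι f * FrequencySpace.extNorm ι g) := by
  obtain ⟨c, hc, hbil⟩ := exists_mainNorm_conv_le
  have hN := IsFunctionNorm.mainNorm c
  obtain ⟨W, i1, i2, i3, ι, hinj, hmem, hnorm⟩ :=
    hN.exists_banachSpace fun u hu => mainNorm_eq_zero hc hu
  have hext : ∀ f : Freq → ℂ, AEStronglyMeasurable f volume →
      extNorm ι f = mainNorm c (fun p => ‖f p‖ₑ) := fun f hf => extNorm_eq hmem hnorm hN hf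
  have hfin : ∀ f : Freq → ℂ, IsReasonable f → mainNorm c (fun p => ‖f p‖ₑ) ≠ ∞ :=
    fun f hf => hf.mainNorm_ne_top c
  refine ⟨W, i1, i2, i3, ι, hinj, fun f hf => exists_of_norm_ne_top hmem hN
    hf.aestronglyMeasurable (hfin f hf), dense_reasonable hmem hnorm hN hfin,
    ⟨c, hc, fun f hf => (hext f hf).trans (mainNorm_enorm c hf)⟩, ?_, ?_, ?_, ?_, ?_⟩
  · intro f g hf hg hfg
    rw [hext f hf, hext g hg]
    exact hN.mono _ _ (hfg.mono fun p hp => enorm_le_iff_norm_le.2 hp)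
  · intro f hf
    rw [hext f hf, hext _ (Complex.continuous_ofReal.comp_aestronglyMeasurable hf.norm)]
    congr 1
    funext p
    simp [← ofReal_norm]
  · refine ⟨2 / c, fun f hf => ?_⟩
    rw [normEnergy_eq, hext f hf.aestronglyMeasurable]
    exact energyNorm_le_mainNorm hc _
  · obtain ⟨C, hC⟩ := exists_mainNorm_le c
    refine ⟨C, fun f hf => ?_⟩
    rw [normXhat_eq, hext f hf.aestronglyMeasurable]
    exact hC _ hf.aestronglyMeasurable.enorm
  · intro f g hf hg
    have hconv : AEStronglyMeasurable (fun p => (modulation p)⁻¹ • conv f g p) volume :=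
      measurable_modulation.inv.aestronglyMeasurable.smul (hf.aestronglyMeasurable_conv hg)
    rw [hext f hf.aestronglyMeasurable, hext g hg.aestronglyMeasurable, hext _ hconv]
    exact hbil f g hf hg
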